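/- Let $G$ be a unimodular connected (finite-dimensional, real, second countable) Lie group with Haar measure $\lambda$, acting in a Borel manner on a standard Borel space $\Omega$ (that is, $(x,\omega)\mapsto x\omega$ is Borel on $G\times\Omega$), and let $d$ be the distance of a right-invariant Riemannian metric on $G$. For $E\subseteq\Omega$ and $\omega\in\Omega$ put $\mathcal O_\omega E=\{x\in G: x\omega\in E\}$, and let $P_E(\omega)$ be the set of those $x\in G$ for which the identity $e$ is the unique $d$-nearest point to $x$ in $\mathcal O_\omega E$ (so $P_E(\omega)=\emptyset$ if $\omega\notin E$). *Definitions.* A *test function* is a non-negative continuous function with compact support. A *Borel invariant Radon $m$-chain* is a family $(\phi_\omega)_{\omega\in\Omega}$ of Radon measures on $G^{m+1}$ such that $\omega\mapsto\int h\,d\phi_\omega$ is Borel for every test function $h$ on $G^{m+1}$, and such that for all $a\in G$, $\omega\in\Omega$ the image of $\phi_{a\omega}$ under $(x_0,\dots,x_m)\mapsto(x_0a,\dots,x_ma)$ is $\phi_\omega$. A *Borel-tame $m$-chain* is a countable sum of such chains. Two families of measures on $G$ indexed by $\Omega$ are *Borel-tamely equidecomposable* if they are the images of one Borel-tame $1$-chain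 under the first and under the second projection $G^2\to G$ respectively. A Borel function $f:\Omega\to[0,\infty]$ *enhanced by* $\frac{d\Lambda}{d\lambda}$, where $\Lambda$ is a right-invariant measure on $G$, is the family of measures $f(x\omega)\,d\Lambda(x)$ on $G$; an ordinary function is regarded as enhanced by $\frac{d\lambda}{d\lambda}$. For a $G$-invariant probability measure $\mu$ on $\Omega$, the *infinitesimal measure* $\frac{d\,\mathrm{count}}{d\lambda}\mu$ is the measure $\nu$ on $\Omega$ such that $$\int_\Omega\sum_{x\in G}h(x)f(x\omega)\,d\mu(\omega)=\int_G h\,d\lambda\cdot\int_\Omega f\,d\nu$$ for all Borel $f:\Omega\to[0,\infty]$ and all test functions $h$ on $G$. *Theorem.* Let $E\subseteq\Omega$ be a Borel set such that $\mathcal O_\omega E$ is non-empty, countable and closed in $G$ for every $\omega\in\Omega$. Then: 1. For every Borel $f:\Omega\to[0,\infty]$, the function $g_f(\omega)=\int_{P_E(\omega)}f(x\omega)\,d\lambda(x)$ is Borel and vanishes outside $E$, and $f$ is Borel-tamely equidecomposable with $g_f$ enhanced by $\frac{d\,\mathrm{count}}{d\lambda}$ (with $f$ as source and the enhanced $g_f$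 as target). 2. For every $G$-invariant probability measure $\mu$ on $\Omega$, the infinitesimal measure $\nu=\frac{d\,\mathrm{count}}{d\lambda}\mu$ exists and is unique, and $\mu$ is recovered from the restriction of $\nu$ to $E$: for every Borel $f:\Omega\to[0,\infty]$, $$\int_\Omega f\,d\mu=\int_E g_f\,d\nu .$$ In particular, two $G$-invariant probability measures on $\Omega$ whose $\frac{d\,\mathrm{count}}{d\lambda}$-infinitesimal measures have the same restriction to $E$ are equal. -/

import Mathlib

open MeasureTheory Manifold Bundle
open scoped ENNReal NNReal ContDiff

noncomputable section

namespace TameChains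

section Metric

variable {E : Type*} [NormedAddCommGroup E] [NormedSpace ℝ E]
  {G : Type*} [Group G] [TopologicalSpace G] [ChartedSpace E G]
  [IsManifold 𝓘(ℝ, E) 1 G]

/-- Right invariance of a smooth Riemannian metric on a Lie group: every right translation
`x ↦ x * a` is an isometry on tangent spaces. -/
def IsRightInvariantMetric
    (g : ContMDiffRiemannianMetric 𝓘(ℝ, E) ∞ E (fun x : G => TangentSpace 𝓘(ℝ, E) x)) : Prop :=
  ∀ (a x : G) (v w : TangentSpace 𝓘(ℝ, E) x),
    g.inner (x * a)
        (mfderiv 𝓘(ℝ, E) 𝓘(ℝ, E) (fun y : G => y * a) x v)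
        (mfderiv 𝓘(ℝ, E) 𝓘(ℝ, E) (fun y : G => y * a) x w)
      = g.inner x v w

/-- The Riemannian distance of the metric `g`: the infimum of the `g`-lengths of `C¹` paths. -/
def riemDist
    (g : ContMDiffRiemannianMetric 𝓘(ℝ, E) ∞ E (fun x : G => TangentSpace 𝓘(ℝ, E) x))
    (x y : G) : ℝ≥0∞ :=
  letI : RiemannianBundle (fun x : G => TangentSpace 𝓘(ℝ, E) x) := ⟨g.toRiemannianMetric⟩
  riemannianEDist 𝓘(ℝ, E) x y

end Metric

section Chains

variable {G : Type*} [Group G] [TopologicalSpace G] [MeasurableSpace G]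
  {Ω : Type*} [MeasurableSpace Ω] [MulAction G Ω]

/-- A Borel measurable invariant Radon `m`-chain: a family `φ p`, `p ∈ Ω`, of measures on
`G ^ (m + 1)` that are finite on compact sets, such that the integral of every test function
(non-negative, continuous, compactly supported) is a Borel function of `p`, and such that right
translating `φ (a • p)` diagonally by `a` gives `φ p`. -/
structure IsRadonChain {m : ℕ} (φ : Ω → Measure (Fin (m + 1) → G)) : Prop where
  finite_on_compacts : ∀ (p : Ω) (K : Set (Fin (m + 1) → G)), IsCompact K → φ p K < ⊤
  borel : ∀ h : (Fin (m + 1) → G) → ℝ≥0, Continuous h → HasCompactSupport h →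
    Measurable fun p => ∫⁻ x, (h x : ℝ≥0∞) ∂(φ p)
  invariant : ∀ (a : G) (p : Ω), (φ (a • p)).map (fun x i => x i * a) = φ p

/-- A Borel-tame `m`-chain: a countable sum of Borel measurable invariant Radon `m`-chains. -/
def IsTameChain {m : ℕ} (φ : Ω → Measure (Fin (m + 1) → G)) : Prop :=
  ∃ ψ : ℕ → Ω → Measure (Fin (m + 1) → G),
    (∀ n, IsRadonChain (ψ n)) ∧ ∀ p, φ p = Measure.sum fun n => ψ n p

/-- The `i`-th vertex of an `m`-chain: the `0`-chain of its images under the `i`-th projection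
(`0`-chains are written as families of measures on `G`). Vertex `0` of a `1`-chain is its source
and vertex `1` its target. -/
def vertex {m : ℕ} (φ : Ω → Measure (Fin (m + 1) → G)) (i : Fin (m + 1)) : Ω → Measure G :=
  fun p => (φ p).map fun x => x i

/-- Two `0`-chains are Borel-tamely equidecomposable when they are the source and the target of one
Borel-tame `1`-chain. -/
def TamelyEquidecomposable (φ₀ φ₁ : Ω → Measure G) : Prop :=
  ∃ Φ : Ω → Measure (Fin (1 + 1) → G), IsTameChain Φ ∧ vertex Φ 0 = φ₀ ∧ vertex Φ 1 = φ₁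

/-- The function `f` enhanced by a measure `Lam` on `G`: the `0`-chain `f (x • p) dLam(x)`. -/
def enhance (Lam : Measure G) (f : Ω → ℝ≥0∞) : Ω → Measure G :=
  fun p => Lam.withDensity fun x => f (x • p)

/-- `ν` is the infinitesimal measure `(dLam/dlam) μ`: for every non-negative Borel function `f`,
the expectation under `μ` of the `0`-chain `f (x • p) dLam(x)` is `(∫ f dν) • lam`, as functionals
on test functions. -/
def IsInfinitesimalMeasure (lam Lam : Measure G) (μ ν : Measure Ω) : Prop :=
  ∀ f : Ω → ℝ≥0∞, Measurable f → ∀ h : G → ℝ≥0, Continuous h → HasCompactSupport h →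
    ∫⁻ p, ∫⁻ x, (h x : ℝ≥0∞) ∂(enhance Lam f p) ∂μ
      = (∫⁻ x, (h x : ℝ≥0∞) ∂lam) * ∫⁻ p, f p ∂ν

end Chains

section Nearest

variable {G : Type*} [Group G] {Ω : Type*} [MulAction G Ω]

/-- The set of `x` in `G` with `x • p ∈ S`. -/
def orbitSet (S : Set Ω) (p : Ω) : Set G := {x | x • p ∈ S}

/-- `y` is the unique point of `A` nearest to `x`, for the distance function `d`. -/
def IsUniqueNearest (d : G → G → ℝ≥0∞) (A : Set G) (x y : G) : Prop :=
  y ∈ A ∧ ∀ z ∈ A, z ≠ y → d x y < d x z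

/-- The cell `P_S(p)`: the points of `G` whose unique nearest point in `orbitSet S p` is `1`
(it is empty unless `p ∈ S`). -/
def cell (d : G → G → ℝ≥0∞) (S : Set Ω) (p : Ω) : Set G :=
  {x | IsUniqueNearest d (orbitSet S p) x 1}

/-- The function `p ↦ ∫_{P_S(p)} f (x • p) dlam(x)`. -/
def cellIntegral [MeasurableSpace G] (d : G → G → ℝ≥0∞) (lam : Measure G) (S : Set Ω)
    (f : Ω → ℝ≥0∞) (p : Ω) : ℝ≥0∞ :=
  ∫⁻ x in cell d S p, f (x • p) ∂lam

end Nearest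

end TameChains

end

/-! The chain behind part 1 moves the density `f (x • p)` from `x` to its nearest point in `orbitSet
S p`. Right invariance of the distance and of `lam` makes this chain invariant. The mass that
reaches a point `y` is the integral over the set of points with unique nearest point `y`; a right
translation turns that set into the cell at `y • p`, so the target is `cellIntegral` enhanced by
counting measure. Three things remain: Borel measurability, tameness, and the fact that almost every
`x` has a unique nearest point.

Measurability: failure to lie in a cell is a projection along `G` of a Borel set. That set splits
into countably many Borel sets with closed sections, so the Kunugui–Novikov theorem and
σ-compactness of `G` make the projection Borel. Nearest points are unique, so Lusin–Souslin handles
the other projections. Tameness: `f` is a countable sum of bounded simple functions, and a bounded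
density gives a Radon chain.

Almost everywhere uniqueness: by Rademacher, the distance function to a closed set is differentiable
almost everywhere. At a point of differentiability, a minimizing curve `w`, translated to start at
`1`, has a velocity determined by conservation of momentum: if `ℓ` is the derivative, the right
logarithmic velocity at `w s` is the gradient dual to `-ℓ ∘ Ad (w s)⁻¹`. All minimizers thus solve
one first-order equation with locally Lipschitz right side, and Grönwall identifies them, hence also
their endpoints (`tendsto_velocity`, `eqOn_of_minimizing`). No geodesic equation or exponential map
is used, only a chart that is isometric to first order at `1`.

Part 2: for fixed `f`, the expected measure `∑ f (x • p) δ_x` is right invariant because `μ` is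
invariant, hence proportional to Haar measure, possibly with infinite factor; the factor defines
`ν`. To recover `μ`, the defining identity is applied to `cellIntegral`. Transporting mass back
along the chain gives a double integral in which invariance of `μ` replaces `x • p` by `p`, and left
invariance of `lam` (unimodularity) removes the nearest point, leaving `∫ h dlam * ∫ f dμ`. -/

section

open MeasureTheory Set Filter Topology Function

/-! ### Novikov separation of countably many analytic sets. -/

section Novikov

variable {α : Type*} [MeasurableSpace α]

/-- A sequence of sets is jointly Borel separable if it can be enlarged to a sequence of measurable
sets with empty intersection. -/
def JointlySeparable (P : ℕ → Set α) : Prop :=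
  ∃ B : ℕ → Set α, (∀ n, P n ⊆ B n) ∧ (∀ n, MeasurableSet (B n)) ∧ ⋂ n, B n = ∅

/-- Take the union over `i` of the enlargements in position `k` and the intersection in every other
position. A point common to all of them lies in `B i k` for one `i`, and then in every `B i n` for
that same `i`. Contrapositively, non-separability survives the passage to some piece of one of the
sets. -/
theorem JointlySeparable.of_iUnion {P : ℕ → Set α} (k : ℕ) (R : ℕ → Set α)
    (hR : P k ⊆ ⋃ i, R i) (h : ∀ i, JointlySeparable (Function.update P k (R i))) :
    JointlySeparable P := by
  choose B hB hBm hBe using h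
  refine ⟨fun n => if n = k then ⋃ i, B i k else ⋂ i, B i n, fun n => ?_, fun n => ?_, ?_⟩
  · by_cases hn : n = k
    · subst hn
      simp only [if_true]
      refine hR.trans (iUnion_mono fun i => ?_)
      simpa using hB i n
    · simp only [hn, if_false]
      refine subset_iInter fun i => ?_
      simpa [hn] using hB i n
  · by_cases hn : n = k
    · simp only [hn, if_true]
      exact MeasurableSet.iUnion fun i => hBm i k
    · simp only [hn, if_false]
      exact MeasurableSet.iInter fun i => hBm i n
  · rw [eq_empty_iff_forall_notMem]
    intro x hx
    rw [mem_iInter] at hx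
    have h1 := hx k
    simp only [if_true, mem_iUnion] at h1
    obtain ⟨i, hi⟩ := h1
    have : x ∈ ⋂ n, B i n := by
      rw [mem_iInter]
      intro n
      by_cases hn : n = k
      · rwa [hn]
      · have := hx n
        simp only [hn, if_false, mem_iInter] at this
        exact this i
    rw [hBe i] at this
    exact this

/-- **Novikov separation**, for ranges of continuous functions on the Baire space. -/
theorem jointlySeparable_range [TopologicalSpace α] [T2Space α] [OpensMeasurableSpace α]
    {f : ℕ → (ℕ → ℕ) → α} (hf : ∀ n, Continuous (f n)) (h : ⋂ n, range (f n) = ∅) :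
    JointlySeparable fun n => range (f n) := by
  by_contra hsep
  -- One sequence `c` codes a point of Baire space for every `n` through the pairing function. At
  -- stage `t` exactly the coordinates with code below `t` are fixed, so each stage refines a single
  -- coordinate of a single set.
  let cyl : ℕ → (ℕ → ℕ) → ℕ → Set (ℕ → ℕ) := fun t c n =>
    {z | ∀ k, Nat.pair n k < t → z k = c (Nat.pair n k)}
  let Q : ℕ → (ℕ → ℕ) → Prop := fun t c => ¬ JointlySeparable fun n => f n '' cyl t c n
  have step : ∀ t c, Q t c → ∃ i, Q (t + 1) (update c t i) := by
    intro t c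
    contrapose!
    intro H
    simp only [Q, not_not] at H ⊢
    refine JointlySeparable.of_iUnion (Nat.unpair t).1
      (fun i => f (Nat.unpair t).1 '' cyl (t + 1) (update c t i) (Nat.unpair t).1) ?_ ?_
    · rintro _ ⟨z, hz, rfl⟩
      refine mem_iUnion.2 ⟨z (Nat.unpair t).2, z, fun k hk => ?_, rfl⟩
      rcases Nat.lt_succ_iff_lt_or_eq.1 hk with hk | hk
      · rw [update_of_ne hk.ne]; exact hz k hk
      · have : k = (Nat.unpair t).2 := by rw [← hk]; simp
        rw [hk, update_self, this]
    · intro i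
      convert H i using 1
      funext n
      by_cases hn : n = (Nat.unpair t).1
      · subst hn; rw [update_self]
      · rw [update_of_ne hn]
        congr 1
        ext z
        refine forall_congr' fun k => ?_
        have hne : Nat.pair n k ≠ t := by
          rintro rfl; simp at hn
        constructor
        · intro hz hk
          rw [update_of_ne hne]
          exact hz (lt_of_le_of_ne (Nat.lt_succ_iff.1 hk) hne)
        · intro hz hk
          have := hz (hk.trans (Nat.lt_succ_self t))
          rwa [update_of_ne hne] at this
  choose! I hI using step
  let p : ℕ → (ℕ → ℕ) := fun t => Nat.rec (fun _ => 0) (fun t c => update c t (I t c)) t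
  have p_succ : ∀ t, p (t + 1) = update (p t) t (I t (p t)) := fun t => rfl
  have hp : ∀ t, Q t (p t) := by
    intro t
    induction t with
    | zero =>
      simp only [Q]
      convert hsep using 3 with n
      simp [cyl]
    | succ t ih => rw [p_succ]; exact hI t _ ih
  let c : ℕ → ℕ := fun t => p (t + 1) t
  have hstat : ∀ j t, j + 1 ≤ t → p t j = c j := by
    intro j
    apply Nat.le_induction
    · rfl
    · intro t ht ih
      rw [p_succ, update_of_ne (by omega), ih]
  have hc : ∀ t, Q t c := by
    intro t
    have := hp t
    simp only [Q] at this ⊢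
    convert this using 4 with n
    ext z
    refine forall_congr' fun k => forall_congr' fun hk => ?_
    rw [hstat _ t hk]
  let z : ℕ → ℕ → ℕ := fun n k => c (Nat.pair n k)
  -- If all the limit points had the same image, that image would lie in the empty intersection. Two
  -- different images have disjoint open neighbourhoods, which separate the family at a late stage
  -- and contradict `hc`.
  have hne : ∃ i j, f i (z i) ≠ f j (z j) := by
    by_contra hcon
    push Not at hcon
    have : f 0 (z 0) ∈ ⋂ n, range (f n) := mem_iInter.2 fun n => ⟨z n, hcon n 0⟩
    rw [h] at this
    exact this
  obtain ⟨i, j, hij⟩ := hne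
  obtain ⟨u, v, u_open, v_open, xu, yv, huv⟩ := t2_separation hij
  have small : ∀ n (w : Set α), IsOpen w → f n (z n) ∈ w →
      ∃ T, ∀ t ≥ T, f n '' cyl t c n ⊆ w := by
    intro n w hw hzw
    have hop : IsOpen (f n ⁻¹' w) := hw.preimage (hf n)
    obtain ⟨s, U, hU, hsU⟩ := isOpen_pi_iff.1 hop (z n) hzw
    refine ⟨s.sup (fun k => Nat.pair n k + 1), fun t ht => ?_⟩
    rintro _ ⟨y, hy, rfl⟩
    apply hsU
    intro k hk
    have h1 : Nat.pair n k + 1 ≤ t :=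
      (Finset.le_sup (f := fun k => Nat.pair n k + 1) hk).trans ht
    rw [hy k h1]
    exact (hU k hk).2
  obtain ⟨T₁, hT₁⟩ := small i u u_open xu
  obtain ⟨T₂, hT₂⟩ := small j v v_open yv
  refine hc (max T₁ T₂) ⟨fun n => if n = i then u else if n = j then v else univ,
    fun n => ?_, fun n => ?_, ?_⟩
  · by_cases hi : n = i
    · subst hi; simpa using hT₁ _ (le_max_left _ _)
    · by_cases hj : n = j
      · subst hj; simpa [hi] using hT₂ _ (le_max_right _ _)
      · simp [hi, hj]
  · by_cases hi : n = i
    · simpa [hi] using u_open.measurableSet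
    · by_cases hj : n = j
      · have : j ≠ i := hj ▸ hi
        simpa [hj, this] using v_open.measurableSet
      · simp [hi, hj]
  · have hji : j ≠ i := by rintro rfl; exact hij rfl
    rw [eq_empty_iff_forall_notMem]
    intro x hx
    rw [mem_iInter] at hx
    have h1 := hx i
    have h2 := hx j
    simp only [if_true, hji, if_false] at h1 h2
    exact (disjoint_left.1 huv) h1 h2

/-- **Novikov separation theorem**: countably many analytic sets with empty intersection can be
enlarged to Borel sets with empty intersection. -/
theorem MeasureTheory.AnalyticSet.jointlySeparable [TopologicalSpace α] [T2Space α]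
    [OpensMeasurableSpace α] {P : ℕ → Set α} (hP : ∀ n, AnalyticSet (P n)) (h : ⋂ n, P n = ∅) :
    JointlySeparable P := by
  by_cases he : ∃ n, P n = ∅
  · obtain ⟨n, hn⟩ := he
    refine ⟨fun k => if k = n then ∅ else univ, fun k => ?_, fun k => ?_, ?_⟩
    · by_cases hk : k = n <;> simp [hk, hn]
    · by_cases hk : k = n <;> simp [hk]
    · rw [eq_empty_iff_forall_notMem]
      intro x hx
      have := mem_iInter.1 hx n
      simp at this
  · push Not at he
    have : ∀ n, ∃ f : (ℕ → ℕ) → α, Continuous f ∧ range f = P n := by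
      intro n
      have := hP n
      rw [AnalyticSet] at this
      exact this.resolve_left (he n).ne_empty
    choose f hf hfr using this
    have : P = fun n => range (f n) := by funext n; rw [hfr]
    rw [this] at h ⊢
    exact jointlySeparable_range hf h

end Novikov

end

section

open MeasureTheory Set Filter Topology Function
open scoped ENNReal NNReal

/-! ### Borel sets with open or closed sections. -/

section ClosedSections

variable {X Y : Type*} [MeasurableSpace X] [StandardBorelSpace X]
  [TopologicalSpace Y] [PolishSpace Y] [MeasurableSpace Y] [BorelSpace Y]

/-- **Kunugui–Novikov theorem**: a Borel set with open vertical sections is a countable union of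
Borel rectangles with open second side. -/
theorem MeasurableSet.exists_eq_iUnion_prod_of_isOpen_sections {B : Set (X × Y)}
    (hB : MeasurableSet B) (hop : ∀ x, IsOpen {y | (x, y) ∈ B}) :
    ∃ (D : ℕ → Set X) (V : ℕ → Set Y), (∀ n, MeasurableSet (D n)) ∧ (∀ n, IsOpen (V n)) ∧
      B = ⋃ n, D n ×ˢ V n := by
  let := upgradeStandardBorel X
  -- The empty set is added only to make the family non-empty, so that it is the range of a
  -- sequence.
  obtain ⟨V, hV⟩ : ∃ V : ℕ → Set Y, insert ∅ (TopologicalSpace.countableBasis Y) = range V :=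
    ((TopologicalSpace.countable_countableBasis Y).insert ∅).exists_eq_range (insert_nonempty _ _)
  have hVo : ∀ n, IsOpen (V n) := by
    intro n
    have : V n ∈ insert ∅ (TopologicalSpace.countableBasis Y) := hV ▸ mem_range_self n
    rcases this with h | h
    · rw [h]; exact isOpen_empty
    · exact TopologicalSpace.isOpen_of_mem_countableBasis h
  -- `W n` is the largest first side for a rectangle over `V n` inside `B`, but it is only
  -- coanalytic. Novikov yields Borel parts `B \ C n` that cover `B` and lie inside these
  -- rectangles; Lusin separation then fits a Borel `D n` between the projection of `B \ C n` and `W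
  -- n`.
  let W : ℕ → Set X := fun n => {x | ∀ y ∈ V n, (x, y) ∈ B}
  have hA : ∀ n, AnalyticSet (B \ (W n ×ˢ V n)) := by
    intro n
    have hm : MeasurableSet {q : (X × Y) × Y | q.1 ∈ B ∧ (q.1.2 ∉ V n ∨
        (q.2 ∈ V n ∧ (q.1.1, q.2) ∉ B))} := by
      have h1 : Measurable fun q : (X × Y) × Y => (q.1.1, q.2) := by fun_prop
      have h2 : Measurable fun q : (X × Y) × Y => q.1.2 := by fun_prop
      exact (measurable_fst hB).inter (((h2 (hVo n).measurableSet).compl).union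
        ((measurable_snd (hVo n).measurableSet).inter (h1 hB).compl))
    have := hm.analyticSet_image (f := Prod.fst) measurable_fst
    convert this using 1
    ext ⟨x, y⟩
    constructor
    · rintro ⟨hxB, hx⟩
      by_cases hy : y ∈ V n
      · have : x ∉ W n := fun h => hx ⟨h, hy⟩
        simp only [W, mem_ofPred_eq, not_forall] at this
        obtain ⟨y', hy', hy''⟩ := this
        exact ⟨((x, y), y'), ⟨hxB, Or.inr ⟨hy', hy''⟩⟩, rfl⟩
      · exact ⟨((x, y), y), ⟨hxB, Or.inl hy⟩, rfl⟩
    · rintro ⟨⟨q, y'⟩, ⟨hq, hq'⟩, rfl⟩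
      refine ⟨hq, fun h => ?_⟩
      rcases hq' with h' | ⟨h', h''⟩
      · exact h' h.2
      · exact h'' (h.1 y' h')
  have hAe : ⋂ n, (B \ (W n ×ˢ V n)) = ∅ := by
    rw [eq_empty_iff_forall_notMem]
    rintro ⟨x, y⟩ hxy
    rw [mem_iInter] at hxy
    have hxB : (x, y) ∈ B := (hxy 0).1
    obtain ⟨v, hv, hyv, hvs⟩ := (TopologicalSpace.isBasis_countableBasis Y).exists_subset_of_mem_open
      (show y ∈ {y | (x, y) ∈ B} from hxB) (hop x)
    have : v ∈ range V := hV ▸ mem_insert_of_mem _ hv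
    obtain ⟨n, rfl⟩ := this
    exact (hxy n).2 ⟨fun y' hy' => hvs hy', hyv⟩
  obtain ⟨C, hAC, hCm, hCe⟩ := AnalyticSet.jointlySeparable hA hAe
  have hsub : ∀ n, B \ C n ⊆ W n ×ˢ V n := by
    intro n q hq
    by_contra h
    exact hq.2 (hAC n ⟨hq.1, h⟩)
  have hsep : ∀ n, MeasurablySeparable (Prod.fst '' (B \ C n)) (W n)ᶜ := by
    intro n
    refine AnalyticSet.measurablySeparable ((hB.diff (hCm n)).analyticSet_image measurable_fst) ?_ ?_
    · have hm : MeasurableSet {q : X × Y | q.2 ∈ V n ∧ q ∉ B} :=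
        (measurable_snd (hVo n).measurableSet).inter hB.compl
      convert hm.analyticSet_image (f := Prod.fst) measurable_fst using 1
      ext x
      simp [W]
    · rw [disjoint_left]
      rintro _ ⟨q, hq, rfl⟩ h
      exact h (hsub n hq).1
  choose D hD hDd hDm using hsep
  refine ⟨D, V, hDm, hVo, ?_⟩
  ext ⟨x, y⟩
  simp only [mem_iUnion, mem_prod]
  constructor
  · intro hxy
    have : (x, y) ∉ ⋂ n, C n := by rw [hCe]; exact notMem_empty _
    rw [mem_iInter, not_forall] at this
    obtain ⟨n, hn⟩ := this
    exact ⟨n, hD n ⟨(x, y), ⟨hxy, hn⟩, rfl⟩, (hsub n ⟨hxy, hn⟩).2⟩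
  · rintro ⟨n, hx, hy⟩
    by_contra h
    exact (disjoint_left.1 (hDd n)) (fun hW => h (hW y hy)) hx

/-- The projection along a σ-compact space of a Borel set with closed sections is Borel. -/
theorem MeasurableSet.image_fst_of_isClosed_sections [SigmaCompactSpace Y] {B : Set (X × Y)}
    (hB : MeasurableSet B) (hcl : ∀ x, IsClosed {y | (x, y) ∈ B}) :
    MeasurableSet (Prod.fst '' B) := by
  obtain ⟨D, V, hD, hV, hBc⟩ := hB.compl.exists_eq_iUnion_prod_of_isOpen_sections
    fun x => (hcl x).isOpen_compl
  -- The section at `x` misses `K` exactly when the open sets `V n` with `x ∈ D n` cover `K`. By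
  -- compactness finitely many suffice, and there are only countably many finite index sets.
  have key : ∀ K : Set Y, IsCompact K → MeasurableSet {x | ∃ y ∈ K, (x, y) ∈ B} := by
    intro K hK
    have : {x | ∃ y ∈ K, (x, y) ∈ B}ᶜ =
        ⋃ F ∈ {F : Finset ℕ | K ⊆ ⋃ n ∈ F, V n}, ⋂ n ∈ F, D n := by
      ext x
      simp only [mem_compl_iff, mem_ofPred_eq, not_exists, not_and, mem_iUnion, mem_iInter,
        exists_prop]
      constructor
      · intro h
        obtain ⟨F, hF⟩ := hK.elim_finite_subcover (fun n : {n // x ∈ D n} => V n) (fun n => hV n)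
          (by
            intro y hy
            have : (x, y) ∈ ⋃ n, D n ×ˢ V n := hBc ▸ h y hy
            obtain ⟨n, hn⟩ := mem_iUnion.1 this
            exact mem_iUnion.2 ⟨⟨n, hn.1⟩, hn.2⟩)
        classical
        refine ⟨F.image Subtype.val, ?_, ?_⟩
        · refine hF.trans ?_
          intro y hy
          simp only [mem_iUnion] at hy ⊢
          obtain ⟨n, hn, hy⟩ := hy
          exact ⟨n.1, Finset.mem_image_of_mem _ hn, hy⟩
        · intro n hn
          obtain ⟨m, _, rfl⟩ := Finset.mem_image.1 hn
          exact m.2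
      · rintro ⟨F, hF, hx⟩ y hy hyB
        obtain ⟨n, hn, hyn⟩ := mem_iUnion₂.1 (hF hy)
        have : (x, y) ∈ Bᶜ := hBc ▸ mem_iUnion.2 ⟨n, hx n hn, hyn⟩
        exact this hyB
    rw [← MeasurableSet.compl_iff, this]
    exact MeasurableSet.biUnion (to_countable _) fun F _ =>
      MeasurableSet.biInter (to_countable _) fun n _ => hD n
  have : Prod.fst '' B = ⋃ j, {x | ∃ y ∈ compactCovering Y j, (x, y) ∈ B} := by
    ext x
    simp only [mem_image, Prod.exists, exists_and_right, exists_eq_right, mem_iUnion, mem_ofPred_eq]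
    constructor
    · rintro ⟨y, hy⟩
      obtain ⟨j, hj⟩ := mem_iUnion.1 (iUnion_compactCovering Y ▸ mem_univ y)
      exact ⟨j, y, hj, hy⟩
    · rintro ⟨j, y, _, hy⟩
      exact ⟨y, hy⟩
  rw [this]
  exact MeasurableSet.iUnion fun j => key _ (isCompact_compactCovering Y j)

end ClosedSections

/-! ### Universal measurability of analytic sets. -/

section UniversallyMeasurable

variable {α : Type*} [TopologicalSpace α] [T2Space α] [MeasurableSpace α] [OpensMeasurableSpace α]

theorem isCompact_setOf_forall_le (c : ℕ → ℕ) : IsCompact {z : ℕ → ℕ | ∀ k, z k ≤ c k} := by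
  have : {z : ℕ → ℕ | ∀ k, z k ≤ c k} = Set.pi univ fun k => Iic (c k) := by
    ext z; simp [Pi.le_def]
  rw [this]
  exact isCompact_univ_pi fun k => (finite_Iic (c k)).isCompact

/-- A neighbourhood of the compact set of sequences bounded by `c` contains all sequences whose
first terms are bounded by those of `c`. -/
theorem exists_setOf_forall_lt_le_subset {c : ℕ → ℕ} {U : Set (ℕ → ℕ)} (hU : IsOpen U)
    (h : {z : ℕ → ℕ | ∀ k, z k ≤ c k} ⊆ U) :
    ∃ m, {z : ℕ → ℕ | ∀ k < m, z k ≤ c k} ⊆ U := by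
  have hloc : ∀ z ∈ {z : ℕ → ℕ | ∀ k, z k ≤ c k}, ∃ m, PiNat.cylinder z m ⊆ U := by
    intro z hz
    obtain ⟨s, V, hV, hsV⟩ := isOpen_pi_iff.1 hU z (h hz)
    refine ⟨s.sup (fun k => k + 1), fun y hy => hsV fun k hk => ?_⟩
    have h1 : k + 1 ≤ s.sup (fun k => k + 1) := Finset.le_sup (f := fun k => k + 1) hk
    rw [PiNat.mem_cylinder_iff.1 hy k h1]
    exact (hV k hk).2
  choose! m hm using hloc
  obtain ⟨t, ht, hcov⟩ := (isCompact_setOf_forall_le c).elim_nhds_subcover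
    (fun z => PiNat.cylinder z (m z))
    (fun z _ => (PiNat.isOpen_cylinder _ z (m z)).mem_nhds (PiNat.self_mem_cylinder z (m z)))
  refine ⟨t.sup m, fun z hz => ?_⟩
  let z' : ℕ → ℕ := fun k => min (z k) (c k)
  have hz' : z' ∈ ⋃ x ∈ t, PiNat.cylinder x (m x) := hcov fun k => min_le_right _ _
  obtain ⟨x, hx, hzx⟩ := mem_iUnion₂.1 hz'
  refine hm x (ht x hx) (PiNat.mem_cylinder_iff.2 fun k hk => ?_)
  rw [← PiNat.mem_cylinder_iff.1 hzx k hk]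
  exact (min_eq_left (hz k (hk.trans_le (Finset.le_sup hx)))).symm

/-- Choquet's capacity argument. The coordinates are bounded one at a time, the `m`-th bound costing
at most `δ m` of mass; continuity of `μ` along increasing unions needs no measurability. The
sequences obeying all bounds form a compact set, whose image is `K`. -/
theorem exists_isCompact_measure_range_le (μ : Measure α) [IsFiniteMeasure μ] {f : (ℕ → ℕ) → α}
    (hf : Continuous f) {ε : ℝ≥0∞} (hε : ε ≠ 0) :
    ∃ K ⊆ range f, IsCompact K ∧ μ (range f) ≤ μ K + ε := by
  obtain ⟨δ, hδ, hδs⟩ := ENNReal.exists_pos_sum_of_countable' hε ℕ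
  let cyl : ℕ → (ℕ → ℕ) → Set (ℕ → ℕ) := fun m c => {z | ∀ k < m, z k ≤ c k}
  have step : ∀ m c, ∃ i, μ (f '' cyl m c) ≤ μ (f '' cyl (m + 1) (update c m i)) + δ m := by
    intro m c
    have hmono : Monotone fun i => f '' cyl (m + 1) (update c m i) := by
      intro i j hij
      refine image_mono fun z hz k hk => (hz k hk).trans ?_
      rcases eq_or_ne k m with rfl | hkm
      · simpa using hij
      · simp [hkm]
    have hU : ⋃ i, f '' cyl (m + 1) (update c m i) = f '' cyl m c := by
      rw [← image_iUnion]
      congr 1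
      ext z
      rw [mem_iUnion]
      constructor
      · rintro ⟨i, hi⟩ k hk
        have := hi k (hk.trans (Nat.lt_succ_self m))
        rwa [update_of_ne hk.ne] at this
      · intro hz
        refine ⟨z m, fun k hk => ?_⟩
        rcases Nat.lt_succ_iff_lt_or_eq.1 hk with hk | rfl
        · rw [update_of_ne hk.ne]; exact hz k hk
        · simp
    have hsup := hmono.measure_iUnion (μ := μ)
    rw [hU] at hsup
    rcases eq_or_ne (μ (f '' cyl m c)) 0 with h0 | h0
    · exact ⟨0, by simp [h0]⟩
    have hlt : μ (f '' cyl m c) - δ m < μ (f '' cyl m c) :=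
      ENNReal.sub_lt_self (measure_ne_top _ _) h0 (hδ m).ne'
    conv_rhs at hlt => rw [hsup]
    obtain ⟨i, hi⟩ := lt_iSup_iff.1 hlt
    exact ⟨i, tsub_le_iff_right.1 hi.le⟩
  choose I hI using step
  let p : ℕ → (ℕ → ℕ) := fun t => Nat.rec (fun _ => 0) (fun t c => update c t (I t c)) t
  have p_succ : ∀ t, p (t + 1) = update (p t) t (I t (p t)) := fun t => rfl
  let c : ℕ → ℕ := fun t => p (t + 1) t
  have hstat : ∀ j t, j + 1 ≤ t → p t j = c j := by
    intro j
    apply Nat.le_induction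
    · rfl
    · intro t ht ih
      rw [p_succ, update_of_ne (by omega), ih]
  have hcyl : ∀ t, cyl t (p t) = cyl t c := by
    intro t
    ext z
    refine forall_congr' fun k => forall_congr' fun hk => ?_
    rw [hstat _ t hk]
  have hbound : ∀ t, μ (range f) ≤ μ (f '' cyl t c) + ∑ i ∈ Finset.range t, δ i := by
    intro t
    induction t with
    | zero => simp [cyl]
    | succ t ih =>
      refine ih.trans ?_
      have := hI t (p t)
      rw [← p_succ, hcyl, hcyl] at this
      rw [Finset.sum_range_succ, add_comm _ (δ t), ← add_assoc]
      gcongr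
  have hbound' : ∀ t, μ (range f) ≤ μ (f '' cyl t c) + ε := by
    intro t
    refine (hbound t).trans ?_
    gcongr
    exact (ENNReal.sum_le_tsum _).trans hδs.le
  have hK : IsCompact (f '' {z | ∀ k, z k ≤ c k}) := (isCompact_setOf_forall_le c).image hf
  refine ⟨_, image_subset_range f _, hK, ?_⟩
  -- Continuity from above does need measurable sets, hence the closures. Their intersection does
  -- not exceed `K`: an open neighbourhood of `K` already contains the image of some finite-stage
  -- cylinder.
  have hanti : Antitone fun t => closure (f '' cyl t c) := by
    intro s t hst
    exact closure_mono (image_mono fun z hz k hk => hz k (hk.trans_le hst))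
  have hInter : ⋂ t, closure (f '' cyl t c) ⊆ f '' {z | ∀ k, z k ≤ c k} := by
    intro x hx
    by_contra hxK
    obtain ⟨u, v, hu, hv, hKu, hxv, huv⟩ := SeparatedNhds.of_isCompact_isCompact hK
      (isCompact_singleton (x := x)) (disjoint_singleton_right.2 hxK)
    obtain ⟨m, hm⟩ := exists_setOf_forall_lt_le_subset (hu.preimage hf) (image_subset_iff.1 hKu)
    have h1 : f '' cyl m c ⊆ u := image_subset_iff.2 hm
    have h2 : x ∈ closure u := closure_mono h1 (mem_iInter.1 hx m)
    rw [mem_closure_iff] at h2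
    obtain ⟨y, hy, hy'⟩ := h2 v hv (hxv rfl)
    exact disjoint_left.1 huv hy' hy
  have hlim : μ (⋂ t, closure (f '' cyl t c)) = ⨅ t, μ (closure (f '' cyl t c)) :=
    hanti.measure_iInter (fun t => isClosed_closure.measurableSet.nullMeasurableSet)
      ⟨0, measure_ne_top _ _⟩
  calc μ (range f) ≤ (⨅ t, μ (closure (f '' cyl t c))) + ε := by
        rw [ENNReal.iInf_add]
        refine le_iInf fun t => (hbound' t).trans ?_
        gcongr
        exact subset_closure
    _ ≤ _ := by rw [← hlim]; gcongr

/-- Analytic sets are universally measurable. -/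
theorem MeasureTheory.AnalyticSet.nullMeasurableSet {s : Set α} (hs : AnalyticSet s)
    (μ : Measure α) [IsFiniteMeasure μ] : NullMeasurableSet s μ := by
  rw [AnalyticSet] at hs
  rcases hs with rfl | ⟨f, hf, rfl⟩
  · exact MeasurableSet.empty.nullMeasurableSet
  have : ∀ n : ℕ, ∃ K ⊆ range f, IsCompact K ∧ μ (range f) ≤ μ K + (n + 1 : ℝ≥0∞)⁻¹ := fun n =>
    exists_isCompact_measure_range_le μ hf (by simp)
  choose K hKs hKc hKm using this
  have hUs : ⋃ n, K n ⊆ range f := iUnion_subset hKs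
  have hUm : MeasurableSet (⋃ n, K n) := MeasurableSet.iUnion fun n => (hKc n).measurableSet
  refine (hUm.nullMeasurableSet).congr ?_
  refine ae_eq_of_subset_of_measure_ge hUs ?_ hUm.nullMeasurableSet (measure_ne_top _ _)
  have h0 : Tendsto (fun n : ℕ => μ (⋃ n, K n) + (n + 1 : ℝ≥0∞)⁻¹) atTop (𝓝 (μ (⋃ n, K n) + 0)) := by
    refine Tendsto.add tendsto_const_nhds ?_
    have := (tendsto_add_atTop_iff_nat 1).2 ENNReal.tendsto_inv_nat_nhds_zero
    simpa using this
  rw [add_zero] at h0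
  refine ge_of_tendsto' h0 fun n => (hKm n).trans ?_
  gcongr
  exact subset_iUnion K n

end UniversallyMeasurable

end

section

open MeasureTheory Set Filter Topology Function
open scoped ENNReal NNReal

/-! ### Integration of counting measures over the fibres of `G × Ω → Ω`. -/

section FiberCount

variable {G Ω : Type*} [MeasurableSpace G] [StandardBorelSpace G]
  [MeasurableSpace Ω] [StandardBorelSpace Ω]

/-- Sums of a Borel function over uncountable fibres are universally measurable. -/
theorem aemeasurable_lintegral_count {H : G × Ω → ℝ≥0∞} (hH : Measurable H) (μ : Measure Ω)
    [IsFiniteMeasure μ] : AEMeasurable (fun p => ∫⁻ x, H (x, p) ∂Measure.count) μ := by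
  let := upgradeStandardBorel Ω
  have key : ∀ c : ℝ≥0∞, NullMeasurableSet {p | c < ∫⁻ x, H (x, p) ∂Measure.count} μ := by
    intro c
    -- The sum exceeds `c` iff some finite partial sum does, so the superlevel set is a countable
    -- union of projections of Borel sets of injective tuples, hence analytic.
    have hset : {p | c < ∫⁻ x, H (x, p) ∂Measure.count} =
        ⋃ n : ℕ, Prod.snd '' {q : (Fin n → G) × Ω | Injective q.1 ∧ c < ∑ i, H (q.1 i, q.2)} := by
      ext p
      rw [mem_ofPred_eq, lintegral_count, ENNReal.tsum_eq_iSup_sum, lt_iSup_iff, mem_iUnion]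
      constructor
      · rintro ⟨s, hs⟩
        refine ⟨s.card, (fun i => s.equivFin.symm i, p), ⟨?_, ?_⟩, rfl⟩
        · exact Subtype.val_injective.comp s.equivFin.symm.injective
        · refine hs.trans_eq ?_
          rw [← Finset.sum_coe_sort s]
          exact (Equiv.sum_comp s.equivFin.symm fun x : s => H (x, p)).symm
      · rintro ⟨n, ⟨x, p⟩, ⟨hx, hc⟩, rfl⟩
        refine ⟨Finset.univ.map ⟨x, hx⟩, ?_⟩
        rwa [Finset.sum_map]
    rw [hset]
    refine NullMeasurableSet.iUnion fun n => AnalyticSet.nullMeasurableSet ?_ μ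
    refine MeasurableSet.analyticSet_image ?_ measurable_snd
    have hm : Measurable fun q : (Fin n → G) × Ω => ∑ i, H (q.1 i, q.2) := by fun_prop
    have hinj : MeasurableSet {q : (Fin n → G) × Ω | Injective q.1} := by
      have : {q : (Fin n → G) × Ω | Injective q.1} =
          ⋂ i, ⋂ j, {q | q.1 i = q.1 j → i = j} := by
        ext q; simp [Injective]
      rw [this]
      refine MeasurableSet.iInter fun i => MeasurableSet.iInter fun j => ?_
      by_cases hij : i = j
      · simp [hij]
      · simp only [hij, imp_false]
        refine (measurableSet_eq_fun ?_ ?_).compl <;> fun_prop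
    exact hinj.inter (measurableSet_lt measurable_const hm)
  have : NullMeasurable (fun p => ∫⁻ x, H (x, p) ∂Measure.count) μ := by
    have : Measurable (fun p : NullMeasurableSpace Ω μ => ∫⁻ x, H (x, p) ∂Measure.count) :=
      measurable_of_Ioi fun c => key c
    exact fun s hs => this hs
  exact this.aemeasurable

/-- The measure on `G × Ω` whose fibre over almost every point of `Ω` is the counting measure. -/
noncomputable def fiberCount (G : Type*) [MeasurableSpace G] [StandardBorelSpace G]
    (μ : Measure Ω) [IsFiniteMeasure μ] : Measure (G × Ω) :=
  Measure.ofMeasurable (fun B _ => ∫⁻ p, ∫⁻ x : G, B.indicator 1 (x, p) ∂Measure.count ∂μ)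
    (by simp) (by
      intro B hB hd
      rw [← lintegral_tsum fun n => aemeasurable_lintegral_count
        (measurable_one.indicator (hB n)) μ]
      refine lintegral_congr fun p => ?_
      rw [← lintegral_tsum fun n => by
        have h1 : Measurable fun x : G => (x, p) := by fun_prop
        exact ((measurable_one.indicator (hB n)).comp h1).aemeasurable]
      refine lintegral_congr fun x => ?_
      exact congrFun (indicator_iUnion_of_pairwise_disjoint B hd (1 : G × Ω → ℝ≥0∞)) (x, p))

/-- A substitute for Tonelli: counting measure on `G` need not be σ-finite, so the product measure
is of no use. The inner integrals are only almost everywhere measurable in `p`, which is enough for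
induction over simple functions and monotone limits. -/
theorem lintegral_fiberCount {H : G × Ω → ℝ≥0∞} (hH : Measurable H) (μ : Measure Ω)
    [IsFiniteMeasure μ] :
    ∫⁻ q, H q ∂(fiberCount G μ) = ∫⁻ p, ∫⁻ x, H (x, p) ∂Measure.count ∂μ := by
  have hpair : ∀ p : Ω, Measurable fun x : G => (x, p) := fun p => by fun_prop
  refine Measurable.ennreal_induction (motive := fun H => ∫⁻ q, H q ∂(fiberCount G μ) =
    ∫⁻ p, ∫⁻ x, H (x, p) ∂Measure.count ∂μ) ?_ ?_ ?_ hH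
  · intro c B hB
    have h1 : fiberCount G μ B = ∫⁻ p, ∫⁻ x : G, B.indicator 1 (x, p) ∂Measure.count ∂μ :=
      Measure.ofMeasurable_apply B hB
    rw [lintegral_indicator_const hB, h1, ← lintegral_const_mul'' c
      (aemeasurable_lintegral_count (measurable_one.indicator hB) μ)]
    refine lintegral_congr fun p => ?_
    refine (lintegral_const_mul _ ((measurable_one.indicator hB).comp (hpair p))).symm.trans ?_
    refine lintegral_congr fun x => ?_
    by_cases hx : (x, p) ∈ B <;> simp [hx]
  · intro f g _ hf hg ihf ihg
    simp only [Pi.add_apply]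
    rw [lintegral_add_left hf, ihf, ihg,
      ← lintegral_add_left' (aemeasurable_lintegral_count hf μ)]
    refine lintegral_congr fun p => ?_
    exact (lintegral_add_left (hf.comp (hpair p)) _).symm
  · intro f hf hmono ih
    rw [lintegral_iSup hf hmono]
    simp_rw [ih]
    rw [← lintegral_iSup' (fun n => aemeasurable_lintegral_count (hf n) μ)]
    · refine lintegral_congr fun p => ?_
      exact (lintegral_iSup (fun n => (hf n).comp (hpair p)) fun m n hmn x => hmono hmn _).symm
    · exact Eventually.of_forall fun p m n hmn => lintegral_mono fun x => hmono hmn _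

end FiberCount

theorem lintegral_count_mul_right {G : Type*} [Group G] [MeasurableSpace G]
    [MeasurableSingletonClass G] (φ : G → ℝ≥0∞) (a : G) :
    ∫⁻ x, φ (x * a) ∂Measure.count = ∫⁻ x, φ x ∂Measure.count := by
  rw [lintegral_count, lintegral_count]
  exact (Equiv.mulRight a).tsum_eq φ

/-! ### Existence and uniqueness of the infinitesimal measure. -/

section Infinitesimal

variable {G Ω : Type*} [Group G] [TopologicalSpace G] [IsTopologicalGroup G]
  [LocallyCompactSpace G] [SecondCountableTopology G] [T2Space G]
  [MeasurableSpace G] [BorelSpace G] [StandardBorelSpace G]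
  [MeasurableSpace Ω] [StandardBorelSpace Ω] [MulAction G Ω] [MeasurableSMul₂ G Ω]

/-- The expectation under `μ` of the random measure `∑ f (x • p) δ_x` on `G`. -/
noncomputable def countIntensity (G : Type*) [Group G] [MeasurableSpace G] [StandardBorelSpace G]
    [MulAction G Ω] (μ : Measure Ω) [IsFiniteMeasure μ] (f : Ω → ℝ≥0∞) : Measure G :=
  ((fiberCount G μ).withDensity fun q => f (q.1 • q.2)).map Prod.fst

omit [IsTopologicalGroup G] [LocallyCompactSpace G] [SecondCountableTopology G] [T2Space G]
  [BorelSpace G] [TopologicalSpace G] in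
theorem lintegral_countIntensity (μ : Measure Ω) [IsFiniteMeasure μ] {f : Ω → ℝ≥0∞}
    (hf : Measurable f) {h : G → ℝ≥0∞} (hh : Measurable h) :
    ∫⁻ x, h x ∂(countIntensity G μ f) = ∫⁻ p, ∫⁻ x, h x * f (x • p) ∂Measure.count ∂μ := by
  have h1 : Measurable fun q : G × Ω => f (q.1 • q.2) := by fun_prop
  have h2 : Measurable fun q : G × Ω => h q.1 := by fun_prop
  rw [countIntensity, lintegral_map hh measurable_fst,
    lintegral_withDensity_eq_lintegral_mul _ h1 h2, lintegral_fiberCount (h1.mul h2)]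
  simp only [Pi.mul_apply, mul_comm]

-- Replacing `p` by `a • p`, which preserves `μ`, turns `f (x • p)` into `f ((x * a) • p)`; the sum
-- over `x` is then reindexed by `x ↦ x * a`.
omit [LocallyCompactSpace G] [SecondCountableTopology G] [T2Space G] in
theorem countIntensity_isMulRightInvariant (μ : Measure Ω) [IsFiniteMeasure μ]
    [SMulInvariantMeasure G Ω μ] {f : Ω → ℝ≥0∞} (hf : Measurable f) :
    (countIntensity G μ f).IsMulRightInvariant := by
  refine ⟨fun a => Measure.ext_of_lintegral _ fun h hh => ?_⟩
  have hm : Measurable fun x : G => x * a := measurable_mul_const a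
  rw [lintegral_map hh hm, lintegral_countIntensity (h := fun x => h (x * a)) μ hf (hh.comp hm),
    lintegral_countIntensity μ hf hh,
    ← (measurePreserving_smul a μ).lintegral_comp_emb (measurableEmbedding_const_smul a)]
  refine lintegral_congr fun p => ?_
  rw [← lintegral_count_mul_right (fun x => h x * f (x • p)) a]
  refine lintegral_congr fun x => ?_
  rw [smul_smul]

omit [LocallyCompactSpace G] [SecondCountableTopology G] [T2Space G] [StandardBorelSpace G] in
/-- A right invariant measure that is infinite on some compact set gives infinite integral to every
non-zero non-negative test function. -/
theorem lintegral_eq_top_of_isMulRightInvariant {M : Measure G} [M.IsMulRightInvariant]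
    {K : Set G} (hK : IsCompact K) (hM : M K = ⊤) {h : G → ℝ≥0} (hc : Continuous h)
    (h0 : h ≠ 0) : ∫⁻ x, (h x : ℝ≥0∞) ∂M = ⊤ := by
  by_contra hne
  obtain ⟨x₀, hx₀⟩ : ∃ x, h x ≠ 0 := by
    by_contra hcon
    push Not at hcon
    exact h0 (funext hcon)
  set δ : ℝ≥0 := h x₀ / 2
  have hδ : 0 < δ := by positivity
  -- `V` is open, non-empty and, by Markov, of finite measure if the integral is finite. Finitely
  -- many right translates of `V` cover `K` and all have the measure of `V`.
  let V : Set G := {x | δ < h x}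
  have hVo : IsOpen V := isOpen_lt continuous_const hc
  have hV₀ : x₀ ∈ V := by
    change h x₀ / 2 < h x₀
    exact NNReal.half_lt_self hx₀
  have hVM : M V ≠ ⊤ := by
    have : M {x | (δ : ℝ≥0∞) ≤ h x} < ⊤ :=
      (meas_ge_le_lintegral_div (by fun_prop) (by exact_mod_cast hδ.ne')
        ENNReal.coe_ne_top).trans_lt (ENNReal.div_lt_top hne (by exact_mod_cast hδ.ne'))
    refine (lt_of_le_of_lt (measure_mono fun x hx => ?_) this).ne
    exact ENNReal.coe_le_coe.2 (le_of_lt hx)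
  have hcover := hK.elim_finite_subcover (fun a : G => (fun x => x * a) ⁻¹' V)
    (fun a => hVo.preimage (continuous_mul_const a)) (fun x _ => mem_iUnion.2 ⟨x⁻¹ * x₀, by
      simpa using hV₀⟩)
  obtain ⟨t, ht⟩ := hcover
  have : M K < ⊤ := by
    refine (measure_mono ht).trans_lt ((measure_biUnion_finset_le t _).trans_lt ?_)
    refine ENNReal.sum_lt_top.2 fun a _ => ?_
    rw [measure_preimage_mul_right]
    exact hVM.lt_top
  exact this.ne hM

omit [T2Space G] [StandardBorelSpace G] in
/-- Up to a possibly infinite factor, a right invariant measure agrees with the Haar measure of a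
unimodular group on test functions. -/
theorem lintegral_mul_eq_of_isMulRightInvariant (lam M : Measure G) [lam.IsHaarMeasure]
    [lam.IsMulRightInvariant] [M.IsMulRightInvariant] {h k : G → ℝ≥0}
    (hc : Continuous h) (hs : HasCompactSupport h) (kc : Continuous k)
    (ks : HasCompactSupport k) :
    (∫⁻ x, (h x : ℝ≥0∞) ∂M) * ∫⁻ x, (k x : ℝ≥0∞) ∂lam
      = (∫⁻ x, (k x : ℝ≥0∞) ∂M) * ∫⁻ x, (h x : ℝ≥0∞) ∂lam := by
  by_cases hfin : ∀ K : Set G, IsCompact K → M K < ⊤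
  · have : IsFiniteMeasureOnCompacts M := ⟨fun K hK => hfin K hK⟩
    have : lam.inv.IsHaarMeasure := {}
    -- Uniqueness of Haar measure concerns left invariant measures; inversion exchanges left and
    -- right.
    have h1 : M.inv = Measure.haarScalarFactor M.inv lam.inv • lam.inv :=
      Measure.isMulLeftInvariant_eq_smul M.inv lam.inv
    have h2 : M = Measure.haarScalarFactor M.inv lam.inv • lam := by
      calc M = M.inv.inv := (Measure.inv_inv M).symm
        _ = (Measure.haarScalarFactor M.inv lam.inv • lam.inv).inv := by rw [← h1]
        _ = _ := by
          rw [Measure.inv, Measure.map_smul]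
          change _ • lam.inv.inv = _
          rw [Measure.inv_inv]
    rw [h2, lintegral_smul_measure, lintegral_smul_measure]
    simp only [ENNReal.smul_def, smul_eq_mul]
    ring
  · push Not at hfin
    obtain ⟨K, hK, hKM⟩ := hfin
    have hKM := top_le_iff.1 hKM
    -- In the infinite case both sides equal `⊤` unless one test function vanishes; that case is
    -- split off because `0 * ⊤ = 0`.
    rcases eq_or_ne h 0 with rfl | hh0
    · simp
    rcases eq_or_ne k 0 with rfl | hk0
    · simp
    have pos : ∀ l : G → ℝ≥0, Continuous l → l ≠ 0 → (∫⁻ x, (l x : ℝ≥0∞) ∂lam) ≠ 0 := by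
      intro l lc l0 hz
      rw [lintegral_eq_zero_iff (by fun_prop)] at hz
      have : (fun x => (l x : ℝ≥0∞)) = 0 :=
        Continuous.ae_eq_iff_eq lam (by fun_prop) continuous_zero |>.1 hz
      exact l0 (funext fun x => by simpa using congrFun this x)
    rw [lintegral_eq_top_of_isMulRightInvariant hK hKM hc hh0,
      lintegral_eq_top_of_isMulRightInvariant hK hKM kc hk0,
      ENNReal.top_mul (pos k kc hk0), ENNReal.top_mul (pos h hc hh0)]

omit [SecondCountableTopology G] [T2Space G] [StandardBorelSpace G] in
theorem exists_testFunction (lam : Measure G) [lam.IsHaarMeasure] :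
    ∃ h : G → ℝ≥0, Continuous h ∧ HasCompactSupport h ∧
      ∫⁻ x, (h x : ℝ≥0∞) ∂lam ≠ 0 ∧ ∫⁻ x, (h x : ℝ≥0∞) ∂lam ≠ ⊤ := by
  obtain ⟨h, hs, h1, h0⟩ := exists_continuous_nonneg_pos (1 : G)
  let k : G → ℝ≥0 := fun x => (h x).toNNReal
  have kc : Continuous k := by fun_prop
  have ks : HasCompactSupport k := hs.comp_left (g := Real.toNNReal) (by simp)
  refine ⟨k, kc, ks, fun hz => ?_, ?_⟩
  · have hkm : Measurable fun x => (k x : ℝ≥0∞) := by fun_prop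
    rw [lintegral_eq_zero_iff hkm] at hz
    have hkc : Continuous fun x => (k x : ℝ≥0∞) := by fun_prop
    have : (fun x => (k x : ℝ≥0∞)) = 0 := (hkc.ae_eq_iff_eq lam continuous_zero).1 hz
    have h2 := congrFun this 1
    simp only [k, Pi.zero_apply, ENNReal.coe_eq_zero, Real.toNNReal_eq_zero] at h2
    exact h0 (le_antisymm h2 (h1 1))
  · exact (h.continuous.integrable_of_hasCompactSupport hs).lintegral_lt_top.ne

open TameChains

omit [IsTopologicalGroup G] [LocallyCompactSpace G] [SecondCountableTopology G] [T2Space G] in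
/-- The defining identity of the infinitesimal measure `(dcount/dlam) μ`, in terms of
`countIntensity`. -/
theorem isInfinitesimalMeasure_count_iff (lam : Measure G) (μ ν : Measure Ω) [IsFiniteMeasure μ] :
    IsInfinitesimalMeasure lam (Measure.count : Measure G) μ ν ↔
      ∀ f : Ω → ℝ≥0∞, Measurable f → ∀ h : G → ℝ≥0, Continuous h → HasCompactSupport h →
        ∫⁻ x, (h x : ℝ≥0∞) ∂(countIntensity G μ f)
          = (∫⁻ x, (h x : ℝ≥0∞) ∂lam) * ∫⁻ p, f p ∂ν := by
  refine forall₂_congr fun f hf => forall_congr' fun h => forall₂_congr fun hc hs => ?_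
  have hm : Measurable fun x => (h x : ℝ≥0∞) := by fun_prop
  rw [lintegral_countIntensity μ hf hm]
  refine Eq.congr_left (lintegral_congr fun p => ?_)
  have hfp : Measurable fun x : G => f (x • p) := by fun_prop
  rw [enhance, lintegral_withDensity_eq_lintegral_mul _ hfp hm]
  simp only [Pi.mul_apply, mul_comm]

-- A single test function `k` with integral `c` in `(0, ∞)` determines the measure. That the
-- resulting formula holds for every other `h` is the proportionality of the intensity with Haar
-- measure, stated by cross-multiplication so that infinite factors are covered.
omit [T2Space G] in
theorem existsUnique_isInfinitesimalMeasure_count (lam : Measure G) [lam.IsHaarMeasure]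
    [lam.IsMulRightInvariant] (μ : Measure Ω) [IsFiniteMeasure μ] [SMulInvariantMeasure G Ω μ] :
    ∃! ν : Measure Ω, IsInfinitesimalMeasure lam (Measure.count : Measure G) μ ν := by
  simp only [isInfinitesimalMeasure_count_iff]
  obtain ⟨k, kc, ks, k0, kt⟩ := exists_testFunction lam
  have hkm : Measurable fun x => (k x : ℝ≥0∞) := by fun_prop
  set c := ∫⁻ x, (k x : ℝ≥0∞) ∂lam
  have hact : Measurable fun q : G × Ω => q.1 • q.2 := by fun_prop
  have hk1 : Measurable fun q : G × Ω => (k q.1 : ℝ≥0∞) := by fun_prop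
  let ν : Measure Ω :=
    c⁻¹ • ((fiberCount G μ).withDensity fun q => (k q.1 : ℝ≥0∞)).map fun q => q.1 • q.2
  have hν : ∀ f : Ω → ℝ≥0∞, Measurable f →
      ∫⁻ p, f p ∂ν = c⁻¹ * ∫⁻ x, (k x : ℝ≥0∞) ∂(countIntensity G μ f) := by
    intro f hf
    have hfa : Measurable fun q : G × Ω => f (q.1 • q.2) := hf.comp hact
    rw [lintegral_smul_measure, lintegral_map hf hact,
      lintegral_withDensity_eq_lintegral_mul _ hk1 hfa,
      lintegral_fiberCount (hk1.mul hfa), lintegral_countIntensity μ hf hkm]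
    rfl
  refine ⟨ν, fun f hf h hc hs => ?_, fun ν' hν' => ?_⟩
  · have := countIntensity_isMulRightInvariant (G := G) μ hf
    have key := lintegral_mul_eq_of_isMulRightInvariant lam (countIntensity G μ f) hc hs kc ks
    rw [hν f hf, ← mul_assoc, mul_comm _ c⁻¹, mul_assoc, mul_comm (∫⁻ x, (h x : ℝ≥0∞) ∂lam), ← key,
      mul_comm _ c, ← mul_assoc, ENNReal.inv_mul_cancel k0 kt, one_mul]
  · refine Measure.ext_of_lintegral _ fun f hf => ?_
    rw [hν f hf, hν' f hf k kc ks, ← mul_assoc, ENNReal.inv_mul_cancel k0 kt, one_mul]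

end Infinitesimal

end

section

open MeasureTheory Set Filter Topology Function TameChains
open scoped ENNReal NNReal

/-! ### Equivariance and Borel measurability of cells and nearest points. -/

section NearestPoint

variable {G Ω : Type*} [Group G] [MulAction G Ω] {d : G → G → ℝ≥0∞} {S : Set Ω}

theorem mem_orbitSet_smul {x a : G} {p : Ω} : x ∈ orbitSet S (a • p) ↔ x * a ∈ orbitSet S p := by
  simp [orbitSet, smul_smul]

theorem isUniqueNearest_smul_iff (hd : ∀ a x y, d (x * a) (y * a) = d x y) {a x y : G} {p : Ω} :
    IsUniqueNearest d (orbitSet S (a • p)) x y ↔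
      IsUniqueNearest d (orbitSet S p) (x * a) (y * a) := by
  refine and_congr mem_orbitSet_smul ⟨fun h z hz hzy => ?_, fun h z hz hzy => ?_⟩
  · have := h (z * a⁻¹) (mem_orbitSet_smul.2 (by simpa using hz))
      (fun h' => hzy (by rw [← h']; group))
    rw [← hd a, ← hd a x] at this
    simpa using this
  · rw [← hd a, ← hd a x]
    exact h (z * a) (mem_orbitSet_smul.1 hz) (fun h' => hzy (mul_right_cancel h'))

/-- Through this the whole nearest-point relation is a Borel pullback of the cell relation, so
measurability has to be proved only for cells. -/
theorem isUniqueNearest_iff_mem_cell (hd : ∀ a x y, d (x * a) (y * a) = d x y) {x y : G} {p : Ω} :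
    IsUniqueNearest d (orbitSet S p) x y ↔ x * y⁻¹ ∈ cell d S (y • p) := by
  rw [cell, mem_ofPred_eq, isUniqueNearest_smul_iff hd]
  simp

omit [Group G] in
theorem TameChains.IsUniqueNearest.unique {A : Set G} {x y z : G} (hy : IsUniqueNearest d A x y)
    (hz : IsUniqueNearest d A x z) : y = z := by
  by_contra h
  exact lt_asymm (hy.2 z hz.1 (Ne.symm h)) (hz.2 y hy.1 h)

variable (d S) in
/-- The pairs `(x, p)` for which `x` has a unique nearest point in `orbitSet S p`. -/
def uniqueNearestSet : Set (G × Ω) := {q | ∃ y, IsUniqueNearest d (orbitSet S q.2) q.1 y}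

open Classical in
variable (d S) in
/-- The nearest point to `x` in `orbitSet S p`, when it is unique. -/
noncomputable def nearestPoint (q : G × Ω) : G :=
  if h : ∃ y, IsUniqueNearest d (orbitSet S q.2) q.1 y then h.choose else 1

theorem isUniqueNearest_nearestPoint {q : G × Ω} (hq : q ∈ uniqueNearestSet d S) :
    IsUniqueNearest d (orbitSet S q.2) q.1 (nearestPoint d S q) := by
  have h : ∃ y, IsUniqueNearest d (orbitSet S q.2) q.1 y := hq
  rw [nearestPoint, dif_pos h]
  exact h.choose_spec

theorem nearestPoint_eq {q : G × Ω} {y : G} (h : IsUniqueNearest d (orbitSet S q.2) q.1 y) :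
    nearestPoint d S q = y :=
  IsUniqueNearest.unique (isUniqueNearest_nearestPoint ⟨y, h⟩) h

theorem nearestPoint_of_notMem {q : G × Ω} (hq : q ∉ uniqueNearestSet d S) :
    nearestPoint d S q = 1 :=
  dif_neg hq

theorem mem_uniqueNearestSet_smul (hd : ∀ a x y, d (x * a) (y * a) = d x y) {a x : G} {p : Ω} :
    (x, a • p) ∈ uniqueNearestSet d S ↔ (x * a, p) ∈ uniqueNearestSet d S := by
  constructor
  · rintro ⟨y, hy⟩
    exact ⟨y * a, (isUniqueNearest_smul_iff hd).1 hy⟩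
  · rintro ⟨y, hy⟩
    exact ⟨y * a⁻¹, (isUniqueNearest_smul_iff hd).2 (by simpa using hy)⟩

theorem nearestPoint_smul (hd : ∀ a x y, d (x * a) (y * a) = d x y) {a x : G} {p : Ω}
    (h : (x, a • p) ∈ uniqueNearestSet d S) :
    nearestPoint d S (x * a, p) = nearestPoint d S (x, a • p) * a :=
  nearestPoint_eq ((isUniqueNearest_smul_iff hd).1 (isUniqueNearest_nearestPoint h))

section Measurability

variable [TopologicalSpace G] [PolishSpace G] [MeasurableSpace G]
  [BorelSpace G] [MeasurableSpace Ω] [StandardBorelSpace Ω] [MeasurableSMul₂ G Ω]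

/-- Leaving the cell is witnessed by a competitor `z ≠ 1` with `d x z ≤ d x 1`. The condition `z ≠
1` is open; writing it as a countable union of closed conditions `F n` makes all sections closed, so
that the projection theorem applies. -/
theorem measurableSet_setOf_mem_cell [SigmaCompactSpace G]
    (hdm : Measurable fun q : G × G => d q.1 q.2)
    (hdc : ∀ x c, IsClosed {z | d x z ≤ c}) (hS : MeasurableSet S)
    (hcl : ∀ p : Ω, IsClosed (orbitSet S p : Set G)) :
    MeasurableSet {q : G × Ω | q.1 ∈ cell d S q.2} := by
  obtain ⟨F, hFc, hF⟩ : ∃ F : ℕ → Set G, (∀ n, IsClosed (F n)) ∧ ⋃ n, F n = {1}ᶜ := by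
    let := TopologicalSpace.upgradeIsCompletelyMetrizable G
    obtain ⟨F, h1, _, h2, _⟩ := (isOpen_compl_singleton (x := (1 : G))).exists_iUnion_isClosed
    exact ⟨F, h1, h2⟩
  let B : ℕ → Set ((G × Ω) × G) := fun n =>
    {r | r.2 • r.1.2 ∈ S ∧ d r.1.1 r.2 ≤ d r.1.1 1 ∧ r.2 ∈ F n}
  have hB : ∀ n, MeasurableSet (B n) := by
    intro n
    have h1 : Measurable fun r : (G × Ω) × G => r.2 • r.1.2 := by fun_prop
    have h2 : Measurable fun r : (G × Ω) × G => d r.1.1 r.2 :=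
      hdm.comp (by fun_prop : Measurable fun r : (G × Ω) × G => (r.1.1, r.2))
    have h3 : Measurable fun r : (G × Ω) × G => d r.1.1 1 :=
      hdm.comp (by fun_prop : Measurable fun r : (G × Ω) × G => (r.1.1, (1 : G)))
    exact (h1 hS).inter ((measurableSet_le h2 h3).inter (measurable_snd (hFc n).measurableSet))
  have hBm : ∀ n, MeasurableSet (Prod.fst '' B n) := fun n =>
    (hB n).image_fst_of_isClosed_sections fun q =>
      (hcl q.2).inter ((hdc q.1 (d q.1 1)).inter (hFc n))
  have : {q : G × Ω | q.1 ∈ cell d S q.2} = (Prod.snd ⁻¹' S) \ ⋃ n, Prod.fst '' B n := by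
    ext ⟨x, p⟩
    simp only [cell, IsUniqueNearest, mem_ofPred_eq, Set.mem_sdiff, mem_preimage, mem_iUnion, not_exists]
    refine and_congr (by simp [orbitSet]) ⟨fun h n => ?_, fun h z hz hz1 => ?_⟩
    · rintro ⟨⟨q, z⟩, ⟨hz, hdz, hzF⟩, rfl⟩
      have : z ∈ ({1}ᶜ : Set G) := hF ▸ mem_iUnion.2 ⟨n, hzF⟩
      exact (h z hz this).not_ge hdz
    · by_contra hcon
      have : z ∈ ⋃ n, F n := hF ▸ hz1
      obtain ⟨n, hn⟩ := mem_iUnion.1 this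
      exact h n ⟨((x, p), z), ⟨hz, not_lt.1 hcon, hn⟩, rfl⟩
  rw [this]
  exact (measurable_snd hS).diff (MeasurableSet.iUnion hBm)

variable [IsTopologicalGroup G]

omit [StandardBorelSpace Ω] in
theorem measurableSet_setOf_isUniqueNearest (hd : ∀ a x y, d (x * a) (y * a) = d x y)
    (hC : MeasurableSet {q : G × Ω | q.1 ∈ cell d S q.2}) :
    MeasurableSet {r : (G × Ω) × G | IsUniqueNearest d (orbitSet S r.1.2) r.1.1 r.2} := by
  simp_rw [isUniqueNearest_iff_mem_cell hd]
  have : Measurable fun r : (G × Ω) × G => (r.1.1 * r.2⁻¹, r.2 • r.1.2) := by fun_prop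
  exact this hC

/-- Uniqueness makes the projection injective on the nearest-point relation, so the Lusin–Souslin
theorem gives a Borel image. -/
theorem measurableSet_uniqueNearestSet (hd : ∀ a x y, d (x * a) (y * a) = d x y)
    (hC : MeasurableSet {q : G × Ω | q.1 ∈ cell d S q.2}) :
    MeasurableSet (uniqueNearestSet d S) := by
  have := (measurableSet_setOf_isUniqueNearest hd hC).image_of_measurable_injOn measurable_fst
    (by
      rintro ⟨q, y⟩ hy ⟨q', y'⟩ hy' (rfl : q = q')
      have : y = y' := IsUniqueNearest.unique hy hy'
      rw [this])
  convert this using 1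
  ext q
  simp [uniqueNearestSet]

theorem measurable_nearestPoint (hd : ∀ a x y, d (x * a) (y * a) = d x y)
    (hC : MeasurableSet {q : G × Ω | q.1 ∈ cell d S q.2}) :
    Measurable (nearestPoint d S) := by
  intro B hB
  have := ((measurableSet_setOf_isUniqueNearest hd hC).inter
    (measurable_snd hB)).image_of_measurable_injOn measurable_fst
    (by
      rintro ⟨q, y⟩ hy ⟨q', y'⟩ hy' (rfl : q = q')
      have : y = y' := IsUniqueNearest.unique hy.1 hy'.1
      rw [this])
  have h2 : MeasurableSet ((uniqueNearestSet d S)ᶜ ∩ {_q : G × Ω | (1 : G) ∈ B}) :=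
    (measurableSet_uniqueNearestSet hd hC).compl.inter (MeasurableSet.const _)
  convert this.union h2 using 1
  ext q
  constructor
  · intro hq
    by_cases hU : q ∈ uniqueNearestSet d S
    · exact Or.inl ⟨(q, nearestPoint d S q), ⟨isUniqueNearest_nearestPoint hU, hq⟩, rfl⟩
    · refine Or.inr ⟨hU, ?_⟩
      have hq' : nearestPoint d S q ∈ B := hq
      rwa [nearestPoint_of_notMem hU] at hq'
  · rintro (⟨⟨q, y⟩, ⟨h1, h2⟩, rfl⟩ | ⟨h1, h2⟩)
    · change nearestPoint d S q ∈ B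
      rwa [nearestPoint_eq h1]
    · change nearestPoint d S q ∈ B
      rwa [nearestPoint_of_notMem h1]

omit [TopologicalSpace G] [PolishSpace G] [BorelSpace G]
  [StandardBorelSpace Ω] [MeasurableSMul₂ G Ω] [IsTopologicalGroup G] in
theorem measurableSet_cell (hC : MeasurableSet {q : G × Ω | q.1 ∈ cell d S q.2}) (p : Ω) :
    MeasurableSet (cell d S p) :=
  (by fun_prop : Measurable fun x : G => (x, p)) hC

omit [TopologicalSpace G] [PolishSpace G] [BorelSpace G]
  [StandardBorelSpace Ω] [IsTopologicalGroup G] in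
theorem measurable_cellIntegral (hC : MeasurableSet {q : G × Ω | q.1 ∈ cell d S q.2})
    (lam : Measure G) [SFinite lam] {f : Ω → ℝ≥0∞} (hf : Measurable f) :
    Measurable (cellIntegral d lam S f) := by
  have h1 : Measurable fun q : G × Ω => f (q.1 • q.2) := by fun_prop
  have := (h1.indicator hC).lintegral_prod_left' (μ := lam)
  convert this using 2 with p
  rw [cellIntegral, ← lintegral_indicator (measurableSet_cell hC p)]
  rfl

end Measurability

theorem cellIntegral_eq_zero [MeasurableSpace G] (lam : Measure G) (f : Ω → ℝ≥0∞) {p : Ω}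
    (hp : p ∉ S) : cellIntegral d lam S f p = 0 := by
  have : cell d S p = ∅ := by
    rw [eq_empty_iff_forall_notMem]
    intro x hx
    exact hp (by simpa [orbitSet] using hx.1)
  simp [cellIntegral, this]

end NearestPoint

/-! ### The transport chain and the recovery of the invariant measure. -/

section NearestChain

variable {G Ω : Type*} [Group G] [MulAction G Ω] [MeasurableSpace G]

/-- The weight `f (x • p)` on the points that have a unique nearest point in `orbitSet S p`. -/
noncomputable def nearestWeight (d : G → G → ℝ≥0∞) (S : Set Ω) (f : Ω → ℝ≥0∞) : G × Ω → ℝ≥0∞ :=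
  (uniqueNearestSet d S).indicator fun q => f (q.1 • q.2)

/-- The `1`-chain that transports the density `f` to the nearest points in `S`. -/
noncomputable def nearestChain (d : G → G → ℝ≥0∞) (lam : Measure G) (S : Set Ω) (f : Ω → ℝ≥0∞)
    (p : Ω) : Measure (Fin (1 + 1) → G) :=
  (lam.withDensity fun x => nearestWeight d S f (x, p)).map fun x => ![x, nearestPoint d S (x, p)]

variable [TopologicalSpace G] [PolishSpace G] [IsTopologicalGroup G]
  [BorelSpace G] [MeasurableSpace Ω] [StandardBorelSpace Ω] [MeasurableSMul₂ G Ω]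
  {d : G → G → ℝ≥0∞} {S : Set Ω} {lam : Measure G}

theorem measurable_nearestWeight (hd : ∀ a x y, d (x * a) (y * a) = d x y)
    (hC : MeasurableSet {q : G × Ω | q.1 ∈ cell d S q.2}) {f : Ω → ℝ≥0∞} (hf : Measurable f) :
    Measurable (nearestWeight d S f) :=
  (by fun_prop : Measurable fun q : G × Ω => f (q.1 • q.2)).indicator
    (measurableSet_uniqueNearestSet hd hC)

theorem measurable_pair_nearestPoint (hd : ∀ a x y, d (x * a) (y * a) = d x y)
    (hC : MeasurableSet {q : G × Ω | q.1 ∈ cell d S q.2}) :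
    Measurable fun q : G × Ω => (![q.1, nearestPoint d S q] : Fin (1 + 1) → G) := by
  refine measurable_pi_iff.2 fun i => ?_
  fin_cases i
  · exact measurable_fst
  · exact measurable_nearestPoint hd hC

theorem lintegral_nearestChain (hd : ∀ a x y, d (x * a) (y * a) = d x y)
    (hC : MeasurableSet {q : G × Ω | q.1 ∈ cell d S q.2}) {f : Ω → ℝ≥0∞} (hf : Measurable f)
    {h : (Fin (1 + 1) → G) → ℝ≥0∞} (hh : Measurable h) (p : Ω) :
    ∫⁻ x, h x ∂(nearestChain d lam S f p)
      = ∫⁻ x, nearestWeight d S f (x, p) * h ![x, nearestPoint d S (x, p)] ∂lam := by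
  have hpair : Measurable fun x : G => (x, p) := by fun_prop
  have h1 : Measurable fun x => nearestWeight d S f (x, p) :=
    (measurable_nearestWeight hd hC hf).comp hpair
  have h2 : Measurable fun x : G => (![x, nearestPoint d S (x, p)] : Fin (1 + 1) → G) :=
    (measurable_pair_nearestPoint hd hC).comp hpair
  have hh2 : Measurable fun x : G => h ![x, nearestPoint d S (x, p)] := hh.comp h2
  rw [nearestChain, lintegral_map hh h2, lintegral_withDensity_eq_lintegral_mul _ h1 hh2]
  rfl

/-- The mass of a compact `K` is at most `C` times the Haar measure of its first projection,
wherever the nearest points are. Invariance combines equivariance of the nearest point with right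
invariance of `lam`. -/
theorem isRadonChain_nearestChain [IsFiniteMeasureOnCompacts lam] [SFinite lam]
    [lam.IsMulRightInvariant] (hd : ∀ a x y, d (x * a) (y * a) = d x y)
    (hC : MeasurableSet {q : G × Ω | q.1 ∈ cell d S q.2}) {f : Ω → ℝ≥0∞} (hf : Measurable f)
    {C : ℝ≥0} (hfC : ∀ p, f p ≤ C) : IsRadonChain (nearestChain d lam S f) where
  finite_on_compacts p K hK := by
    have hK0 : IsCompact ((fun x : Fin (1 + 1) → G => x 0) '' K) :=
      hK.image (continuous_apply 0)
    rw [← lintegral_indicator_one hK.isClosed.measurableSet,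
      lintegral_nearestChain hd hC hf (measurable_one.indicator hK.isClosed.measurableSet)]
    calc _ ≤ ∫⁻ x, ((fun x : Fin (1 + 1) → G => x 0) '' K).indicator (fun _ => (C : ℝ≥0∞)) x ∂lam := by
          refine lintegral_mono fun x => ?_
          by_cases hx : ![x, nearestPoint d S (x, p)] ∈ K
          · have hx' : x ∈ (fun x : Fin (1 + 1) → G => x 0) '' K := ⟨_, hx, rfl⟩
            rw [indicator_of_mem hx, indicator_of_mem hx', Pi.one_apply, mul_one]
            exact indicator_le_self' (fun _ _ => zero_le) _ |>.trans (hfC _)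
          · rw [indicator_of_notMem hx, mul_zero]
            exact zero_le
      _ = C * lam ((fun x : Fin (1 + 1) → G => x 0) '' K) :=
          lintegral_indicator_const hK0.isClosed.measurableSet _
      _ < ⊤ := ENNReal.mul_lt_top ENNReal.coe_lt_top hK0.measure_lt_top
  borel h hc _ := by
    have hm : Measurable fun x => (h x : ℝ≥0∞) := by fun_prop
    simp_rw [lintegral_nearestChain hd hC hf hm]
    exact ((measurable_nearestWeight hd hC hf).mul
      (hm.comp (measurable_pair_nearestPoint hd hC))).lintegral_prod_left'
  invariant a p := by
    have hma : Measurable fun (x : Fin (1 + 1) → G) i => x i * a := by fun_prop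
    refine Measure.ext_of_lintegral _ fun h hh => ?_
    have hha : Measurable fun x : Fin (1 + 1) → G => h fun i => x i * a := hh.comp hma
    rw [lintegral_map hh hma, lintegral_nearestChain hd hC hf hha, lintegral_nearestChain hd hC hf hh,
      ← lintegral_mul_right_eq_self
        (fun x => nearestWeight d S f (x, p) * h ![x, nearestPoint d S (x, p)]) a]
    refine lintegral_congr fun x => ?_
    by_cases hx : (x, a • p) ∈ uniqueNearestSet d S
    · have hx' := (mem_uniqueNearestSet_smul hd).1 hx
      simp only [nearestWeight]
      rw [indicator_of_mem hx, indicator_of_mem hx', smul_smul,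
        nearestPoint_smul hd hx]
      congr 2
      funext i
      fin_cases i <;> rfl
    · have hx' := mt (mem_uniqueNearestSet_smul hd).2 hx
      simp only [nearestWeight]
      rw [indicator_of_notMem hx, indicator_of_notMem hx', zero_mul, zero_mul]

/-- The chain is countably additive in `f`, and `f` is a countable sum of finite-valued simple
functions, each of them bounded. -/
theorem isTameChain_nearestChain [IsFiniteMeasureOnCompacts lam] [SFinite lam]
    [lam.IsMulRightInvariant] (hd : ∀ a x y, d (x * a) (y * a) = d x y)
    (hC : MeasurableSet {q : G × Ω | q.1 ∈ cell d S q.2}) {f : Ω → ℝ≥0∞} (hf : Measurable f) :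
    IsTameChain (nearestChain d lam S f) := by
  let F : ℕ → Ω → ℝ≥0∞ := fun n p => SimpleFunc.eapproxDiff f n p
  have hF : ∀ n, Measurable (F n) := fun n => by
    have := (SimpleFunc.eapproxDiff f n).measurable
    fun_prop
  refine ⟨fun n => nearestChain d lam S (F n), fun n => ?_, fun p => ?_⟩
  · obtain ⟨C, hC'⟩ := (SimpleFunc.eapproxDiff f n).exists_forall_le
    exact isRadonChain_nearestChain hd hC (hF n) (C := C) fun p =>
      ENNReal.coe_le_coe.2 (hC' p)
  · have hw : (fun x => nearestWeight d S f (x, p)) = ∑' n, fun x => nearestWeight d S (F n) (x, p) := by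
      funext x
      rw [ENNReal.tsum_apply]
      by_cases hx : (x, p) ∈ uniqueNearestSet d S
      · simp only [nearestWeight, indicator_of_mem hx]
        exact (SimpleFunc.tsum_eapproxDiff f hf _).symm
      · simp [nearestWeight, indicator_of_notMem hx]
    have hpair : Measurable fun x : G => (x, p) := by fun_prop
    have h2 : Measurable fun x : G => (![x, nearestPoint d S (x, p)] : Fin (1 + 1) → G) :=
      (measurable_pair_nearestPoint hd hC).comp hpair
    have hFw : ∀ n, Measurable fun x => nearestWeight d S (F n) (x, p) := fun n =>
      (measurable_nearestWeight hd hC (hF n)).comp hpair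
    rw [nearestChain, hw, withDensity_tsum hFw,
      Measure.map_sum h2.aemeasurable]
    rfl

theorem vertex_zero_nearestChain (hd : ∀ a x y, d (x * a) (y * a) = d x y)
    (hC : MeasurableSet {q : G × Ω | q.1 ∈ cell d S q.2})
    (hae : ∀ p, ∀ᵐ x ∂lam, (x, p) ∈ uniqueNearestSet d S) {f : Ω → ℝ≥0∞} :
    vertex (nearestChain d lam S f) 0 = enhance lam f := by
  funext p
  have hpair : Measurable fun x : G => (x, p) := by fun_prop
  have h2 : Measurable fun x : G => (![x, nearestPoint d S (x, p)] : Fin (1 + 1) → G) :=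
    (measurable_pair_nearestPoint hd hC).comp hpair
  rw [vertex, nearestChain, Measure.map_map (measurable_pi_apply 0) h2]
  have : ((fun x : Fin (1 + 1) → G => x 0) ∘ fun x => ![x, nearestPoint d S (x, p)]) = id := rfl
  rw [this, Measure.map_id, enhance]
  refine withDensity_congr_ae ?_
  filter_upwards [hae p] with x hx
  rw [nearestWeight, indicator_of_mem hx]

-- The points whose nearest point is `y` form the cell at `y • p` translated by `y`. The sum over
-- `y` runs over the countable set `orbitSet S p`, which permits the exchange with the integral; for
-- given `x` at most one term survives.
omit [StandardBorelSpace Ω] in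
theorem lintegral_enhance_count_cellIntegral [SFinite lam] [lam.IsMulRightInvariant]
    (hd : ∀ a x y, d (x * a) (y * a) = d x y)
    (hC : MeasurableSet {q : G × Ω | q.1 ∈ cell d S q.2}) {f : Ω → ℝ≥0∞} (hf : Measurable f)
    {p : Ω} (hp : (orbitSet S p : Set G).Countable) {h : G → ℝ≥0∞} (hh : Measurable h) :
    ∫⁻ x, h x ∂(enhance (Measure.count : Measure G) (cellIntegral d lam S f) p)
      = ∫⁻ x, nearestWeight d S f (x, p) * h (nearestPoint d S (x, p)) ∂lam := by
  have hg := measurable_cellIntegral hC lam hf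
  have hgp : Measurable fun x : G => cellIntegral d lam S f (x • p) := by fun_prop
  have : Countable (orbitSet S p : Set G) := hp
  have hfp : Measurable fun x : G => f (x • p) := by fun_prop
  have hmeas : ∀ y : G, MeasurableSet {x | IsUniqueNearest d (orbitSet S p) x y} := fun y =>
    (by fun_prop : Measurable fun x : G => ((x, p), y)) (measurableSet_setOf_isUniqueNearest hd hC)
  have hcell : ∀ y : G, cellIntegral d lam S f (y • p) =
      ∫⁻ x, {x | IsUniqueNearest d (orbitSet S p) x y}.indicator (fun x => f (x • p)) x ∂lam := by
    intro y
    rw [cellIntegral, ← lintegral_indicator (measurableSet_cell hC _),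
      ← lintegral_mul_right_eq_self _ y⁻¹]
    refine lintegral_congr fun x => ?_
    by_cases hx : IsUniqueNearest d (orbitSet S p) x y
    · have hx' := (isUniqueNearest_iff_mem_cell hd).1 hx
      rw [indicator_of_mem hx', indicator_of_mem (by exact hx), smul_smul]
      simp
    · have hx' := mt (isUniqueNearest_iff_mem_cell hd).2 hx
      rw [indicator_of_notMem hx', indicator_of_notMem (by exact hx)]
  rw [enhance, lintegral_withDensity_eq_lintegral_mul _ hgp hh, lintegral_count]
  simp only [Pi.mul_apply]
  have hsupp : support (fun x : G => cellIntegral d lam S f (x • p) * h x) ⊆ orbitSet S p := by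
    intro x hx
    by_contra hxS
    exact hx (by simp [cellIntegral_eq_zero (d := d) lam f (show x • p ∉ S from hxS)])
  rw [← tsum_subtype_eq_of_support_subset hsupp]
  simp_rw [hcell]
  set I : G → G → ℝ≥0∞ := fun y =>
    {x | IsUniqueNearest d (orbitSet S p) x y}.indicator fun x => f (x • p) with hI
  have hIm : ∀ y, Measurable (I y) := fun y => hfp.indicator (hmeas y)
  have hIn : ∀ x y, ¬ IsUniqueNearest d (orbitSet S p) x y → I y x = 0 := fun x y hxy =>
    indicator_of_notMem (s := {x' | IsUniqueNearest d (orbitSet S p) x' y}) hxy _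
  calc ∑' y : (orbitSet S p : Set G), (∫⁻ x, I y x ∂lam) * h y
      = ∑' y : (orbitSet S p : Set G), ∫⁻ x, I y x * h y ∂lam :=
        tsum_congr fun y => (lintegral_mul_const _ (hIm y)).symm
    _ = ∫⁻ x, ∑' y : (orbitSet S p : Set G), I y x * h y ∂lam :=
        (lintegral_tsum fun y : (orbitSet S p : Set G) => ((hIm y).mul_const (h y)).aemeasurable).symm
    _ = _ := by
      refine lintegral_congr fun x => ?_
      by_cases hx : (x, p) ∈ uniqueNearestSet d S
      · have hn := isUniqueNearest_nearestPoint hx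
        have hIx : I (nearestPoint d S (x, p)) x = nearestWeight d S f (x, p) := by
          rw [nearestWeight, indicator_of_mem hx]
          exact indicator_of_mem (s := {x' | IsUniqueNearest d (orbitSet S p) x' _}) hn _
        rw [tsum_eq_single (⟨nearestPoint d S (x, p), hn.1⟩ : (orbitSet S p : Set G)), hIx]
        intro y hy
        rw [hIn x y fun hxy => hy (Subtype.ext (IsUniqueNearest.unique hxy hn)), zero_mul]
      · rw [nearestWeight, indicator_of_notMem hx, zero_mul, ENNReal.tsum_eq_zero]
        intro y
        rw [hIn x y fun hxy => hx ⟨y, hxy⟩, zero_mul]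

theorem vertex_one_nearestChain [SFinite lam] [lam.IsMulRightInvariant]
    (hd : ∀ a x y, d (x * a) (y * a) = d x y)
    (hC : MeasurableSet {q : G × Ω | q.1 ∈ cell d S q.2})
    (hcount : ∀ p : Ω, (orbitSet S p : Set G).Countable) {f : Ω → ℝ≥0∞} (hf : Measurable f) :
    vertex (nearestChain d lam S f) 1 =
      enhance (Measure.count : Measure G) (cellIntegral d lam S f) := by
  funext p
  refine Measure.ext_of_lintegral _ fun h hh => ?_
  have hh1 : Measurable fun x : Fin (1 + 1) → G => h (x 1) := hh.comp (measurable_pi_apply 1)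
  rw [lintegral_enhance_count_cellIntegral hd hC hf (hcount p) hh, vertex,
    lintegral_map hh (measurable_pi_apply 1), lintegral_nearestChain hd hC hf hh1]
  rfl

/-- Tonelli turns "for all `p`, almost every `x`" into "for some `x`, almost every `p`"; invariance
of `μ` then moves `x` to `1`. -/
theorem ae_mem_uniqueNearestSet_one [SFinite lam] [NeZero lam] {μ : Measure Ω} [SFinite μ]
    [SMulInvariantMeasure G Ω μ] (hd : ∀ a x y, d (x * a) (y * a) = d x y)
    (hC : MeasurableSet {q : G × Ω | q.1 ∈ cell d S q.2})
    (hae : ∀ p, ∀ᵐ x ∂lam, (x, p) ∈ uniqueNearestSet d S) :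
    ∀ᵐ p ∂μ, ((1 : G), p) ∈ uniqueNearestSet d S := by
  have hU := measurableSet_uniqueNearestSet hd hC
  have h0 : lam.prod μ (uniqueNearestSet d S)ᶜ = 0 := by
    rw [Measure.prod_apply_symm hU.compl]
    exact (lintegral_congr fun p => hae p).trans lintegral_zero
  rw [Measure.measure_prod_null hU.compl] at h0
  obtain ⟨x, hx⟩ := h0.exists
  have h1 : (fun p => x • p) ⁻¹' {p | ((1 : G), p) ∈ (uniqueNearestSet d S)ᶜ} =
      Prod.mk x ⁻¹' (uniqueNearestSet d S)ᶜ := by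
    ext p
    have := mem_uniqueNearestSet_smul (S := S) (x := 1) (a := x) (p := p) hd
    rw [one_mul] at this
    exact not_congr this
  rw [ae_iff]
  change μ {p | ((1 : G), p) ∈ (uniqueNearestSet d S)ᶜ} = 0
  rw [← measure_preimage_smul_of_nullMeasurableSet (c := x), h1]
  · exact hx
  · exact ((by fun_prop : Measurable fun p : Ω => ((1 : G), p)) hU.compl).nullMeasurableSet

/-- An invariant probability measure is recovered from the restriction to `S` of its infinitesimal
measure. -/
theorem lintegral_eq_setLIntegral_cellIntegral [SFinite lam] [NeZero lam] [lam.IsMulRightInvariant]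
    [lam.IsMulLeftInvariant] {μ ν : Measure Ω} [SFinite μ] [SMulInvariantMeasure G Ω μ]
    (hd : ∀ a x y, d (x * a) (y * a) = d x y)
    (hC : MeasurableSet {q : G × Ω | q.1 ∈ cell d S q.2})
    (hae : ∀ p, ∀ᵐ x ∂lam, (x, p) ∈ uniqueNearestSet d S)
    (hcount : ∀ p : Ω, (orbitSet S p : Set G).Countable)
    (hν : IsInfinitesimalMeasure lam (Measure.count : Measure G) μ ν)
    {h : G → ℝ≥0} (hc : Continuous h) (hs : HasCompactSupport h)
    (h0 : ∫⁻ x, (h x : ℝ≥0∞) ∂lam ≠ 0) (ht : ∫⁻ x, (h x : ℝ≥0∞) ∂lam ≠ ⊤)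
    {f : Ω → ℝ≥0∞} (hf : Measurable f) :
    ∫⁻ p, f p ∂μ = ∫⁻ p in S, cellIntegral d lam S f p ∂ν := by
  have hm : Measurable fun x => (h x : ℝ≥0∞) := by fun_prop
  have hg := measurable_cellIntegral hC lam hf
  have hgS : ∫⁻ p in S, cellIntegral d lam S f p ∂ν = ∫⁻ p, cellIntegral d lam S f p ∂ν :=
    setLIntegral_eq_of_support_subset fun p hp => by
      by_contra hpS
      exact hp (cellIntegral_eq_zero lam f hpS)
  let F : G × Ω → ℝ≥0∞ := fun q => nearestWeight d S f q * h (nearestPoint d S q)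
  have hn1 := measurable_nearestPoint hd hC
  have hF : Measurable F := (measurable_nearestWeight hd hC hf).mul (hm.comp hn1)
  -- Mass transport: substituting `x • p` for `p` sees the configuration from `x`, whose nearest
  -- point is the one seen from `1`, translated by `x`.
  have hF1 : ∀ x, ∫⁻ p, F (x, p) ∂μ = ∫⁻ p, f p * h (nearestPoint d S (1, p) * x) ∂μ := by
    intro x
    rw [← (measurePreserving_smul x μ).lintegral_comp_emb (measurableEmbedding_const_smul x)
      (fun p => f p * h (nearestPoint d S (1, p) * x))]
    have hx := (measurePreserving_smul x μ).quasiMeasurePreserving.ae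
      (ae_mem_uniqueNearestSet_one hd hC hae)
    refine lintegral_congr_ae ?_
    filter_upwards [hx] with p hp
    have hp' := (mem_uniqueNearestSet_smul hd).1 hp
    have hn := nearestPoint_smul hd hp
    rw [one_mul] at hp' hn
    simp only [F, nearestWeight, indicator_of_mem hp', hn]
  have hpm : Measurable fun q : G × Ω => f q.2 * h (nearestPoint d S (1, q.2) * q.1) := by
    have h1 : Measurable fun q : G × Ω => nearestPoint d S (1, q.2) := hn1.comp (by fun_prop)
    have h2 : Measurable fun q : G × Ω => nearestPoint d S (1, q.2) * q.1 := by fun_prop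
    exact (by fun_prop : Measurable fun q : G × Ω => f q.2).mul (hm.comp h2)
  have key : (∫⁻ x, (h x : ℝ≥0∞) ∂lam) * ∫⁻ p, cellIntegral d lam S f p ∂ν =
      (∫⁻ x, (h x : ℝ≥0∞) ∂lam) * ∫⁻ p, f p ∂μ := by
    rw [← hν _ hg h hc hs]
    rw [lintegral_congr fun p => lintegral_enhance_count_cellIntegral hd hC hf (hcount p) hm]
    calc ∫⁻ p, ∫⁻ x, F (x, p) ∂lam ∂μ = ∫⁻ x, ∫⁻ p, F (x, p) ∂μ ∂lam :=
          (lintegral_lintegral_swap hF.aemeasurable).symm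
      _ = ∫⁻ x, ∫⁻ p, f p * h (nearestPoint d S (1, p) * x) ∂μ ∂lam := by simp_rw [hF1]
      _ = ∫⁻ p, ∫⁻ x, f p * h (nearestPoint d S (1, p) * x) ∂lam ∂μ :=
          lintegral_lintegral_swap hpm.aemeasurable
      _ = ∫⁻ p, f p * ∫⁻ x, (h x : ℝ≥0∞) ∂lam ∂μ := by
          refine lintegral_congr fun p => ?_
          have hmp : Measurable fun x => (h (nearestPoint d S (1, p) * x) : ℝ≥0∞) :=
            hm.comp (measurable_const_mul _)
          -- Here unimodularity enters: `lam` must be left invariant as well to absorb the nearest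
          -- point.
          rw [lintegral_const_mul _ hmp, lintegral_mul_left_eq_self (fun x => (h x : ℝ≥0∞))]
      _ = _ := by rw [lintegral_mul_const _ hf, mul_comm]
  rw [hgS]
  exact ((ENNReal.mul_right_inj h0 ht).1 key).symm

end NearestChain

end

section

open MeasureTheory Set Filter Topology Function

/-! ### Minimizing curves in proper length spaces. -/

section Geodesics

variable {X : Type*} [MetricSpace X]

/-- In a proper space, approximate intermediate points can be replaced by exact ones. -/
theorem exists_dist_le_of_approx [ProperSpace X]
    (happ : ∀ (x y : X) (t ε : ℝ), 0 ≤ t → t ≤ dist x y → 0 < ε →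
      ∃ z, dist x z ≤ t ∧ dist z y ≤ dist x y - t + ε)
    {x y : X} {r s : ℝ} (hr : 0 ≤ r) (hs : 0 ≤ s) (h : dist x y ≤ r + s) :
    ∃ z, dist x z ≤ r ∧ dist z y ≤ s := by
  rcases le_total (dist x y) r with hxr | hxr
  · exact ⟨y, hxr, by simpa using hs⟩
  obtain ⟨z, hz, hmin⟩ := (isCompact_closedBall x r).exists_isMinOn ⟨x, by simpa using hr⟩
    (continuous_id.dist continuous_const : Continuous fun z => dist z y).continuousOn
  refine ⟨z, by rw [dist_comm]; exact hz, ?_⟩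
  refine le_of_forall_pos_le_add fun ε hε => ?_
  obtain ⟨w, hw, hwy⟩ := happ x y r ε hr hxr hε
  have : dist z y ≤ dist w y := isMinOn_iff.1 hmin w (by rw [Metric.mem_closedBall, dist_comm]; exact hw)
  linarith

/-- Times are inserted in increasing order. The bound on the distance to `y` is carried along
because it is what allows the next intermediate point to be chosen. -/
theorem exists_chain_of_finset {x y : X} {L : ℝ}
    (hmid : ∀ (x y : X) (r s : ℝ), 0 ≤ r → 0 ≤ s → dist x y ≤ r + s →
      ∃ z, dist x z ≤ r ∧ dist z y ≤ s)
    (hL : dist x y ≤ L) (F : Finset ℝ) (hF : ∀ t ∈ F, 0 ≤ t ∧ t ≤ L) :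
    ∃ γ : ℝ → X, (∀ s ∈ F, ∀ t ∈ F, s ≤ t → dist (γ s) (γ t) ≤ t - s) ∧
      ∀ t ∈ F, dist x (γ t) ≤ t ∧ dist (γ t) y ≤ L - t := by
  induction F using Finset.induction_on_max with
  | empty => exact ⟨fun _ => x, by simp, by simp⟩
  | insert m F hm ih =>
    obtain ⟨γ, h1, h2⟩ := ih fun t ht => hF t (Finset.mem_insert_of_mem ht)
    obtain ⟨hm0, hmL⟩ := hF m (Finset.mem_insert_self m F)
    obtain ⟨z, hz1, hz2, hz3⟩ : ∃ z, (∀ s ∈ F, dist (γ s) z ≤ m - s) ∧ dist x z ≤ m ∧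
        dist z y ≤ L - m := by
      rcases F.eq_empty_or_nonempty with rfl | hne
      · obtain ⟨z, hz, hz'⟩ := hmid x y m (L - m) hm0 (by linarith) (by linarith)
        exact ⟨z, by simp, hz, hz'⟩
      · have hM := F.max'_mem hne
        set M := F.max' hne
        have hMm := hm M hM
        obtain ⟨z, hz, hz'⟩ := hmid (γ M) y (m - M) (L - m) (by linarith) (by linarith)
          (by linarith [(h2 M hM).2])
        refine ⟨z, fun s hs => ?_, ?_, hz'⟩
        · have := h1 s hs M hM (F.le_max' s hs)
          linarith [dist_triangle (γ s) (γ M) z]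
        · linarith [dist_triangle x (γ M) z, (h2 M hM).1]
    have hne : ∀ t ∈ F, t ≠ m := fun t ht => (hm t ht).ne
    refine ⟨update γ m z, fun s hs t ht hst => ?_, fun t ht => ?_⟩
    · obtain hs | hs := Finset.mem_insert.1 hs <;> obtain ht | ht := Finset.mem_insert.1 ht
      · simp [hs, ht]
      · exact absurd (hm t ht) (hs ▸ hst).not_gt
      · rw [ht, update_self, update_of_ne (hne s hs)]
        exact hz1 s hs
      · rw [update_of_ne (hne s hs), update_of_ne (hne t ht)]
        exact h1 s hs t ht hst
    · rcases Finset.mem_insert.1 ht with ht | ht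
      · subst ht; rw [update_self]; exact ⟨hz2, hz3⟩
      · rw [update_of_ne (hne t ht)]; exact h2 t ht

/-- A proper space with intermediate points is geodesic. -/
theorem exists_geodesic [ProperSpace X]
    (hmid : ∀ (x y : X) (r s : ℝ), 0 ≤ r → 0 ≤ s → dist x y ≤ r + s →
      ∃ z, dist x z ≤ r ∧ dist z y ≤ s) (x y : X) :
    ∃ γ : ℝ → X, γ 0 = x ∧ γ (dist x y) = y ∧
      ∀ s ∈ Icc 0 (dist x y), ∀ t ∈ Icc 0 (dist x y), dist (γ s) (γ t) = |s - t| := by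
  classical
  set L := dist x y with hL
  have hL0 : 0 ≤ L := dist_nonneg
  -- Each pair of times imposes a closed condition on a curve in the product of closed balls,
  -- compact by Tychonoff. Finitely many conditions can be met by a finite chain, so all can be met
  -- at once.
  let Z : Icc 0 L × Icc 0 L → Set (ℝ → X) := fun i =>
    {γ | ((i.1 : ℝ) ≤ i.2 → dist (γ i.1) (γ i.2) ≤ i.2 - i.1) ∧ dist x (γ i.1) ≤ i.1 ∧
      dist (γ i.1) y ≤ L - i.1}
  have hZc : ∀ i, IsClosed (Z i) := by
    intro i
    have h1 : IsClosed {γ : ℝ → X | (i.1 : ℝ) ≤ i.2 → dist (γ i.1) (γ i.2) ≤ i.2 - i.1} := by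
      by_cases hi : (i.1 : ℝ) ≤ i.2
      · simp only [hi, forall_true_left]
        exact isClosed_le ((continuous_apply _).dist (continuous_apply _)) continuous_const
      · simp only [hi, false_imp_iff]
        exact isClosed_univ
    exact h1.inter ((isClosed_le (continuous_const.dist (continuous_apply _))
      continuous_const).inter (isClosed_le ((continuous_apply _).dist continuous_const)
      continuous_const))
  have hK : IsCompact (Set.pi univ fun _ : ℝ => Metric.closedBall x L) :=
    isCompact_univ_pi fun _ => isCompact_closedBall x L
  obtain ⟨γ, -, hγ⟩ := hK.inter_iInter_nonempty Z hZc (by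
    intro u
    let F : Finset ℝ := u.image (fun i => (i.1 : ℝ)) ∪ u.image (fun i => (i.2 : ℝ))
    have hF : ∀ t ∈ F, 0 ≤ t ∧ t ≤ L := by
      intro t ht
      simp only [F, Finset.mem_union, Finset.mem_image] at ht
      rcases ht with ⟨i, _, rfl⟩ | ⟨i, _, rfl⟩
      · exact i.1.2
      · exact i.2.2
    obtain ⟨γ, h1, h2⟩ := exists_chain_of_finset hmid hL.ge F hF
    refine ⟨fun t => if t ∈ F then γ t else x, ?_, ?_⟩
    · intro t _
      by_cases ht : t ∈ F
      · simp only [ht, if_true, Metric.mem_closedBall]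
        rw [dist_comm]
        exact (h2 t ht).1.trans (hF t ht).2
      · simpa [ht] using hL0
    · refine mem_iInter₂.2 fun i hi => ?_
      have hi1 : (i.1 : ℝ) ∈ F := Finset.mem_union_left _ (Finset.mem_image_of_mem _ hi)
      have hi2 : (i.2 : ℝ) ∈ F := Finset.mem_union_right _ (Finset.mem_image_of_mem _ hi)
      simp only [Z, mem_ofPred_eq, hi1, hi2, if_true]
      exact ⟨h1 _ hi1 _ hi2, h2 _ hi1⟩)
  rw [mem_iInter] at hγ
  have hle : ∀ s ∈ Icc 0 L, ∀ t ∈ Icc 0 L, s ≤ t → dist (γ s) (γ t) ≤ t - s :=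
    fun s hs t ht => (hγ (⟨s, hs⟩, ⟨t, ht⟩)).1
  have hend : ∀ t ∈ Icc 0 L, dist x (γ t) ≤ t ∧ dist (γ t) y ≤ L - t :=
    fun t ht => (hγ (⟨t, ht⟩, ⟨t, ht⟩)).2
  -- A strict inequality would make the total length from `x` to `y` smaller than `L = dist x y`.
  have heq : ∀ s ∈ Icc 0 L, ∀ t ∈ Icc 0 L, s ≤ t → dist (γ s) (γ t) = t - s := by
    intro s hs t ht hst
    refine le_antisymm (hle s hs t ht hst) ?_
    linarith [dist_triangle4 x (γ s) (γ t) y, (hend s hs).1, (hend t ht).2]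
  refine ⟨γ, ?_, ?_, fun s hs t ht => ?_⟩
  · have := (hend 0 ⟨le_rfl, hL0⟩).1
    exact (dist_le_zero.1 this).symm
  · have := (hend L ⟨hL0, le_rfl⟩).2
    exact dist_le_zero.1 (by linarith)
  · rcases le_total s t with hst | hst
    · rw [heq s hs t ht hst, abs_sub_comm, abs_of_nonneg (by linarith)]
    · rw [dist_comm, heq t ht s hs hst, abs_of_nonneg (by linarith)]

end Geodesics

end

/-! ### First-order calculus in a chart at the identity. -/

section

open MeasureTheory Set Filter Topology Function Asymptotics

theorem dist_eq_dist_mul_inv_one {G : Type*} [Group G] [PseudoMetricSpace G]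
    [IsIsometricSMul Gᵐᵒᵖ G] (x y : G) : dist x y = dist (x * y⁻¹) 1 := by
  have := dist_mul_right x y y⁻¹
  rw [← this, mul_inv_cancel]

/-- `ψ` is a chart at the identity of a group with a right-invariant distance, with local inverse
`σ`, which is an isometry to first order at the identity and in which the group operations are
sufficiently regular. -/
structure IsLogChart {F G : Type*} [NormedAddCommGroup F] [NormedSpace ℝ F] [Group G]
    [MetricSpace G] (ψ : G → F) (σ : F → G) : Prop where
  symm_zero : σ 0 = 1
  continuousAt : ContinuousAt ψ 1
  continuousAt_symm : ContinuousAt σ 0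
  left_inv : ∀ᶠ z in 𝓝 1, σ (ψ z) = z
  right_inv : ∀ᶠ v in 𝓝 0, ψ (σ v) = v
  dist_isLittleO : (fun z => dist z 1 - ‖ψ z‖) =o[𝓝 1] ψ
  div : HasStrictFDerivAt (fun q : F × F => ψ (σ q.1 * (σ q.2)⁻¹))
    (ContinuousLinearMap.fst ℝ F F - ContinuousLinearMap.snd ℝ F F) 0
  mul : ∀ᶠ v in 𝓝 0, DifferentiableAt ℝ (fun u => ψ (σ u * σ v)) 0
  conj : ∀ y, DifferentiableAt ℝ (fun v => ψ (y * σ v * y⁻¹)) 0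
  exists_norm_conj_sub_le : ∃ C, ∀ᶠ q in 𝓝 (0 : F × F),
    ‖ψ (σ q.1 * σ q.2 * (σ q.1)⁻¹) - q.2‖ ≤ C * ‖q.1‖ * ‖q.2‖

namespace IsLogChart

variable {F G : Type*} [NormedAddCommGroup F] [NormedSpace ℝ F] [Group G]
  [MetricSpace G] {ψ : G → F} {σ : F → G}

section Basic

variable (h : IsLogChart ψ σ)
include h

theorem map_one : ψ 1 = 0 := by
  have := h.right_inv.self_of_nhds
  rwa [h.symm_zero] at this

theorem tendsto : Tendsto ψ (𝓝 1) (𝓝 0) := by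
  simpa [ContinuousAt, h.map_one] using h.continuousAt

theorem tendsto_symm : Tendsto σ (𝓝 0) (𝓝 1) := by
  simpa [ContinuousAt, h.symm_zero] using h.continuousAt_symm

theorem dist_one_le : ∀ᶠ z in 𝓝 1, dist z 1 ≤ 2 * ‖ψ z‖ := by
  filter_upwards [h.dist_isLittleO.bound one_pos] with z hz
  have := (abs_le.1 hz).2
  linarith

theorem norm_le : ∀ᶠ z in 𝓝 1, ‖ψ z‖ ≤ 2 * dist z 1 := by
  filter_upwards [h.dist_isLittleO.bound (half_pos one_pos)] with z hz
  have := (abs_le.1 hz).1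
  linarith

variable [IsIsometricSMul Gᵐᵒᵖ G]

theorem tendsto_div : Tendsto (fun q : F × F => σ q.1 * (σ q.2)⁻¹) (𝓝 0) (𝓝 1) := by
  rw [tendsto_iff_dist_tendsto_zero]
  have h1 : Tendsto (fun q : F × F => σ q.1) (𝓝 0) (𝓝 1) :=
    h.tendsto_symm.comp (continuous_fst.tendsto' (0 : F × F) (0 : F) rfl)
  have h2 : Tendsto (fun q : F × F => σ q.2) (𝓝 0) (𝓝 1) :=
    h.tendsto_symm.comp (continuous_snd.tendsto' (0 : F × F) (0 : F) rfl)
  have := h1.dist h2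
  rw [dist_self] at this
  exact this.congr fun q => dist_eq_dist_mul_inv_one _ _

/-- By right invariance the distance is that of the quotient from `1`; there the chart is isometric
to first order, and the quotient reads `q.1 - q.2` to first order. -/
theorem dist_symm_isLittleO :
    (fun q : F × F => dist (σ q.1) (σ q.2) - ‖q.1 - q.2‖) =o[𝓝 0] fun q => q := by
  have hd : (fun q : F × F => ψ (σ q.1 * (σ q.2)⁻¹) - (q.1 - q.2)) =o[𝓝 0] fun q => q := by
    simpa [h.symm_zero, h.map_one] using h.div.hasFDerivAt.isLittleO
  have hO : (fun q : F × F => ψ (σ q.1 * (σ q.2)⁻¹)) =O[𝓝 0] fun q => q := by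
    simpa [h.symm_zero, h.map_one] using h.div.hasFDerivAt.isBigO_sub
  have h1 := (h.dist_isLittleO.comp_tendsto h.tendsto_div).trans_isBigO hO
  have h2 : (fun q : F × F => ‖ψ (σ q.1 * (σ q.2)⁻¹)‖ - ‖q.1 - q.2‖) =o[𝓝 0] fun q => q := by
    refine IsBigO.trans_isLittleO (.of_bound 1 (Eventually.of_forall fun q => ?_)) hd
    simpa [h.symm_zero, h.map_one] using
      abs_norm_sub_norm_le (ψ (σ q.1 * (σ q.2)⁻¹)) (q.1 - q.2)
  refine (h1.add h2).congr_left fun q => ?_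
  simp only [comp_apply, dist_eq_dist_mul_inv_one (σ q.1) (σ q.2)]
  ring

theorem exists_dist_symm_le :
    ∃ C : ℝ, 0 < C ∧ ∀ᶠ q in 𝓝 (0 : F × F), dist (σ q.1) (σ q.2) ≤ C * ‖q.1 - q.2‖ := by
  obtain ⟨K, s, hs, hK⟩ := h.div.exists_lipschitzOnWith
  refine ⟨2 * (K + 1), by positivity, ?_⟩
  have hdiag : Tendsto (fun q : F × F => (q.2, q.2)) (𝓝 0) (𝓝 0) :=
    (continuous_snd.prodMk continuous_snd).tendsto' _ _ rfl
  filter_upwards [hs, hdiag.eventually hs, h.tendsto_div.eventually h.dist_one_le] with q h1 h2 h3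
  rw [dist_eq_dist_mul_inv_one]
  have := hK.dist_le_mul _ h1 _ h2
  simp only [mul_inv_cancel, h.map_one, dist_zero_right] at this
  have hle : dist q (q.2, q.2) = ‖q.1 - q.2‖ := by
    rw [Prod.dist_eq, dist_self, dist_eq_norm]
    simp
  rw [hle] at this
  nlinarith [norm_nonneg (q.1 - q.2)]

/-- A quadratic commutator bound in terms of the distance. It controls, in the Grönwall argument,
how moving along one curve distorts the quotient of two curves. -/
theorem exists_dist_conj_le :
    ∃ C : ℝ, 0 < C ∧ ∀ᶠ q in 𝓝 (1 : G × G),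
      dist (q.1 * q.2 * q.1⁻¹) q.2 ≤ C * dist q.1 1 * dist q.2 1 := by
  obtain ⟨C, hC, hle⟩ := h.exists_dist_symm_le
  obtain ⟨K, hK⟩ := h.exists_norm_conj_sub_le
  have t1 : Tendsto (fun q : G × G => q.1) (𝓝 1) (𝓝 1) := continuous_fst.tendsto' _ _ rfl
  have t2 : Tendsto (fun q : G × G => q.2) (𝓝 1) (𝓝 1) := continuous_snd.tendsto' _ _ rfl
  have t12 : Tendsto (fun q : G × G => (ψ q.1, ψ q.2)) (𝓝 1) (𝓝 0) :=
    (h.tendsto.comp t1).prodMk_nhds (h.tendsto.comp t2)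
  have t3 : Tendsto (fun q : G × G => q.1 * q.2 * q.1⁻¹) (𝓝 1) (𝓝 1) := by
    rw [tendsto_iff_dist_tendsto_zero]
    have : Tendsto (fun q : G × G => dist q.1 1 + dist q.2 1 + dist q.1 1) (𝓝 1) (𝓝 0) := by
      have e1 : Tendsto (fun q : G × G => dist q.1 1) (𝓝 1) (𝓝 0) := by
        simpa using t1.dist (tendsto_const_nhds (x := (1 : G)))
      have e2 : Tendsto (fun q : G × G => dist q.2 1) (𝓝 1) (𝓝 0) := by
        simpa using t2.dist (tendsto_const_nhds (x := (1 : G)))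
      simpa using (e1.add e2).add e1
    refine squeeze_zero (fun _ => dist_nonneg) (fun q => ?_) this
    rw [← dist_mul_right (q.1 * q.2 * q.1⁻¹) 1 q.1, inv_mul_cancel_right, one_mul]
    calc dist (q.1 * q.2) q.1 ≤ dist (q.1 * q.2) q.2 + dist q.2 1 + dist 1 q.1 :=
          dist_triangle4 _ _ _ _
      _ = _ := by
          rw [dist_comm 1 q.1, ← dist_mul_right q.1 1 q.2, one_mul]
  refine ⟨C * (|K| + 1) * 2 * 2, by positivity, ?_⟩
  have t4 : Tendsto (fun q : G × G => (ψ (q.1 * q.2 * q.1⁻¹), ψ q.2)) (𝓝 1) (𝓝 0) :=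
    (h.tendsto.comp t3).prodMk_nhds (h.tendsto.comp t2)
  filter_upwards [t4.eventually hle, t12.eventually hK, t1.eventually h.left_inv,
    t2.eventually h.left_inv, t3.eventually h.left_inv, t1.eventually h.norm_le,
    t2.eventually h.norm_le] with q h1 h2 e1 e2 e3 n1 n2
  simp only [e1, e2, e3] at h1 h2
  refine h1.trans ?_
  have hK' : K * ‖ψ q.1‖ * ‖ψ q.2‖ ≤ (|K| + 1) * (2 * dist q.1 1) * (2 * dist q.2 1) := by
    gcongr
    linarith [le_abs_self K]
  calc C * ‖ψ (q.1 * q.2 * q.1⁻¹) - ψ q.2‖ ≤ C * ((|K| + 1) * (2 * dist q.1 1) * (2 * dist q.2 1)) := by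
        gcongr; exact h2.trans hK'
    _ = _ := by ring

end Basic

/-- The adjoint representation, read in the chart. -/
noncomputable def adjoint (ψ : G → F) (σ : F → G) (y : G) : F →L[ℝ] F :=
  fderiv ℝ (fun v => ψ (y * σ v * y⁻¹)) 0

section Adjoint

variable (h : IsLogChart ψ σ)
include h

theorem hasFDerivAt_conj (y : G) : HasFDerivAt (fun v => ψ (y * σ v * y⁻¹)) (adjoint ψ σ y) 0 :=
  (h.conj y).hasFDerivAt

theorem adjoint_one : adjoint ψ σ 1 = .id ℝ F := by
  refine (h.hasFDerivAt_conj 1).unique ((hasFDerivAt_id (0 : F)).congr_of_eventuallyEq ?_)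
  filter_upwards [h.right_inv] with v hv
  simp [hv]

theorem tendsto_conj [IsTopologicalGroup G] (y : G) :
    Tendsto (fun v => y * σ v * y⁻¹) (𝓝 0) (𝓝 1) := by
  have := (h.tendsto_symm.const_mul y).mul_const y⁻¹
  simpa using this

theorem adjoint_mul [IsTopologicalGroup G] (x y : G) :
    adjoint ψ σ (x * y) = (adjoint ψ σ x).comp (adjoint ψ σ y) := by
  refine (h.hasFDerivAt_conj (x * y)).unique ?_
  have h0 : ψ (y * σ 0 * y⁻¹) = 0 := by simp [h.symm_zero, h.map_one]
  have h1 : HasFDerivAt (fun v => ψ (x * σ v * x⁻¹)) (adjoint ψ σ x) (ψ (y * σ 0 * y⁻¹)) := by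
    rw [h0]; exact h.hasFDerivAt_conj x
  refine (h1.comp 0 (h.hasFDerivAt_conj y)).congr_of_eventuallyEq ?_
  filter_upwards [(h.tendsto_conj y).eventually h.left_inv] with v hv
  simp only [comp_apply, hv]
  group

/-- The commutator bound, divided by the norm of its second argument, passes to the derivative.
Multiplicativity of `adjoint` spreads this Lipschitz estimate from `1` to the whole group. -/
theorem exists_norm_adjoint_sub_le : ∃ C : ℝ, 0 < C ∧ ∀ᶠ z in 𝓝 (1 : G),
    ‖adjoint ψ σ z - .id ℝ F‖ ≤ C * dist z 1 := by
  obtain ⟨K, hK⟩ := h.exists_norm_conj_sub_le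
  refine ⟨(|K| + 1) * 2, by positivity, ?_⟩
  have hK' : ∀ᶠ a in 𝓝 (0 : F), ∀ᶠ v in 𝓝 (0 : F),
      ‖ψ (σ a * σ v * (σ a)⁻¹) - v‖ ≤ K * ‖a‖ * ‖v‖ := by
    have := hK
    rw [show (0 : F × F) = ((0 : F), (0 : F)) from rfl, nhds_prod_eq] at this
    exact this.curry
  filter_upwards [h.tendsto.eventually hK', h.left_inv, h.norm_le] with z hz e n
  rw [e] at hz
  have hd : HasFDerivAt (fun v => ψ (z * σ v * z⁻¹) - v) (adjoint ψ σ z - .id ℝ F) 0 :=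
    (h.hasFDerivAt_conj z).sub (hasFDerivAt_id 0)
  refine hd.le_of_lip' (by positivity) ?_
  filter_upwards [hz] with v hv
  simp only [h.symm_zero, mul_one, mul_inv_cancel, h.map_one, sub_zero]
  refine hv.trans ?_
  have : K * ‖ψ z‖ ≤ (|K| + 1) * (2 * dist z 1) := by
    gcongr
    linarith [le_abs_self K]
  calc K * ‖ψ z‖ * ‖v‖ ≤ (|K| + 1) * (2 * dist z 1) * ‖v‖ := by gcongr
    _ = _ := by ring

end Adjoint

end IsLogChart

end

/-! ### Minimizing curves are determined by momentum. -/

section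

open MeasureTheory Set Filter Topology Function Asymptotics

section InnerProduct

variable {F : Type*} [NormedAddCommGroup F] [InnerProductSpace ℝ F]

/-- At `v = 0` the inequality forces `‖w‖ = 1`, so an affine function touches `‖v - w‖` from below
at `0` and its slope must be the derivative there. The proof squares the inequality along `t • v`
and compares the first-order terms. -/
theorem eq_neg_inner_of_one_add_le_norm_sub {m : F →L[ℝ] ℝ} {w : F} (hw : ‖w‖ ≤ 1)
    (hm : ∀ v, 1 + m v ≤ ‖v - w‖) (v : F) : m v = -inner ℝ w v := by
  have key : ∀ t : ℝ, |t| * |m v| ≤ 1 → 2 * t * (m v + inner ℝ w v) ≤ t ^ 2 * ‖v‖ ^ 2 := by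
    intro t ht
    have h1 := hm (t • v)
    rw [map_smul, smul_eq_mul] at h1
    have h2 : ‖t • v - w‖ ^ 2 = t ^ 2 * ‖v‖ ^ 2 - 2 * (t * inner ℝ w v) + ‖w‖ ^ 2 := by
      rw [norm_sub_sq_real, norm_smul, mul_pow, Real.norm_eq_abs, sq_abs, real_inner_smul_left,
        real_inner_comm]
    have h3 : 0 ≤ 1 + t * m v := by
      rw [← abs_mul] at ht
      linarith [(abs_le.1 ht).1]
    have h4 : (1 + t * m v) ^ 2 ≤ ‖t • v - w‖ ^ 2 := pow_le_pow_left₀ h3 h1 2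
    have h5 : ‖w‖ ^ 2 ≤ 1 := pow_le_one₀ (norm_nonneg _) hw
    nlinarith [sq_nonneg (t * m v)]
  set c := m v + inner ℝ w v with hc
  suffices c = 0 by linarith
  by_contra hne
  -- The first summand makes `t = ±1 / n` admissible in `key`; the second makes the linear term beat
  -- the quadratic one.
  obtain ⟨n, hn⟩ := exists_nat_gt (|m v| + ‖v‖ ^ 2 / |c|)
  have hcpos : 0 < |c| := abs_pos.2 hne
  have hnpos : (0 : ℝ) < n := lt_of_le_of_lt (by positivity) hn
  have hd : ‖v‖ ^ 2 < n * |c| := by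
    rw [← div_lt_iff₀ hcpos]
    linarith [abs_nonneg (m v)]
  have hmn : |m v| ≤ n := by
    have : 0 ≤ ‖v‖ ^ 2 / |c| := by positivity
    linarith
  have hsm : ∀ t : ℝ, |t| = 1 / n → 2 * t * c ≤ t ^ 2 * ‖v‖ ^ 2 := fun t ht => key t (by
    rw [ht, one_div, inv_mul_le_iff₀ hnpos, mul_one]; exact hmn)
  have hfin : 2 * (1 / n) * |c| ≤ (1 / n : ℝ) ^ 2 * ‖v‖ ^ 2 := by
    rcases abs_cases c with ⟨h, -⟩ | ⟨h, -⟩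
    · rw [h]; exact hsm _ (abs_of_pos (by positivity))
    · have := hsm (-(1 / n)) (by rw [abs_neg, abs_of_pos (by positivity)])
      rw [h]
      nlinarith
  have : 2 * (n * |c|) ≤ ‖v‖ ^ 2 := by
    have h6 := mul_le_mul_of_nonneg_left hfin (by positivity : (0 : ℝ) ≤ n ^ 2)
    field_simp at h6
    nlinarith
  nlinarith

end InnerProduct

namespace IsLogChart

variable {F G : Type*} [NormedAddCommGroup F] [InnerProductSpace ℝ F] [FiniteDimensional ℝ F]
  [Group G] [MetricSpace G] [IsIsometricSMul Gᵐᵒᵖ G] [IsTopologicalGroup G] {ψ : G → F} {σ : F → G}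

/-- The initial velocity at `y` of a minimizing curve from `1`, in terms of the derivative `ℓ` at
`1` of the distance function to the target. -/
noncomputable def velocity (ψ : G → F) (σ : F → G) (ℓ : F →L[ℝ] ℝ) (y : G) : F :=
  (InnerProductSpace.toDual ℝ F).symm (-(ℓ.comp (adjoint ψ σ y⁻¹)))

variable (h : IsLogChart ψ σ)
include h

/-- The rescaled increments have norm tending to `1`, so by compactness it suffices to identify
their cluster points `w`. Dividing `hf` by `ε` and letting `ε` tend to `0` gives a supporting
inequality for `‖v - w‖` with slope `ℓ ∘ Ad y⁻¹`, which determines `w`. -/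
theorem tendsto_velocity {f : G → ℝ} {x y : G} {ℓ : F →L[ℝ] ℝ}
    (hℓ : HasFDerivAt (fun u => f (σ u * x)) ℓ 0) {q : ℝ → G}
    (hq : ∀ᶠ ε in 𝓝[>] 0, dist (q ε) 1 = ε)
    (hf : ∀ᶠ ε in 𝓝[>] (0 : ℝ), ∀ k, f (k * x) ≤ f x + dist (y * k * y⁻¹) (q ε) - ε) :
    Tendsto (fun ε => ε⁻¹ • ψ (q ε)) (𝓝[>] 0) (𝓝 (velocity ψ σ ℓ y)) := by
  have hpos : ∀ᶠ ε : ℝ in 𝓝[>] 0, 0 < ε := self_mem_nhdsWithin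
  have hid : Tendsto (fun ε : ℝ => ε) (𝓝[>] 0) (𝓝 0) := tendsto_id.mono_left nhdsWithin_le_nhds
  have hq1 : Tendsto q (𝓝[>] 0) (𝓝 1) := by
    rw [tendsto_iff_dist_tendsto_zero]
    exact hid.congr' (hq.mono fun ε hε => hε.symm)
  have hqO : (fun ε => ψ (q ε)) =O[𝓝[>] 0] fun ε => ε := by
    refine .of_bound 2 ?_
    filter_upwards [hq1.eventually h.norm_le, hq, hpos] with ε h1 h2 h3
    rw [h2] at h1
    rwa [Real.norm_of_nonneg h3.le]
  have hnorm : Tendsto (fun ε => ‖ε⁻¹ • ψ (q ε)‖) (𝓝[>] 0) (𝓝 1) := by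
    have h1 := ((h.dist_isLittleO.comp_tendsto hq1).trans_isBigO hqO).tendsto_div_nhds_zero
    have h2 : Tendsto (fun ε => 1 - ((fun z => dist z 1 - ‖ψ z‖) ∘ q) ε / ε) (𝓝[>] 0) (𝓝 1) := by
      simpa using h1.const_sub 1
    refine h2.congr' ?_
    filter_upwards [hq, hpos] with ε h3 h4
    simp only [comp_apply, h3, norm_smul, norm_inv, Real.norm_of_nonneg h4.le]
    field_simp
    ring
  refine (isCompact_closedBall (0 : F) 2).tendsto_nhds_of_unique_mapClusterPt ?_ ?_
  · filter_upwards [hnorm.eventually (Iio_mem_nhds one_lt_two)] with ε hε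
    rw [mem_closedBall_zero_iff]
    exact hε.le
  intro w _ hw
  rw [mapClusterPt_iff_frequently] at hw
  have hw1 : ‖w‖ ≤ 1 := by
    refine le_of_forall_pos_le_add fun δ hδ => ?_
    obtain ⟨ε, h1, h2⟩ := ((hw _ (Metric.ball_mem_nhds w (half_pos hδ))).and_eventually
      (hnorm.eventually (Iio_mem_nhds (lt_add_of_pos_right 1 (half_pos hδ))))).exists
    rw [Metric.mem_ball, dist_eq_norm] at h1
    have := norm_sub_norm_le w (ε⁻¹ • ψ (q ε))
    rw [norm_sub_rev] at this
    linarith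
  have hmain : ∀ v, 1 + (ℓ.comp (adjoint ψ σ y⁻¹)) v ≤ ‖v - w‖ := by
    intro v
    -- The perturbation `k = σ (ε • X)` is chosen so that its conjugate by `y` reads `ε • v` to
    -- first order.
    set X := adjoint ψ σ y⁻¹ v with hX
    have hAd : adjoint ψ σ y X = v := by
      have := h.adjoint_mul y y⁻¹
      rw [mul_inv_cancel, h.adjoint_one] at this
      simpa using (DFunLike.congr_fun this v).symm
    have hline : HasDerivAt (fun ε : ℝ => ε • X) X 0 := by
      simpa using (hasDerivAt_id (0 : ℝ)).smul_const X
    have hne : 𝓝[>] (0 : ℝ) ≤ 𝓝[≠] 0 := nhdsWithin_mono _ fun ε hε => ne_of_gt hε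
    have d1 : Tendsto (fun ε : ℝ => ε⁻¹ * (f (σ (ε • X) * x) - f x)) (𝓝[>] 0) (𝓝 (ℓ X)) := by
      have h0 : HasFDerivAt (fun u => f (σ u * x)) ℓ ((0 : ℝ) • X) := by rwa [zero_smul]
      have h1 : HasDerivAt (fun ε : ℝ => f (σ (ε • X) * x)) (ℓ X) 0 := by
        have := h0.comp_hasDerivAt 0 hline
        exact this
      have h2 := (hasDerivAt_iff_tendsto_slope_zero.1 h1).mono_left hne
      simpa [h.symm_zero] using h2
    have d2' : HasDerivAt (fun ε : ℝ => ψ (y * σ (ε • X) * y⁻¹)) v 0 := by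
      have h0 : HasFDerivAt (fun v => ψ (y * σ v * y⁻¹)) (adjoint ψ σ y) ((0 : ℝ) • X) := by
        rw [zero_smul]; exact h.hasFDerivAt_conj y
      have h1 := h0.comp_hasDerivAt 0 hline
      rwa [hAd] at h1
    have d2 : Tendsto (fun ε : ℝ => ε⁻¹ • ψ (y * σ (ε • X) * y⁻¹)) (𝓝[>] 0) (𝓝 v) := by
      have h2 := (hasDerivAt_iff_tendsto_slope_zero.1 d2').mono_left hne
      simpa [h.symm_zero, h.map_one] using h2
    have hk : Tendsto (fun ε : ℝ => y * σ (ε • X) * y⁻¹) (𝓝[>] 0) (𝓝 1) := by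
      refine (h.tendsto_conj y).comp ?_
      simpa using hid.smul_const X
    have haO : (fun ε : ℝ => ψ (y * σ (ε • X) * y⁻¹)) =O[𝓝[>] 0] fun ε => ε := by
      have := d2'.isBigO_sub.mono (nhdsWithin_le_nhds (s := Ioi 0))
      simpa [h.symm_zero, h.map_one] using this
    have hpair : Tendsto (fun ε : ℝ => (ψ (y * σ (ε • X) * y⁻¹), ψ (q ε))) (𝓝[>] 0) (𝓝 0) :=
      (h.tendsto.comp hk).prodMk_nhds (h.tendsto.comp hq1)
    have d3 := ((h.dist_symm_isLittleO.comp_tendsto hpair).trans_isBigO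
      (haO.prod_left hqO)).tendsto_div_nhds_zero
    have hΦ := (((tendsto_sub_nhds_zero_iff.2 d2).norm.add d3).sub
      (tendsto_sub_nhds_zero_iff.2 d1))
    simp only [norm_zero, add_zero, sub_zero] at hΦ
    refine le_of_forall_pos_le_add fun δ hδ => ?_
    obtain ⟨ε, h1, h2, h3, h4, h5, h6⟩ := ((hw _ (Metric.ball_mem_nhds w (half_pos hδ))).and_eventually
      ((hΦ.eventually (Iio_mem_nhds (half_pos hδ))).and (hpos.and (hf.and
        ((hk.eventually h.left_inv).and (hq1.eventually h.left_inv)))))).exists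
    rw [Metric.mem_ball, dist_eq_norm] at h1
    simp only [comp_apply, h5, h6] at h2
    have h7 := h4 (σ (ε • X))
    have hrw : ε⁻¹ * ‖ψ (y * σ (ε • X) * y⁻¹) - ψ (q ε)‖
        = ‖ε⁻¹ • ψ (y * σ (ε • X) * y⁻¹) - ε⁻¹ • ψ (q ε)‖ := by
      rw [← smul_sub, norm_smul, norm_inv, Real.norm_of_nonneg h3.le]
    have h8 : ε⁻¹ * (f (σ (ε • X) * x) - f x) + 1 ≤ ε⁻¹ * dist (y * σ (ε • X) * y⁻¹) (q ε) := by
      have : ε⁻¹ * (f (σ (ε • X) * x) - f x + ε) ≤ ε⁻¹ * dist (y * σ (ε • X) * y⁻¹) (q ε) := by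
        gcongr
        linarith
      rwa [mul_add, inv_mul_cancel₀ h3.ne'] at this
    rw [div_eq_inv_mul, mul_sub, hrw] at h2
    have h9 := norm_add₃_le (a := ε⁻¹ • ψ (y * σ (ε • X) * y⁻¹) - v) (b := v - w)
      (c := w - ε⁻¹ • ψ (q ε))
    rw [sub_add_sub_cancel, sub_add_sub_cancel, norm_sub_rev w] at h9
    change 1 + ℓ X ≤ _
    linarith
  have := eq_neg_inner_of_one_add_le_norm_sub hw1 hmain
  apply (InnerProductSpace.toDual ℝ F).injective
  rw [velocity, LinearIsometryEquiv.apply_symm_apply]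
  ext v
  rw [InnerProductSpace.toDual_apply_apply, neg_apply, this v, neg_neg]

omit h [MetricSpace G] [IsIsometricSMul Gᵐᵒᵖ G] [IsTopologicalGroup G] in
theorem norm_velocity_sub_velocity (ℓ : F →L[ℝ] ℝ) (y₁ y₂ : G) :
    ‖velocity ψ σ ℓ y₁ - velocity ψ σ ℓ y₂‖
      = ‖ℓ.comp (adjoint ψ σ y₂⁻¹ - adjoint ψ σ y₁⁻¹)‖ := by
  rw [velocity, velocity, ← map_sub, LinearIsometryEquiv.norm_map, ContinuousLinearMap.comp_sub]
  congr 1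
  abel

/-- Two minimizing curves from `1` towards targets whose distance functions share a differentiable
minorant at the base point coincide. -/
theorem eqOn_of_minimizing {f : G → ℝ} {x : G} {ℓ : F →L[ℝ] ℝ} {L : ℝ}
    (hℓ : HasFDerivAt (fun u => f (σ u * x)) ℓ 0) {y₁ y₂ : ℝ → G}
    (h0 : y₁ 0 = y₂ 0)
    (hy₁ : ∀ s ∈ Icc 0 L, ∀ t ∈ Icc 0 L, dist (y₁ s) (y₁ t) = |s - t|)
    (hy₂ : ∀ s ∈ Icc 0 L, ∀ t ∈ Icc 0 L, dist (y₂ s) (y₂ t) = |s - t|)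
    (hf₁ : ∀ s ∈ Icc 0 L, ∀ t ∈ Icc 0 L, s ≤ t → ∀ k,
      f (k * x) ≤ f x + dist (y₁ s * k * (y₁ s)⁻¹) (y₁ t * (y₁ s)⁻¹) - (t - s))
    (hf₂ : ∀ s ∈ Icc 0 L, ∀ t ∈ Icc 0 L, s ≤ t → ∀ k,
      f (k * x) ≤ f x + dist (y₂ s * k * (y₂ s)⁻¹) (y₂ t * (y₂ s)⁻¹) - (t - s)) :
    EqOn y₁ y₂ (Icc 0 L) := by
  have hcont : ∀ y : ℝ → G, (∀ s ∈ Icc 0 L, ∀ t ∈ Icc 0 L, dist (y s) (y t) = |s - t|) →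
      ContinuousOn y (Icc 0 L) := fun y hy =>
    (LipschitzOnWith.of_dist_le_mul (K := 1) fun s hs t ht => by
      rw [hy s hs t ht, NNReal.coe_one, one_mul, Real.dist_eq]).continuousOn
  have hD : ContinuousOn (fun s => dist (y₁ s) (y₂ s)) (Icc 0 L) :=
    fun s hs => (hcont y₁ hy₁ s hs).dist (hcont y₂ hy₂ s hs)
  have hclosed : IsClosed ({s | dist (y₁ s) (y₂ s) = 0} ∩ Icc 0 L) := by
    have := hD.preimage_isClosed_of_isClosed isClosed_Icc (isClosed_singleton (x := (0 : ℝ)))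
    rwa [inter_comm] at this
  suffices Icc 0 L ⊆ {s | dist (y₁ s) (y₂ s) = 0} from fun s hs => dist_eq_zero.1 (this hs)
  -- Continuation: the coincidence set is closed and contains `0`, so it is enough to extend it a
  -- little to the right of each of its points.
  refine hclosed.Icc_subset_of_forall_mem_nhdsWithin (by simp [h0]) ?_
  rintro s₀ ⟨hs₀, hs₀L⟩
  obtain ⟨C₁, hC₁, h₁⟩ := h.exists_dist_conj_le
  obtain ⟨C₂, hC₂, h₂⟩ := h.exists_norm_adjoint_sub_le
  obtain ⟨r₁, hr₁, h₁⟩ := Metric.eventually_nhds_iff.1 h₁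
  obtain ⟨r₂, hr₂, h₂⟩ := Metric.eventually_nhds_iff.1 h₂
  set p := y₁ s₀ with hp
  have hp2 : p = y₂ s₀ := dist_eq_zero.1 hs₀
  -- The Grönwall constant: `C₁` accounts for the distortion by conjugation, the other term is a
  -- Lipschitz constant of the velocity near `p`, with the inner factor bounding `Ad (y₁ s)⁻¹`.
  set K := C₁ + ‖ℓ‖ * (‖adjoint ψ σ p⁻¹‖ * (C₂ * r₂ + 1)) * C₂ with hK
  set δ := min (min r₁ r₂ / 2) (L - s₀) with hδ
  have hδ0 : 0 < δ := lt_min (half_pos (lt_min hr₁ hr₂)) (sub_pos.2 hs₀L.2)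
  have hδL : s₀ + δ ≤ L := by linarith [min_le_right (min r₁ r₂ / 2) (L - s₀)]
  have hδ' : 2 * δ ≤ min r₁ r₂ := by linarith [min_le_left (min r₁ r₂ / 2) (L - s₀)]
  have hsub : Icc s₀ (s₀ + δ) ⊆ Icc 0 L := Icc_subset_Icc hs₀L.1 hδL
  have hvel : ∀ y : ℝ → G, (∀ s ∈ Icc 0 L, ∀ t ∈ Icc 0 L, dist (y s) (y t) = |s - t|) →
      (∀ s ∈ Icc 0 L, ∀ t ∈ Icc 0 L, s ≤ t → ∀ k,
        f (k * x) ≤ f x + dist (y s * k * (y s)⁻¹) (y t * (y s)⁻¹) - (t - s)) →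
      ∀ s ∈ Ico s₀ (s₀ + δ), Tendsto (fun ε => ε⁻¹ • ψ (y (s + ε) * (y s)⁻¹)) (𝓝[>] 0)
        (𝓝 (velocity ψ σ ℓ (y s))) := by
    intro y hy hfy s hs
    have hsI : s ∈ Icc 0 L := hsub ⟨hs.1, hs.2.le⟩
    have hev : ∀ᶠ ε : ℝ in 𝓝[>] 0, 0 < ε ∧ s + ε ∈ Icc 0 L := by
      filter_upwards [Ioc_mem_nhdsGT (sub_pos.2 hs.2)] with ε hε
      exact ⟨hε.1, hsI.1.trans (by linarith [hε.1]), by linarith [hε.2]⟩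
    refine h.tendsto_velocity hℓ (hev.mono fun ε hε => ?_) (hev.mono fun ε hε k => ?_)
    · rw [← dist_eq_dist_mul_inv_one, hy _ hε.2 _ hsI, add_sub_cancel_left, abs_of_pos hε.1]
    · have := hfy s hsI _ hε.2 (by linarith [hε.1]) k
      rwa [add_sub_cancel_left] at this
  have hgr := le_gronwallBound_of_liminf_deriv_right_le (f := fun s => dist (y₁ s) (y₂ s))
    (f' := fun s => K * dist (y₁ s) (y₂ s)) (δ := 0) (K := K) (ε := 0) (a := s₀) (b := s₀ + δ)
    (hD.mono hsub) ?_ hs₀.le (fun s _ => by simp)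
  · filter_upwards [Icc_mem_nhdsGT (lt_add_of_pos_right s₀ hδ0)] with s hs
    have := hgr s hs
    rw [gronwallBound_ε0_δ0] at this
    exact le_antisymm this dist_nonneg
  intro s hs r hr
  have hsI : s ∈ Icc 0 L := hsub ⟨hs.1, hs.2.le⟩
  have hs₀I : s₀ ∈ Icc 0 L := ⟨hs₀L.1, hs₀L.2.le⟩
  have hd1 : dist p (y₁ s) < δ := by
    rw [hp, hy₁ _ hs₀I _ hsI, abs_sub_comm, abs_of_nonneg (by linarith [hs.1])]
    linarith [hs.2]
  have hd2 : dist p (y₂ s) < δ := by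
    rw [hp2, hy₂ _ hs₀I _ hsI, abs_sub_comm, abs_of_nonneg (by linarith [hs.1])]
    linarith [hs.2]
  have hd3 : dist (y₁ s) (y₂ s) < 2 * δ := by
    linarith [dist_triangle (y₁ s) p (y₂ s), dist_comm (y₁ s) p]
  set z := y₁ s * (y₂ s)⁻¹ with hz
  have hz1 : dist z 1 = dist (y₁ s) (y₂ s) := (dist_eq_dist_mul_inv_one _ _).symm
  have hr1 : 2 * δ ≤ r₁ := hδ'.trans (min_le_left _ _)
  have hr2 : 2 * δ ≤ r₂ := hδ'.trans (min_le_right _ _)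
  have hvd : ‖velocity ψ σ ℓ (y₁ s) - velocity ψ σ ℓ (y₂ s)‖
      ≤ ‖ℓ‖ * (‖adjoint ψ σ p⁻¹‖ * (C₂ * r₂ + 1)) * C₂ * dist (y₁ s) (y₂ s) := by
    have e1 : adjoint ψ σ (y₂ s)⁻¹ = (adjoint ψ σ (y₁ s)⁻¹).comp (adjoint ψ σ z) := by
      rw [← h.adjoint_mul]
      congr 1
      rw [hz]; group
    have e2 : adjoint ψ σ (y₁ s)⁻¹ = (adjoint ψ σ p⁻¹).comp (adjoint ψ σ (p * (y₁ s)⁻¹)) := by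
      rw [← h.adjoint_mul]
      congr 1
      group
    have e3 : ‖adjoint ψ σ (p * (y₁ s)⁻¹)‖ ≤ C₂ * r₂ + 1 := by
      have hlt : dist (p * (y₁ s)⁻¹) 1 < r₂ := by
        rw [← dist_eq_dist_mul_inv_one]; linarith
      have h3 := h₂ hlt
      calc ‖adjoint ψ σ (p * (y₁ s)⁻¹)‖
          = ‖(adjoint ψ σ (p * (y₁ s)⁻¹) - .id ℝ F) + .id ℝ F‖ := by rw [sub_add_cancel]
        _ ≤ C₂ * r₂ + 1 := by
            refine (norm_add_le _ _).trans (add_le_add (h3.trans ?_) ContinuousLinearMap.norm_id_le)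
            gcongr
    have e4 : ‖adjoint ψ σ z - .id ℝ F‖ ≤ C₂ * dist (y₁ s) (y₂ s) := by
      rw [← hz1]
      exact h₂ (by rw [hz1]; linarith)
    have e5 : adjoint ψ σ (y₂ s)⁻¹ - adjoint ψ σ (y₁ s)⁻¹
        = (adjoint ψ σ (y₁ s)⁻¹).comp (adjoint ψ σ z - .id ℝ F) := by
      rw [e1, ContinuousLinearMap.comp_sub, ContinuousLinearMap.comp_id]
    rw [norm_velocity_sub_velocity, e5]
    calc _ ≤ ‖ℓ‖ * (‖adjoint ψ σ (y₁ s)⁻¹‖ * ‖adjoint ψ σ z - .id ℝ F‖) :=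
          (ContinuousLinearMap.opNorm_comp_le _ _).trans
            (by gcongr; exact ContinuousLinearMap.opNorm_comp_le _ _)
      _ ≤ ‖ℓ‖ * ((‖adjoint ψ σ p⁻¹‖ * (C₂ * r₂ + 1)) * (C₂ * dist (y₁ s) (y₂ s))) := by
          gcongr
          rw [e2]
          exact (ContinuousLinearMap.opNorm_comp_le _ _).trans (by gcongr)
      _ = _ := by ring
  have t1 := hvel y₁ hy₁ hf₁ s hs
  have t2 := hvel y₂ hy₂ hf₂ s hs
  have hpos : ∀ᶠ ε : ℝ in 𝓝[>] 0, 0 < ε := self_mem_nhdsWithin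
  have hev : ∀ᶠ ε : ℝ in 𝓝[>] 0, 0 < ε ∧ ε < r₁ ∧ s + ε ∈ Icc 0 L := by
    filter_upwards [Ioc_mem_nhdsGT (sub_pos.2 hs.2), Ioo_mem_nhdsGT hr₁] with ε hε hε'
    exact ⟨hε.1, hε'.2, hsI.1.trans (by linarith [hε.1]), by linarith [hε.2]⟩
  have hq : ∀ y : ℝ → G, (∀ s ∈ Icc 0 L, ∀ t ∈ Icc 0 L, dist (y s) (y t) = |s - t|) →
      ∀ᶠ ε : ℝ in 𝓝[>] 0, dist (y (s + ε) * (y s)⁻¹) 1 = ε := fun y hy =>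
    hev.mono fun ε hε => by
      rw [← dist_eq_dist_mul_inv_one, hy _ hε.2.2 _ hsI, add_sub_cancel_left, abs_of_pos hε.1]
  have hid : Tendsto (fun ε : ℝ => ε) (𝓝[>] 0) (𝓝 0) := tendsto_id.mono_left nhdsWithin_le_nhds
  have hqt : ∀ y : ℝ → G, (∀ s ∈ Icc 0 L, ∀ t ∈ Icc 0 L, dist (y s) (y t) = |s - t|) →
      Tendsto (fun ε => y (s + ε) * (y s)⁻¹) (𝓝[>] 0) (𝓝 1) := fun y hy => by
    rw [tendsto_iff_dist_tendsto_zero]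
    exact hid.congr' ((hq y hy).mono fun ε hε => hε.symm)
  have hqO : ∀ y : ℝ → G, (∀ s ∈ Icc 0 L, ∀ t ∈ Icc 0 L, dist (y s) (y t) = |s - t|) →
      (fun ε => ψ (y (s + ε) * (y s)⁻¹)) =O[𝓝[>] 0] fun ε => ε := fun y hy => by
    refine .of_bound 2 ?_
    filter_upwards [(hqt y hy).eventually h.norm_le, hq y hy, hpos] with ε h1 h2 h3
    rw [h2] at h1
    rwa [Real.norm_of_nonneg h3.le]
  have hpair : Tendsto (fun ε : ℝ => (ψ (y₁ (s + ε) * (y₁ s)⁻¹), ψ (y₂ (s + ε) * (y₂ s)⁻¹)))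
      (𝓝[>] 0) (𝓝 0) :=
    (h.tendsto.comp (hqt y₁ hy₁)).prodMk_nhds (h.tendsto.comp (hqt y₂ hy₂))
  have d3 := ((h.dist_symm_isLittleO.comp_tendsto hpair).trans_isBigO
    ((hqO y₁ hy₁).prod_left (hqO y₂ hy₂))).tendsto_div_nhds_zero
  have d4 := (d3.add (t1.sub t2).norm).const_add (C₁ * dist (y₁ s) (y₂ s))
  have hlim : C₁ * dist (y₁ s) (y₂ s) +
      (0 + ‖velocity ψ σ ℓ (y₁ s) - velocity ψ σ ℓ (y₂ s)‖) < r := by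
    refine lt_of_le_of_lt ?_ hr
    rw [hK, add_mul, zero_add]
    gcongr
  have hfin : ∀ᶠ ε : ℝ in 𝓝[>] 0,
      ε⁻¹ * (dist (y₁ (s + ε)) (y₂ (s + ε)) - dist (y₁ s) (y₂ s)) < r := by
    filter_upwards [d4.eventually (Iio_mem_nhds hlim), hev, hq y₁ hy₁,
      (hqt y₁ hy₁).eventually h.left_inv, (hqt y₂ hy₂).eventually h.left_inv]
      with ε h3 h4 h5 h6 h7
    refine lt_of_le_of_lt ?_ h3
    simp only [comp_apply, h6, h7]
    set q₁ := y₁ (s + ε) * (y₁ s)⁻¹ with hq₁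
    set q₂ := y₂ (s + ε) * (y₂ s)⁻¹ with hq₂
    have e1 : dist (q₁ * z * q₁⁻¹) z ≤ C₁ * dist q₁ 1 * dist z 1 := by
      refine @h₁ (q₁, z) ?_
      rw [Prod.dist_eq]
      refine max_lt ?_ ?_
      · change dist q₁ 1 < r₁
        rw [h5]; exact h4.2.1
      · change dist z 1 < r₁
        rw [hz1]; linarith
    -- Insert `q₁ * y₂ s`: applying the same increment `q₁` to both curves conjugates their quotient
    -- `z`, and the change from `q₁` to `q₂` is the difference of velocities to first order.
    have e2 : dist (y₁ (s + ε)) (y₂ (s + ε)) ≤ dist (q₁ * z * q₁⁻¹) 1 + dist q₁ q₂ := by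
      have e3 : y₁ (s + ε) = q₁ * y₁ s := by rw [hq₁]; group
      have e4 : y₂ (s + ε) = q₂ * y₂ s := by rw [hq₂]; group
      rw [e3, e4]
      refine (dist_triangle _ (q₁ * y₂ s) _).trans (add_le_add (le_of_eq ?_) (le_of_eq ?_))
      · rw [dist_eq_dist_mul_inv_one (q₁ * y₁ s), hz]
        congr 1
        group
      · exact dist_mul_right _ _ _
    have e3 := dist_triangle (q₁ * z * q₁⁻¹) z 1
    rw [h5, hz1] at e1
    rw [hz1] at e3
    have hrw : ‖ε⁻¹ • ψ q₁ - ε⁻¹ • ψ q₂‖ = ‖ψ q₁ - ψ q₂‖ / ε := by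
      rw [← smul_sub, norm_smul, norm_inv, Real.norm_of_nonneg h4.1.le, div_eq_inv_mul]
    rw [hrw, ← add_div, sub_add_cancel, ← div_eq_inv_mul, div_le_iff₀ h4.1, add_mul,
      div_mul_cancel₀ _ h4.1.ne']
    linarith
  have hmap : Tendsto (fun ε => s + ε) (𝓝[>] (0 : ℝ)) (𝓝[>] s) := by
    refine tendsto_nhdsWithin_iff.2 ⟨?_, hpos.mono fun ε hε => lt_add_of_pos_right s hε⟩
    simpa using hid.const_add s
  refine hmap.frequently (Eventually.frequently ?_)
  filter_upwards [hfin] with ε hε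
  rwa [add_sub_cancel_left]

end IsLogChart

end

/-! ### Almost everywhere uniqueness of nearest points. -/

section

open MeasureTheory Set Filter Topology Function Asymptotics TameChains

namespace IsLogChart

variable {F G : Type*} [NormedAddCommGroup F] [InnerProductSpace ℝ F] [FiniteDimensional ℝ F]
  [Group G] [MetricSpace G] [IsIsometricSMul Gᵐᵒᵖ G] [IsTopologicalGroup G] [ProperSpace G]
  {ψ : G → F} {σ : F → G}

variable (h : IsLogChart ψ σ)
  (hgeo : ∀ x y : G, ∃ γ : ℝ → G, γ 0 = x ∧ γ (dist x y) = y ∧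
      ∀ s ∈ Icc 0 (dist x y), ∀ t ∈ Icc 0 (dist x y), dist (γ s) (γ t) = |s - t|)
include h hgeo

/-- Where the distance function to a closed set is differentiable, the nearest point is unique. -/
theorem exists_isUniqueNearest {A : Set G} (hA : IsClosed A) (hne : A.Nonempty) {x : G}
    (hd : DifferentiableAt ℝ (fun u => Metric.infDist (σ u * x) A) 0) :
    ∃ y, IsUniqueNearest (fun a b : G => edist a b) A x y := by
  obtain ⟨y, hy, hxy⟩ := hA.exists_infDist_eq_dist hne x
  set L := Metric.infDist x A with hL
  -- A competing route from `k * x` to `a`: follow the right translate of `w` by `k * x` up to time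
  -- `s`, of length `s`; jump to `γ t`; follow `γ` to `a`, of length `L - t`. The jump, after right
  -- translation, is the distance in the inequality.
  have key : ∀ a ∈ A, L = dist x a → ∃ w : ℝ → G, w 0 = 1 ∧ w L = a * x⁻¹ ∧
      (∀ s ∈ Icc 0 L, ∀ t ∈ Icc 0 L, dist (w s) (w t) = |s - t|) ∧
      ∀ s ∈ Icc 0 L, ∀ t ∈ Icc 0 L, s ≤ t → ∀ k, Metric.infDist (k * x) A
        ≤ Metric.infDist x A + dist (w s * k * (w s)⁻¹) (w t * (w s)⁻¹) - (t - s) := by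
    intro a ha hLa
    obtain ⟨γ, h0, h1, h2⟩ := hgeo x a
    rw [← hLa] at h1 h2
    have hLI : L ∈ Icc 0 L := right_mem_Icc.2 Metric.infDist_nonneg
    have h0I : (0 : ℝ) ∈ Icc 0 L := left_mem_Icc.2 Metric.infDist_nonneg
    refine ⟨fun s => γ s * x⁻¹, by simp [h0], by simp [h1], fun s hs t ht => ?_,
      fun s hs t ht hst k => ?_⟩
    · rw [dist_mul_right, h2 s hs t ht]
    · refine (Metric.infDist_le_dist_of_mem ha).trans ?_
      have e1 : dist (k * x) (γ s * x⁻¹ * k * x) = s := by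
        have : dist (k * x) (γ s * x⁻¹ * k * x) = dist (γ 0) (γ s) := by
          rw [h0, dist_eq_dist_mul_inv_one (k * x), dist_eq_dist_mul_inv_one x]
          congr 1
          group
        rw [this, h2 0 h0I s hs, zero_sub, abs_neg, abs_of_nonneg hs.1]
      have e2 : dist (γ s * x⁻¹ * k * x) (γ t)
          = dist (γ s * x⁻¹ * k * (γ s * x⁻¹)⁻¹) (γ t * x⁻¹ * (γ s * x⁻¹)⁻¹) := by
        rw [dist_mul_right, ← dist_mul_right _ (γ t * x⁻¹) x, inv_mul_cancel_right]
      have e3 : dist (γ t) a = L - t := by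
        rw [← h1, h2 t ht L hLI, abs_sub_comm, abs_of_nonneg (by linarith [ht.2])]
      have := dist_triangle4 (k * x) (γ s * x⁻¹ * k * x) (γ t) a
      rw [e1, e2, e3] at this
      linarith
  obtain ⟨w, hw0, hwL, hw, hwf⟩ := key y hy hxy
  refine ⟨y, hy, fun z hz hzy => ?_⟩
  have hle : L ≤ dist x z := Metric.infDist_le_dist_of_mem hz
  rcases hle.lt_or_eq with hlt | heq
  · change edist x y < edist x z
    rw [edist_dist, edist_dist, ← hxy]
    exact (ENNReal.ofReal_lt_ofReal_iff_of_nonneg Metric.infDist_nonneg).2 hlt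
  · obtain ⟨w', hw'0, hw'L, hw', hwf'⟩ := key z hz heq
    have := h.eqOn_of_minimizing (f := fun z => Metric.infDist z A) hd.hasFDerivAt (hw'0.trans hw0.symm) hw' hw hwf' hwf
      (right_mem_Icc.2 Metric.infDist_nonneg)
    rw [hw'L, hwL] at this
    exact absurd (mul_right_cancel this) hzy

/-- Rademacher in the chart shows that for every `p` almost all `v` in a small ball have `σ v * p`
outside the bad set `N`. Tonelli exchanges the quantifiers, and by left invariance each slice has
measure `lam N`, which must vanish because the ball has positive volume. -/
theorem ae_exists_isUniqueNearest [MeasurableSpace G] [BorelSpace G] [SecondCountableTopology G]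
    (lam : Measure G) [SFinite lam] [lam.IsMulLeftInvariant] {A : Set G} (hA : IsClosed A)
    (hne : A.Nonempty)
    (hm : MeasurableSet {x : G | ∃ y, IsUniqueNearest (fun a b : G => edist a b) A x y}) :
    ∀ᵐ x ∂lam, ∃ y, IsUniqueNearest (fun a b : G => edist a b) A x y := by
  let : MeasurableSpace F := borel F
  have : BorelSpace F := ⟨rfl⟩
  obtain ⟨C, hC, hlip⟩ := h.exists_dist_symm_le
  have hcomp : ∀ᶠ v in 𝓝 (0 : F), ∀ᶠ z in 𝓝 (σ v), σ (ψ z) = z :=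
    h.tendsto_symm.eventually (eventually_eventually_nhds.2 h.left_inv)
  obtain ⟨ρ₁, hρ₁, hlip⟩ := Metric.eventually_nhds_iff.1 hlip
  obtain ⟨ρ₂, hρ₂, hev⟩ := Metric.eventually_nhds_iff.1 (hcomp.and (h.mul.and h.right_inv))
  set ρ := min ρ₁ ρ₂ with hρ
  have hρ0 : 0 < ρ := lt_min hρ₁ hρ₂
  set B := Metric.ball (0 : F) ρ with hB
  have hlipB : ∀ v ∈ B, ∀ v' ∈ B, dist (σ v) (σ v') ≤ C * ‖v - v'‖ := by
    intro v hv v' hv'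
    refine @hlip (v, v') ?_
    rw [Prod.dist_eq]
    exact max_lt (lt_of_lt_of_le hv (min_le_left _ _)) (lt_of_lt_of_le hv' (min_le_left _ _))
  have hcont : ContinuousOn σ B :=
    (LipschitzOnWith.of_dist_le_mul (K := C.toNNReal) fun v hv v' hv' => by
      rw [Real.coe_toNNReal _ hC.le, dist_eq_norm]; exact hlipB v hv v' hv').continuousOn
  set N := {x : G | ∃ y, IsUniqueNearest (fun a b : G => edist a b) A x y}ᶜ with hN
  have hNm : MeasurableSet N := hm.compl
  have hpt : ∀ p : G, ∀ᵐ v ∂(volume : Measure F).restrict B, σ v * p ∉ N := by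
    intro p
    have hL : LipschitzOnWith C.toNNReal (fun v => Metric.infDist (σ v * p) A) B := by
      refine LipschitzOnWith.of_dist_le_mul fun v hv v' hv' => ?_
      rw [Real.coe_toNNReal _ hC.le, dist_eq_norm v]
      refine le_trans ?_ (hlipB v hv v' hv')
      rw [← dist_mul_right (σ v) (σ v') p]
      simpa using (Metric.lipschitz_infDist_pt A).dist_le_mul (σ v * p) (σ v' * p)
    filter_upwards [hL.ae_differentiableWithinAt (μ := volume) measurableSet_ball,
      ae_restrict_mem measurableSet_ball] with v hv hvB
    obtain ⟨h1, h2, h3⟩ := @hev v (lt_of_lt_of_le hvB (min_le_right _ _))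
    have hd := hv.differentiableAt (Metric.isOpen_ball.mem_nhds hvB)
    rw [hN, mem_compl_iff, not_not]
    refine h.exists_isUniqueNearest hgeo hA hne ?_
    have h0 : ψ (σ 0 * σ v) = v := by rw [h.symm_zero, one_mul, h3]
    -- Rademacher gives differentiability at `v`, whereas uniqueness asks for it at `0` in the chart
    -- moved to `σ v * p`; the differentiable map `u ↦ ψ (σ u * σ v)` connects the two.
    have hcd : DifferentiableAt ℝ ((fun v => Metric.infDist (σ v * p) A) ∘
        fun u => ψ (σ u * σ v)) 0 := by
      refine DifferentiableAt.comp 0 ?_ h2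
      rwa [h0]
    refine hcd.congr_of_eventuallyEq ?_
    have ht : Tendsto (fun u => σ u * σ v) (𝓝 0) (𝓝 (σ v)) := by
      simpa using h.tendsto_symm.mul_const (σ v)
    filter_upwards [ht.eventually h1] with u hu
    rw [comp_apply, hu, mul_assoc]
  classical
  -- `σ` is known to be continuous only on `B`; the value `1` elsewhere gives a globally Borel map.
  set τ : F → G := B.piecewise σ fun _ => 1 with hτ
  have hτm : Measurable τ :=
    hcont.measurable_piecewise continuousOn_const measurableSet_ball
  have hT : MeasurableSet {q : F × G | τ q.1 * q.2 ∈ N} :=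
    ((hτm.comp measurable_fst).mul measurable_snd) hNm
  have hz1 : ((volume : Measure F).restrict B).prod lam {q : F × G | τ q.1 * q.2 ∈ N} = 0 := by
    rw [Measure.prod_apply_symm hT]
    refine lintegral_eq_zero_of_ae_eq_zero (Eventually.of_forall fun p => ?_)
    change ((volume : Measure F).restrict B) {v | τ v * p ∈ N} = 0
    have : ∀ᵐ v ∂(volume : Measure F).restrict B, ¬ τ v * p ∈ N := by
      filter_upwards [hpt p, ae_restrict_mem measurableSet_ball] with v hv hvB
      rwa [hτ, piecewise_eq_of_mem _ _ _ hvB]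
    simpa [ae_iff] using this
  rw [Measure.prod_apply hT] at hz1
  have hconst : ∀ v, lam (Prod.mk v ⁻¹' {q : F × G | τ q.1 * q.2 ∈ N}) = lam N := fun v =>
    measure_preimage_mul lam (τ v) N
  simp only [hconst, lintegral_const, Measure.restrict_apply_univ, mul_eq_zero] at hz1
  have hB0 : volume B ≠ 0 := (Metric.measure_ball_pos volume 0 hρ0).ne'
  exact hz1.resolve_right hB0

end IsLogChart

end

section

open MeasureTheory Set Filter Topology Function Manifold Bundle TameChains
open scoped ENNReal NNReal ContDiff

/-! ### Right invariance of the Riemannian distance. -/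

section RightInvariance

variable {E : Type*} [NormedAddCommGroup E] [NormedSpace ℝ E]
  {G : Type*} [Group G] [TopologicalSpace G] [ChartedSpace E G] [LieGroup 𝓘(ℝ, E) ∞ G]
  (g : ContMDiffRiemannianMetric 𝓘(ℝ, E) ∞ E (fun x : G => TangentSpace 𝓘(ℝ, E) x))

theorem enorm_mfderiv_mul_right (hg : IsRightInvariantMetric g) (a x : G)
    (v : TangentSpace 𝓘(ℝ, E) x) :
    letI : RiemannianBundle (fun x : G => TangentSpace 𝓘(ℝ, E) x) := ⟨g.toRiemannianMetric⟩
    ‖mfderiv 𝓘(ℝ, E) 𝓘(ℝ, E) (fun y : G => y * a) x v‖ₑ = ‖v‖ₑ := by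
  let : RiemannianBundle (fun x : G => TangentSpace 𝓘(ℝ, E) x) := ⟨g.toRiemannianMetric⟩
  rw [← ofReal_norm, ← ofReal_norm, norm_eq_sqrt_real_inner, norm_eq_sqrt_real_inner]
  congr 2
  exact hg a x v v

theorem riemDist_mul_right_le (hg : IsRightInvariantMetric g) (a x y : G) :
    riemDist g (x * a) (y * a) ≤ riemDist g x y := by
  let : RiemannianBundle (fun x : G => TangentSpace 𝓘(ℝ, E) x) := ⟨g.toRiemannianMetric⟩
  refine le_of_forall_gt fun r hr => ?_
  obtain ⟨γ, h0, h1, hγ, hlt, -⟩ := exists_lt_locally_constant_of_riemannianEDist_lt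
    (I := 𝓘(ℝ, E)) (x := x) (y := y) hr zero_lt_one
  have hmul : ContMDiff 𝓘(ℝ, E) 𝓘(ℝ, E) 1 (fun z : G => z * a) :=
    (contMDiff_mul_right (I := 𝓘(ℝ, E)) (n := ∞) (a := a)).of_le (by exact_mod_cast le_top)
  have hc : ContMDiff 𝓘(ℝ, ℝ) 𝓘(ℝ, E) 1 (fun t => γ t * a) := hmul.comp hγ
  refine lt_of_le_of_lt (riemannianEDist_le_pathELength hc.contMDiffOn (by rw [h0]) (by rw [h1])
    zero_le_one) (lt_of_eq_of_lt ?_ hlt)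
  rw [pathELength_eq_lintegral_mfderiv_Icc, pathELength_eq_lintegral_mfderiv_Icc]
  refine lintegral_congr fun t => ?_
  have hcomp : mfderiv 𝓘(ℝ, ℝ) 𝓘(ℝ, E) (fun t => γ t * a) t
      = (mfderiv 𝓘(ℝ, E) 𝓘(ℝ, E) (fun z : G => z * a) (γ t)).comp (mfderiv 𝓘(ℝ, ℝ) 𝓘(ℝ, E) γ t) :=
    mfderiv_comp t (hmul.mdifferentiable one_ne_zero _) (hγ.mdifferentiable one_ne_zero _)
  rw [hcomp]
  exact enorm_mfderiv_mul_right g hg a (γ t) _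

theorem riemDist_mul_right (hg : IsRightInvariantMetric g) (a x y : G) :
    riemDist g (x * a) (y * a) = riemDist g x y := by
  refine (riemDist_mul_right_le g hg a x y).antisymm ?_
  simpa using riemDist_mul_right_le g hg a⁻¹ (x * a) (y * a)

end RightInvariance

end

/-! ### Comparison of the Riemannian distance with a norm in a chart. -/

section

open MeasureTheory Set Filter Topology Function Manifold Bundle TameChains
open scoped ENNReal NNReal ContDiff

theorem enorm_le_of_norm_le {A B : Type*} [SeminormedAddGroup A] [SeminormedAddGroup B] {a : A}
    {b : B} {r : ℝ≥0} (h : ‖a‖ ≤ r * ‖b‖) : ‖a‖ₑ ≤ r * ‖b‖ₑ := by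
  simp only [enorm]
  exact_mod_cast h

section LocalComparison

variable {E : Type*} [NormedAddCommGroup E] [NormedSpace ℝ E]
  {M : Type*} [TopologicalSpace M] [ChartedSpace E M] [IsManifold 𝓘(ℝ, E) 1 M]
  [RiemannianBundle (fun x : M => TangentSpace 𝓘(ℝ, E) x)]
  [IsContinuousRiemannianBundle E (fun x : M => TangentSpace 𝓘(ℝ, E) x)]
  {F : Type*} [NormedAddCommGroup F] [NormedSpace ℝ F]

/-- The linear map `T` carries the Riemannian norm at `x`, read in the preferred chart at `x`, to
the norm of the target. -/
def IsChartIsometry (x : M) (T : E →L[ℝ] F) : Prop :=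
  ∀ w : E, ‖T w‖ = ‖(trivializationAt E (TangentSpace 𝓘(ℝ, E)) x).symmL ℝ x w‖

variable {x : M} {T : E →L[ℝ] F}

theorem IsChartIsometry.eventually_norm_mfderiv_le (hT : IsChartIsometry x T) {r : ℝ} (hr : 1 < r) :
    ∀ᶠ y in 𝓝 x, ∀ v : TangentSpace 𝓘(ℝ, E) y,
      ‖T (mfderiv 𝓘(ℝ, E) 𝓘(ℝ, E) (extChartAt 𝓘(ℝ, E) x) y v)‖ ≤ r * ‖v‖ := by
  filter_upwards [eventually_norm_symmL_trivializationAt_self_comp_lt E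
    (fun y : M => TangentSpace 𝓘(ℝ, E) y) x hr, chart_source_mem_nhds E x] with y hy hy' v
  have h1 := (ContinuousLinearMap.le_opNorm ((trivializationAt E
    (fun y : M => TangentSpace 𝓘(ℝ, E) y) x).symmL ℝ x ∘L
    (trivializationAt E (fun y : M => TangentSpace 𝓘(ℝ, E) y) x).continuousLinearMapAt ℝ y) v).trans
    (mul_le_mul_of_nonneg_right hy.le (norm_nonneg _))
  have h2 := TangentBundle.continuousLinearMapAt_trivializationAt (𝕜 := ℝ) (I := 𝓘(ℝ, E)) hy'
  rw [← h2]
  exact (hT _).trans_le h1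

theorem IsChartIsometry.eventually_norm_mfderivWithin_symm_le (hT : IsChartIsometry x T) {r : ℝ}
    (hr : 1 < r) :
    ∀ᶠ e in 𝓝 (extChartAt 𝓘(ℝ, E) x x), ∀ w : E,
      ‖(mfderivWithin 𝓘(ℝ, E) 𝓘(ℝ, E) (extChartAt 𝓘(ℝ, E) x).symm (range 𝓘(ℝ, E)) e w :
        TangentSpace 𝓘(ℝ, E) ((extChartAt 𝓘(ℝ, E) x).symm e))‖ ≤ r * ‖T w‖ := by
  have key : ∀ᶠ y in 𝓝 x, ∀ w : E,
      ‖(trivializationAt E (fun y : M => TangentSpace 𝓘(ℝ, E) y) x).symmL ℝ y w‖ ≤ r * ‖T w‖ := by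
    filter_upwards [eventually_norm_symmL_trivializationAt_comp_self_lt E
      (fun y : M => TangentSpace 𝓘(ℝ, E) y) x hr] with y hy w
    have h1 := (ContinuousLinearMap.le_opNorm ((trivializationAt E
      (fun y : M => TangentSpace 𝓘(ℝ, E) y) x).symmL ℝ y ∘L
      (trivializationAt E (fun y : M => TangentSpace 𝓘(ℝ, E) y) x).continuousLinearMapAt ℝ x)
      ((trivializationAt E (fun y : M => TangentSpace 𝓘(ℝ, E) y) x).symmL ℝ x w)).trans
      (mul_le_mul_of_nonneg_right hy.le (norm_nonneg _))
    rw [ContinuousLinearMap.comp_apply, Trivialization.continuousLinearMapAt_symmL _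
      (FiberBundle.mem_baseSet_trivializationAt' x)] at h1
    rw [hT w]
    exact h1
  have hx : 𝓝 x = 𝓝 ((extChartAt 𝓘(ℝ, E) x).symm (extChartAt 𝓘(ℝ, E) x x)) := by simp
  have hc : ContinuousAt (extChartAt 𝓘(ℝ, E) x).symm (extChartAt 𝓘(ℝ, E) x x) :=
    continuousAt_extChartAt_symm _
  rw [hx] at key
  filter_upwards [hc.eventually key, extChartAt_target_mem_nhds (I := 𝓘(ℝ, E)) x] with e he het w
  have hes : (extChartAt 𝓘(ℝ, E) x).symm e ∈ (chartAt E x).source := by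
    have := (extChartAt 𝓘(ℝ, E) x).map_target het
    rwa [extChartAt_source] at this
  have h2 := TangentBundle.symmL_trivializationAt (𝕜 := ℝ) (I := 𝓘(ℝ, E)) hes
  have h3 := he w
  rw [h2, (extChartAt 𝓘(ℝ, E) x).right_inv het] at h3
  exact h3

theorem lintegral_enorm_fderiv_lineMap (a b : E) (T : E →L[ℝ] F) :
    ∫⁻ t in Icc (0 : ℝ) 1,
      ‖T (fderivWithin ℝ (ContinuousAffineMap.lineMap (R := ℝ) a b) (Icc 0 1) t 1)‖ₑ
      = ‖T (b - a)‖ₑ := by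
  have : ‖T (b - a)‖ₑ = ∫⁻ _ in Icc (0 : ℝ) 1, ‖T (b - a)‖ₑ := by simp
  rw [this]
  refine setLIntegral_congr_fun measurableSet_Icc fun z hz => ?_
  have h1 : fderivWithin ℝ (ContinuousAffineMap.lineMap (R := ℝ) a b) (Icc 0 1) z 1 = b - a := by
    rw [fderivWithin_eq_fderiv (uniqueDiffOn_Icc zero_lt_one _ hz)
      (ContinuousAffineMap.differentiableAt _)]
    simp
  simp only [h1]

/-- The straight segment in the chart is a competing path; by continuity of the metric its length
near `x` is at most `r` times its length for the norm at `x`. -/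
theorem IsChartIsometry.eventually_riemannianEDist_le (hT : IsChartIsometry x T) {r : ℝ≥0}
    (hr : 1 < r) :
    ∀ᶠ y in 𝓝 x, riemannianEDist 𝓘(ℝ, E) x y
      ≤ r * ‖T (extChartAt 𝓘(ℝ, E) x y - extChartAt 𝓘(ℝ, E) x x)‖ₑ := by
  have htar : ∀ᶠ e in 𝓝 (extChartAt 𝓘(ℝ, E) x x), e ∈ (extChartAt 𝓘(ℝ, E) x).target :=
    extChartAt_target_mem_nhds x
  obtain ⟨ρ, hρ, hball⟩ := Metric.eventually_nhds_iff_ball.1 (htar.and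
      (hT.eventually_norm_mfderivWithin_symm_le (r := r) (by exact_mod_cast hr)))
  have hA : ∀ᶠ y in 𝓝 x, extChartAt 𝓘(ℝ, E) x y ∈ Metric.ball (extChartAt 𝓘(ℝ, E) x x) ρ :=
    (continuousAt_extChartAt x).preimage_mem_nhds (Metric.ball_mem_nhds _ hρ)
  filter_upwards [hA, extChartAt_source_mem_nhds (I := 𝓘(ℝ, E)) x] with y hy hys
  let η := ContinuousAffineMap.lineMap (R := ℝ) (extChartAt 𝓘(ℝ, E) x x) (extChartAt 𝓘(ℝ, E) x y)
  let γ : ℝ → M := fun t => (extChartAt 𝓘(ℝ, E) x).symm (η t)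
  have hη : ∀ t ∈ Icc (0 : ℝ) 1, η t ∈ Metric.ball (extChartAt 𝓘(ℝ, E) x x) ρ := by
    intro t ht
    refine (convex_ball _ _).segment_subset (Metric.mem_ball_self hρ) hy ?_
    rw [segment_eq_image_lineMap]
    exact ⟨t, ht, by simp [η, ContinuousAffineMap.coe_lineMap_eq]⟩
  have η_smooth : ContMDiffOn 𝓘(ℝ, ℝ) 𝓘(ℝ, E) 1 η (Icc 0 1) := by
    apply ContMDiff.contMDiffOn
    rw [contMDiff_iff_contDiff]
    exact ContinuousAffineMap.contDiff _
  have hle : riemannianEDist 𝓘(ℝ, E) x y ≤ pathELength 𝓘(ℝ, E) γ 0 1 := by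
    apply riemannianEDist_le_pathELength _ _ _ zero_le_one
    · exact (contMDiffOn_extChartAt_symm x).comp η_smooth fun t ht => (hball _ (hη t ht)).1
    · simp [γ, η, ContinuousAffineMap.coe_lineMap_eq]
    · simp only [γ, η, ContinuousAffineMap.coe_lineMap_eq, AffineMap.lineMap_apply_one]
      exact (extChartAt 𝓘(ℝ, E) x).left_inv hys
  refine hle.trans ?_
  rw [← lintegral_enorm_fderiv_lineMap, pathELength_eq_lintegral_mfderivWithin_Icc,
    ← lintegral_const_mul' _ _ ENNReal.coe_ne_top]
  refine setLIntegral_mono' measurableSet_Icc fun t ht => ?_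
  have hcomp : mfderivWithin 𝓘(ℝ, ℝ) 𝓘(ℝ, E) γ (Icc 0 1) t =
      (mfderivWithin 𝓘(ℝ, E) 𝓘(ℝ, E) (extChartAt 𝓘(ℝ, E) x).symm (range 𝓘(ℝ, E)) (η t)) ∘L
        (mfderivWithin 𝓘(ℝ, ℝ) 𝓘(ℝ, E) η (Icc 0 1) t) := by
    apply mfderivWithin_comp
    · exact mdifferentiableWithinAt_extChartAt_symm (hball _ (hη t ht)).1
    · exact η_smooth.mdifferentiableOn one_ne_zero t ht
    · exact fun t _ => by simp
    · rw [uniqueMDiffWithinAt_iff_uniqueDiffWithinAt]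
      exact uniqueDiffOn_Icc zero_lt_one t ht
  rw [hcomp, mfderivWithin_eq_fderivWithin]
  have := (hball _ (hη t ht)).2 (fderivWithin ℝ η (Icc 0 1) t 1)
  exact enorm_le_of_norm_le this

theorem IsChartIsometry.eventually_le_riemannianEDist [RegularSpace M] (hT : IsChartIsometry x T)
    {r : ℝ≥0} (hr : 1 < r) :
    ∀ᶠ y in 𝓝 x, ‖T (extChartAt 𝓘(ℝ, E) x y - extChartAt 𝓘(ℝ, E) x x)‖ₑ
      ≤ r * riemannianEDist 𝓘(ℝ, E) x y := by
  -- Every path from `x` of length below `c` stays where the norm comparison holds, so nearly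
  -- minimal paths can be measured in the chart.
  obtain ⟨c, hc, hsub⟩ := setOfPred_riemannianEDist_lt_subset_nhds' 𝓘(ℝ, E)
    (inter_mem (chart_source_mem_nhds E x)
      (hT.eventually_norm_mfderiv_le (r := r) (by exact_mod_cast hr)))
  filter_upwards [eventually_riemannianEDist_lt 𝓘(ℝ, E) x hc] with y hy
  suffices hlen : ∀ L, riemannianEDist 𝓘(ℝ, E) x y < L → L < c →
      ‖T (extChartAt 𝓘(ℝ, E) x y - extChartAt 𝓘(ℝ, E) x x)‖ₑ ≤ r * L by
    refine le_of_forall_gt fun a ha => ?_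
    rw [mul_comm] at ha
    have h2 := ENNReal.lt_div_iff_mul_lt (.inl (by exact_mod_cast (zero_lt_one.trans hr).ne'))
      (.inl ENNReal.coe_ne_top) |>.2 ha
    obtain ⟨L, hL, hL2⟩ := exists_between (lt_min h2 hy)
    refine (hlen L hL (hL2.trans_le (min_le_right _ _))).trans_lt ?_
    rw [mul_comm]
    exact ENNReal.lt_div_iff_mul_lt (.inl (by exact_mod_cast (zero_lt_one.trans hr).ne'))
      (.inl ENNReal.coe_ne_top) |>.1 (hL2.trans_le (min_le_left _ _))
  intro L hL hLc
  obtain ⟨γ, h0, h1, hγ, hlt, -⟩ := exists_lt_locally_constant_of_riemannianEDist_lt hL zero_lt_one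
  have hmem : ∀ t ∈ Icc (0 : ℝ) 1, γ t ∈ _ := fun t ht => hsub (by
    refine lt_of_le_of_lt (riemannianEDist_le_pathELength hγ.contMDiffOn h0 rfl ht.1) ?_
    exact (pathELength_mono le_rfl ht.2).trans_lt (hlt.trans hLc))
  let γ' : ℝ → E := fun t => extChartAt 𝓘(ℝ, E) x (γ t)
  have hC : ContMDiffOn 𝓘(ℝ, ℝ) 𝓘(ℝ, E) 1 γ' (Icc 0 1) :=
    contMDiffOn_extChartAt.comp (I' := 𝓘(ℝ, E)) (t := (chartAt E x).source)
      hγ.contMDiffOn (fun t ht => (hmem t ht).1)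
  have hC' : ContDiffOn ℝ 1 (fun t => T (γ' t)) (Icc 0 1) :=
    T.contDiff.comp_contDiffOn (contMDiffOn_iff_contDiffOn.1 hC)
  have hfin := enorm_sub_le_lintegral_derivWithin_Icc_of_contDiffOn_Icc hC' zero_le_one
  simp only [γ', h0, h1, ← map_sub] at hfin
  refine hfin.trans (le_trans ?_ (mul_le_mul_right hlt.le _))
  rw [pathELength_eq_lintegral_mfderivWithin_Icc, ← lintegral_const_mul' _ _ ENNReal.coe_ne_top]
  refine setLIntegral_mono' measurableSet_Icc fun t ht => ?_
  have hcomp : mfderivWithin 𝓘(ℝ, ℝ) 𝓘(ℝ, E) γ' (Icc 0 1) t =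
      (mfderiv 𝓘(ℝ, E) 𝓘(ℝ, E) (extChartAt 𝓘(ℝ, E) x) (γ t)) ∘L
        (mfderivWithin 𝓘(ℝ, ℝ) 𝓘(ℝ, E) γ (Icc 0 1) t) := by
    apply mfderiv_comp_mfderivWithin
    · exact mdifferentiableAt_extChartAt (hmem t ht).1
    · exact (hγ.mdifferentiable one_ne_zero).mdifferentiableOn _ ht
    · rw [uniqueMDiffWithinAt_iff_uniqueDiffWithinAt]
      exact uniqueDiffOn_Icc zero_lt_one t ht
  have hd : derivWithin (fun t => T (γ' t)) (Icc 0 1) t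
      = T (mfderivWithin 𝓘(ℝ, ℝ) 𝓘(ℝ, E) γ' (Icc 0 1) t 1) := by
    rw [mfderivWithin_eq_fderivWithin]
    have h2 : DifferentiableWithinAt ℝ γ' (Icc 0 1) t :=
      (contMDiffOn_iff_contDiffOn.1 hC).differentiableOn one_ne_zero t ht
    have h3 := T.hasFDerivAt.comp_hasDerivWithinAt t h2.hasDerivWithinAt
    rw [← fderivWithin_derivWithin] at h3
    exact h3.derivWithin (uniqueDiffOn_Icc zero_lt_one t ht)
  rw [hd, hcomp]
  have := (hmem t ht).2 (mfderivWithin 𝓘(ℝ, ℝ) 𝓘(ℝ, E) γ (Icc 0 1) t 1)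
  exact enorm_le_of_norm_le this

end LocalComparison

end

/-! ### Properness, finiteness and approximate intermediate points. -/

section

open MeasureTheory Set Filter Topology Function Manifold Bundle TameChains
open scoped ENNReal NNReal ContDiff Pointwise

/-- One compact ball about `1` generates larger ones: a point at distance at most `(n + 1) * (r /
2)` is the product of a point of the `r`-ball and one of the ball of radius `n * (r / 2)`. -/
theorem properSpace_of_approx {G : Type*} [Group G] [MetricSpace G] [IsTopologicalGroup G]
    [IsIsometricSMul Gᵐᵒᵖ G] [WeaklyLocallyCompactSpace G]
    (happ : ∀ (x y : G) (t ε : ℝ), 0 ≤ t → t ≤ dist x y → 0 < ε →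
      ∃ z, dist x z ≤ t ∧ dist z y ≤ dist x y - t + ε) : ProperSpace G := by
  obtain ⟨r, hr, hc⟩ := Metric.exists_isCompact_closedBall (1 : G)
  have hstep : ∀ n : ℕ, IsCompact (Metric.closedBall (1 : G) (n * (r / 2))) := by
    intro n
    induction n with
    | zero => simp
    | succ n ih =>
      refine (hc.mul ih).of_isClosed_subset Metric.isClosed_closedBall fun z hz => ?_
      rw [Metric.mem_closedBall, dist_comm] at hz
      push_cast at hz
      have hn : (0 : ℝ) ≤ n * (r / 2) := by positivity
      -- Radii grow by `r / 2` only, so the approximation error `r / 2` still fits into the compact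
      -- ball of radius `r`.
      obtain ⟨w, hw1, hw2⟩ := happ 1 z (min (n * (r / 2)) (dist 1 z)) (r / 2)
        (le_min hn dist_nonneg) (min_le_right _ _) (half_pos hr)
      refine mem_mul.2 ⟨z * w⁻¹, ?_, w, ?_, by group⟩
      · rw [Metric.mem_closedBall, ← dist_eq_dist_mul_inv_one, dist_comm]
        refine hw2.trans ?_
        rcases le_total (n * (r / 2)) (dist 1 z) with h | h
        · rw [min_eq_left h]; linarith
        · rw [min_eq_right h]; linarith
      · rw [Metric.mem_closedBall, dist_comm]
        exact hw1.trans (min_le_left _ _)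
  refine ⟨fun x R => ?_⟩
  obtain ⟨n, hn⟩ := exists_nat_ge (R / (r / 2))
  rw [div_le_iff₀ (half_pos hr)] at hn
  refine ((hstep n).image (continuous_mul_const x)).of_isClosed_subset Metric.isClosed_closedBall
    fun z hz => ⟨z * x⁻¹, ?_, by simp⟩
  rw [Metric.mem_closedBall, ← dist_eq_dist_mul_inv_one]
  exact (Metric.mem_closedBall.1 hz).trans hn

section RiemannianDistance

variable {E : Type*} [NormedAddCommGroup E] [NormedSpace ℝ E]
  {M : Type*} [TopologicalSpace M] [ChartedSpace E M] [IsManifold 𝓘(ℝ, E) 1 M]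
  [RiemannianBundle (fun x : M => TangentSpace 𝓘(ℝ, E) x)]
  [IsContinuousRiemannianBundle E (fun x : M => TangentSpace 𝓘(ℝ, E) x)]

theorem riemannianEDist_ne_top [PreconnectedSpace M] (x y : M) :
    riemannianEDist 𝓘(ℝ, E) x y ≠ ⊤ := by
  have hopen : IsOpen {y : M | riemannianEDist 𝓘(ℝ, E) x y < ⊤} := by
    refine isOpen_iff_mem_nhds.2 fun y hy => ?_
    filter_upwards [eventually_riemannianEDist_lt 𝓘(ℝ, E) y one_pos] with z hz
    exact riemannianEDist_triangle.trans_lt (ENNReal.add_lt_top.2 ⟨hy, hz.trans ENNReal.one_lt_top⟩)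
  have hclosed : IsClosed {y : M | riemannianEDist 𝓘(ℝ, E) x y < ⊤} := by
    refine isOpen_compl_iff.1 (isOpen_iff_mem_nhds.2 fun y hy => ?_)
    filter_upwards [eventually_riemannianEDist_lt 𝓘(ℝ, E) y one_pos] with z hz hzx
    refine hy (lt_of_le_of_lt (riemannianEDist_triangle (y := z))
      (ENNReal.add_lt_top.2 ⟨hzx, ?_⟩))
    rw [riemannianEDist_comm]
    exact hz.trans ENNReal.one_lt_top
  have hu := IsClopen.eq_univ ⟨hclosed, hopen⟩ ⟨x, by simp [riemannianEDist_self]⟩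
  exact ((Set.ext_iff.1 hu y).2 trivial).ne

variable (E M) in
/-- The Riemannian distance of a connected manifold. -/
@[reducible] noncomputable def riemannianMetricSpace [T3Space M] [PreconnectedSpace M] :
    MetricSpace M :=
  letI : EMetricSpace M := EMetricSpace.ofRiemannianMetric 𝓘(ℝ, E) M
  EMetricSpace.toMetricSpace fun x y => riemannianEDist_ne_top (E := E) x y

end RiemannianDistance

/-- On a path of length below `dist x y + ε`, the intermediate value theorem finds a point at
distance exactly `t` from `x`; what remains of the path bounds its distance to `y`. -/
theorem exists_dist_le_of_edist_eq_riemannianEDist {E : Type*} [NormedAddCommGroup E]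
    [NormedSpace ℝ E] {M : Type*} [MetricSpace M] [ChartedSpace E M] [IsManifold 𝓘(ℝ, E) 1 M]
    [RiemannianBundle (fun x : M => TangentSpace 𝓘(ℝ, E) x)]
    (hed : ∀ a b : M, edist a b = riemannianEDist 𝓘(ℝ, E) a b) (x y : M) (t ε : ℝ)
    (ht : 0 ≤ t) (htd : t ≤ dist x y) (hε : 0 < ε) :
    ∃ z, dist x z ≤ t ∧ dist z y ≤ dist x y - t + ε := by
  have hlt : riemannianEDist 𝓘(ℝ, E) x y < ENNReal.ofReal (dist x y + ε) := by
    rw [← hed, edist_dist]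
    exact (ENNReal.ofReal_lt_ofReal_iff (by positivity)).2 (by linarith)
  obtain ⟨γ, h0, h1, hγ, hlen, -⟩ := exists_lt_locally_constant_of_riemannianEDist_lt hlt
    zero_lt_one
  have hc : Continuous fun s => dist x (γ s) := continuous_const.dist hγ.continuous
  obtain ⟨s, hs, hst⟩ : t ∈ (fun s => dist x (γ s)) '' Icc 0 1 := by
    refine intermediate_value_Icc zero_le_one hc.continuousOn ⟨?_, ?_⟩
    · simpa [h0] using ht
    · simpa [h1] using htd
  refine ⟨γ s, hst.le, ?_⟩
  have h2 : edist x (γ s) + edist (γ s) y ≤ ENNReal.ofReal (dist x y + ε) := by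
    refine le_trans ?_ hlen.le
    rw [← pathELength_add hs.1 hs.2, hed, hed]
    exact add_le_add (riemannianEDist_le_pathELength hγ.contMDiffOn h0 rfl hs.1)
      (riemannianEDist_le_pathELength hγ.contMDiffOn rfl h1 hs.2)
  rw [edist_dist, edist_dist, ← ENNReal.ofReal_add dist_nonneg dist_nonneg,
    ENNReal.ofReal_le_ofReal_iff (by positivity)] at h2
  simp only at hst
  linarith

end

/-! ### Smoothness of the group law in a chart at the identity. -/

section

open MeasureTheory Set Filter Topology Function Manifold Bundle TameChains Asymptotics
open scoped ENNReal NNReal ContDiff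

/-- A `C²` map of two variables vanishing on both axes is bounded by the product of the norms. -/
theorem ContDiffAt.exists_norm_le_mul_of_eq_zero {A B C : Type*} [NormedAddCommGroup A]
    [NormedSpace ℝ A] [NormedAddCommGroup B] [NormedSpace ℝ B] [NormedAddCommGroup C]
    [NormedSpace ℝ C] {c : A × B → C} (hc : ContDiffAt ℝ 2 c 0)
    (h1 : ∀ᶠ a in 𝓝 (0 : A), c (a, 0) = 0) (h2 : ∀ᶠ b in 𝓝 (0 : B), c (0, b) = 0) :
    ∃ K, ∀ᶠ q in 𝓝 (0 : A × B), ‖c q‖ ≤ K * ‖q.1‖ * ‖q.2‖ := by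
  obtain ⟨K, t, ht, hK⟩ := (hc.fderiv_right (m := 1) (by norm_num)).exists_lipschitzOnWith
  have hdiff : ∀ᶠ q in 𝓝 (0 : A × B), DifferentiableAt ℝ c q := by
    filter_upwards [hc.eventually (by simp)] with q hq using hq.differentiableAt (by simp)
  have h2' : ∀ᶠ q in 𝓝 (0 : A × B), ∀ᶠ b in 𝓝 q.2, c (0, b) = 0 :=
    (continuous_snd.tendsto' (0 : A × B) (0 : B) rfl).eventually (eventually_eventually_nhds.2 h2)
  have h1' : ∀ᶠ q in 𝓝 (0 : A × B), c (q.1, 0) = 0 :=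
    (continuous_fst.tendsto' (0 : A × B) (0 : A) rfl).eventually h1
  obtain ⟨ρ, hρ, hball⟩ := Metric.eventually_nhds_iff_ball.1
    ((hdiff.and (h2'.and h1')).and (Filter.eventually_mem_set.2 ht))
  refine ⟨K, ?_⟩
  filter_upwards [Metric.ball_mem_nhds (0 : A × B) hρ] with q hq
  have hmem : ∀ b ∈ Metric.ball (0 : B) ρ, (q.1, b) ∈ Metric.ball (0 : A × B) ρ ∧
      ((0 : A), b) ∈ Metric.ball (0 : A × B) ρ := by
    intro b hb
    simp only [mem_ball_zero_iff, Prod.norm_def, sup_lt_iff] at hq hb ⊢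
    exact ⟨⟨hq.1, hb⟩, by simpa using hρ, hb⟩
  have hqB : q.2 ∈ Metric.ball (0 : B) ρ := by
    simp only [mem_ball_zero_iff, Prod.norm_def, sup_lt_iff] at hq ⊢
    exact hq.2
  have hder : ∀ b ∈ Metric.ball (0 : B) ρ, HasFDerivWithinAt (fun b => c (q.1, b))
      ((fderiv ℝ c (q.1, b)).comp (ContinuousLinearMap.inr ℝ A B)) (Metric.ball 0 ρ) b := by
    intro b hb
    have hd := (hball _ (hmem b hb).1).1.1.hasFDerivAt
    exact (hd.comp b (hasFDerivAt_prodMk_right q.1 b)).hasFDerivWithinAt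
  have hbound : ∀ b ∈ Metric.ball (0 : B) ρ,
      ‖(fderiv ℝ c (q.1, b)).comp (ContinuousLinearMap.inr ℝ A B)‖ ≤ K * ‖q.1‖ := by
    intro b hb
    obtain ⟨⟨hd0, hz, -⟩, hm0⟩ := hball _ (hmem b hb).2
    -- Since `c` vanishes on the axis `{0} × B`, so does its partial derivative in `b`. The
    -- Lipschitz derivative then bounds that partial derivative by `K * ‖q.1‖`, and the mean value
    -- inequality from `(q.1, 0)` supplies the factor `‖q.2‖`.
    have hzero : (fderiv ℝ c (0, b)).comp (ContinuousLinearMap.inr ℝ A B) = 0 := by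
      have e1 : HasFDerivAt (fun b => c (0, b))
          ((fderiv ℝ c (0, b)).comp (ContinuousLinearMap.inr ℝ A B)) b :=
        hd0.hasFDerivAt.comp b (hasFDerivAt_prodMk_right 0 b)
      have e2 : HasFDerivAt (fun b => c (0, b)) (0 : B →L[ℝ] C) b :=
        (hasFDerivAt_const (0 : C) b).congr_of_eventuallyEq hz
      exact e1.unique e2
    have hl := hK.norm_sub_le (hball _ (hmem b hb).1).2 hm0
    rw [Prod.mk_sub_mk, sub_zero, sub_self, Prod.norm_mk, norm_zero,
      max_eq_left (norm_nonneg _)] at hl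
    calc ‖(fderiv ℝ c (q.1, b)).comp (ContinuousLinearMap.inr ℝ A B)‖
        = ‖(fderiv ℝ c (q.1, b) - fderiv ℝ c (0, b)).comp (ContinuousLinearMap.inr ℝ A B)‖ := by
          rw [ContinuousLinearMap.sub_comp, hzero, sub_zero]
      _ ≤ ‖fderiv ℝ c (q.1, b) - fderiv ℝ c (0, b)‖ * 1 :=
          (ContinuousLinearMap.opNorm_comp_le _ _).trans
            (by gcongr; exact ContinuousLinearMap.norm_inr_le_one ℝ A B)
      _ ≤ K * ‖q.1‖ := by rw [mul_one]; exact hl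
  have hmv := (convex_ball (0 : B) ρ).norm_image_sub_le_of_norm_hasFDerivWithin_le hder hbound
    (Metric.mem_ball_self hρ) hqB
  have h0 : c (q.1, 0) = 0 := (hball q hq).1.2.2
  simpa [h0] using hmv

section LieGroup

variable {E : Type*} [NormedAddCommGroup E] [NormedSpace ℝ E]
  {G : Type*} [Group G] [MetricSpace G] [ChartedSpace E G] [LieGroup 𝓘(ℝ, E) ∞ G]
  {F : Type*} [NormedAddCommGroup F] [NormedSpace ℝ F]

/-- The preferred chart at the identity, centred and composed with a linear equivalence. -/
noncomputable def centredChart (T : E ≃L[ℝ] F) (z : G) : F :=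
  T (extChartAt 𝓘(ℝ, E) (1 : G) z - extChartAt 𝓘(ℝ, E) (1 : G) 1)

/-- The inverse of `centredChart`. -/
noncomputable def centredChartSymm (G : Type*) [Group G] [MetricSpace G] [ChartedSpace E G]
    (T : E ≃L[ℝ] F) (v : F) : G :=
  (extChartAt 𝓘(ℝ, E) (1 : G)).symm (T.symm v + extChartAt 𝓘(ℝ, E) (1 : G) 1)

variable (T : E ≃L[ℝ] F)

omit [LieGroup 𝓘(ℝ, E) ∞ G] in
theorem centredChartSymm_zero : centredChartSymm G T 0 = 1 := by
  simp [centredChartSymm]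

omit [LieGroup 𝓘(ℝ, E) ∞ G] in
theorem centredChart_one : centredChart T (1 : G) = 0 := by
  simp [centredChart]

omit [LieGroup 𝓘(ℝ, E) ∞ G] in
theorem centredChartSymm_centredChart {z : G} (hz : z ∈ (chartAt E (1 : G)).source) :
    centredChartSymm G T (centredChart T z) = z := by
  rw [← extChartAt_source 𝓘(ℝ, E)] at hz
  rw [centredChartSymm, centredChart, T.symm_apply_apply, sub_add_cancel]
  exact (extChartAt 𝓘(ℝ, E) (1 : G)).left_inv hz

theorem contMDiffAt_centredChart {z : G} (hz : z ∈ (chartAt E (1 : G)).source) :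
    ContMDiffAt 𝓘(ℝ, E) 𝓘(ℝ, F) ∞ (centredChart T) z := by
  have h1 : ContMDiffAt 𝓘(ℝ, E) 𝓘(ℝ, E) ∞ (extChartAt 𝓘(ℝ, E) (1 : G)) z :=
    contMDiffAt_extChartAt' hz
  have h2 : ContDiff ℝ ∞ fun e => T (e - extChartAt 𝓘(ℝ, E) (1 : G) 1) :=
    T.contDiff.comp (contDiff_id.sub contDiff_const)
  exact h2.contMDiff.contMDiffAt.comp z h1

variable (G) in
theorem eventually_centredChartSymm :
    ∀ᶠ v in 𝓝 (0 : F), centredChartSymm G T v ∈ (chartAt E (1 : G)).source ∧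
      centredChart T (centredChartSymm G T v) = v ∧
      ContMDiffAt 𝓘(ℝ, F) 𝓘(ℝ, E) ∞ (centredChartSymm G T) v := by
  have hc : ContDiff ℝ ∞ fun v => T.symm v + extChartAt 𝓘(ℝ, E) (1 : G) 1 :=
    T.symm.contDiff.add contDiff_const
  have ht : Tendsto (fun v => T.symm v + extChartAt 𝓘(ℝ, E) (1 : G) 1) (𝓝 0)
      (𝓝 (extChartAt 𝓘(ℝ, E) (1 : G) 1)) := hc.continuous.tendsto' _ _ (by simp)
  have hopen : IsOpen (extChartAt 𝓘(ℝ, E) (1 : G)).target := isOpen_extChartAt_target _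
  filter_upwards [ht.eventually (hopen.mem_nhds (mem_extChartAt_target (1 : G)))] with v hv
  refine ⟨?_, ?_, ?_⟩
  · rw [← extChartAt_source 𝓘(ℝ, E)]
    exact (extChartAt 𝓘(ℝ, E) (1 : G)).map_target hv
  · rw [centredChart, centredChartSymm, (extChartAt 𝓘(ℝ, E) (1 : G)).right_inv hv,
      add_sub_cancel_right, T.apply_symm_apply]
  · exact ((contMDiffOn_extChartAt_symm (1 : G)).contMDiffAt (hopen.mem_nhds hv)).comp v
      hc.contMDiff.contMDiffAt

theorem isLogChart_centredChart [IsTopologicalGroup G]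
    (hle : ∀ r : ℝ, 1 < r → ∀ᶠ z in 𝓝 (1 : G), dist z 1 ≤ r * ‖centredChart T z‖)
    (hge : ∀ r : ℝ, 1 < r → ∀ᶠ z in 𝓝 (1 : G), ‖centredChart T z‖ ≤ r * dist z 1) :
    IsLogChart (centredChart T) (centredChartSymm G T) := by
  have hs1 : (1 : G) ∈ (chartAt E (1 : G)).source := mem_chart_source E 1
  have hσ0 := (eventually_centredChartSymm G T).self_of_nhds.2.2
  have hψ1 := contMDiffAt_centredChart (G := G) T hs1
  have hright : ∀ᶠ v in 𝓝 (0 : F), centredChart T (centredChartSymm G T v) = v :=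
    (eventually_centredChartSymm G T).mono fun v hv => hv.2.1
  have hfst : ContMDiffAt 𝓘(ℝ, F × F) 𝓘(ℝ, E) ∞ (fun q : F × F => centredChartSymm G T q.1) 0 :=
    ContMDiffAt.comp (I' := 𝓘(ℝ, F)) (0 : F × F) (g := centredChartSymm G T) (f := Prod.fst)
      hσ0 contDiff_fst.contMDiff.contMDiffAt
  have hsnd : ContMDiffAt 𝓘(ℝ, F × F) 𝓘(ℝ, E) ∞ (fun q : F × F => centredChartSymm G T q.2) 0 :=
    ContMDiffAt.comp (I' := 𝓘(ℝ, F)) (0 : F × F) (g := centredChartSymm G T) (f := Prod.snd)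
      hσ0 contDiff_snd.contMDiff.contMDiffAt
  refine ⟨centredChartSymm_zero T, hψ1.continuousAt, hσ0.continuousAt, ?_, hright, ?_, ?_, ?_,
    ?_, ?_⟩
  · filter_upwards [chart_source_mem_nhds E (1 : G)] with z hz
    exact centredChartSymm_centredChart T hz
  · refine isLittleO_iff.2 fun δ hδ => ?_
    filter_upwards [hle (1 + δ) (by linarith), hge (1 + δ) (by linarith)] with z h1 h2
    rw [Real.norm_eq_abs, abs_le]
    constructor
    · by_contra hcon
      push Not at hcon
      have : (1 + δ) * dist z 1 < (1 + δ) * ((1 - δ) * ‖centredChart T z‖) := by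
        gcongr
        linarith
      nlinarith [norm_nonneg (centredChart T z), sq_nonneg δ,
        mul_nonneg (sq_nonneg δ) (norm_nonneg (centredChart T z))]
    · linarith
  · have hk : ContDiffAt ℝ ∞
        (fun q : F × F => centredChart T (centredChartSymm G T q.1 * (centredChartSymm G T q.2)⁻¹))
        0 := by
      rw [← contMDiffAt_iff_contDiffAt]
      refine ContMDiffAt.comp (I' := 𝓘(ℝ, E)) (0 : F × F) (g := centredChart T) ?_ (hfst.mul hsnd.inv)
      simpa [centredChartSymm_zero] using hψ1
    have hst := hk.hasStrictFDerivAt (by simp)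
    convert! hst using 1
    set L := fderiv ℝ (fun q : F × F =>
      centredChart T (centredChartSymm G T q.1 * (centredChartSymm G T q.2)⁻¹)) 0
    have h1 : ∀ u, L (u, 0) = u := by
      have e1 := hst.hasFDerivAt.comp (f := fun u : F => (u, (0 : F))) (0 : F)
        (hasFDerivAt_prodMk_left (0 : F) (0 : F))
      have e2 := (hasFDerivAt_id (𝕜 := ℝ) (0 : F)).congr_of_eventuallyEq (f₁ := _) (by
        filter_upwards [hright] with u hu
        change centredChart T (centredChartSymm G T u * (centredChartSymm G T 0)⁻¹) = u
        rw [centredChartSymm_zero, inv_one, mul_one, hu])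
      intro u
      simpa using DFunLike.congr_fun (e1.unique e2) u
    -- The derivative of the quotient map is determined by its values on `(u, 0)`, where the map is
    -- the identity, and on the diagonal, where it is constant.
    have h2 : ∀ u, L (u, u) = 0 := by
      have e1 := hst.hasFDerivAt.comp (f := fun u : F => (u, u)) (0 : F)
        ((hasFDerivAt_id (0 : F)).prodMk (hasFDerivAt_id (0 : F)))
      have e2 := (hasFDerivAt_const (𝕜 := ℝ) (0 : F) (0 : F)).congr_of_eventuallyEq (f₁ := _) (by
        refine Eventually.of_forall fun u => ?_
        change centredChart T (centredChartSymm G T u * (centredChartSymm G T u)⁻¹) = 0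
        rw [mul_inv_cancel, centredChart_one])
      intro u
      simpa using DFunLike.congr_fun (e1.unique e2) u
    ext u
    · simp [h1]
    · have := h2 u
      rw [show ((u, u) : F × F) = (u, 0) + (0, u) by simp, map_add, h1] at this
      simpa using (eq_neg_of_add_eq_zero_right this).symm
  · filter_upwards [eventually_centredChartSymm G T] with v hv
    have hk : ContDiffAt ℝ ∞
        (fun u : F => centredChart T (centredChartSymm G T u * centredChartSymm G T v)) 0 := by
      rw [← contMDiffAt_iff_contDiffAt]
      refine ContMDiffAt.comp (I' := 𝓘(ℝ, E)) (0 : F) (g := centredChart T) ?_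
        (hσ0.mul contMDiffAt_const)
      simpa [centredChartSymm_zero] using contMDiffAt_centredChart T hv.1
    exact hk.differentiableAt (by simp)
  · intro y
    have hk : ContDiffAt ℝ ∞
        (fun u : F => centredChart T (y * centredChartSymm G T u * y⁻¹)) 0 := by
      rw [← contMDiffAt_iff_contDiffAt]
      refine ContMDiffAt.comp (I' := 𝓘(ℝ, E)) (0 : F) (g := centredChart T) ?_
        ((contMDiffAt_const.mul hσ0).mul contMDiffAt_const)
      simpa [centredChartSymm_zero] using hψ1
    exact hk.differentiableAt (by simp)
  · have hk : ContDiffAt ℝ ∞ (fun q : F × F => centredChart T (centredChartSymm G T q.1 *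
        centredChartSymm G T q.2 * (centredChartSymm G T q.1)⁻¹)) 0 := by
      rw [← contMDiffAt_iff_contDiffAt]
      refine ContMDiffAt.comp (I' := 𝓘(ℝ, E)) (0 : F × F) (g := centredChart T) ?_
        ((hfst.mul hsnd).mul hfst.inv)
      simpa [centredChartSymm_zero] using hψ1
    -- After subtraction of the second coordinate, conjugation vanishes on both axes: conjugating
    -- `1` gives `1`, and conjugating by `1` does nothing.
    have hc := hk.sub contDiffAt_snd
    refine ContDiffAt.exists_norm_le_mul_of_eq_zero (hc.of_le ENat.LEInfty.out) ?_ ?_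
    · refine Eventually.of_forall fun a => ?_
      simp [centredChartSymm_zero, centredChart_one]
    · filter_upwards [hright] with b hb
      simp [centredChartSymm_zero, hb]

end LieGroup

end

/-! ### Charts and geodesics for the right-invariant metric. -/

section

open MeasureTheory Set Filter Topology Function Manifold Bundle TameChains
open scoped ENNReal NNReal ContDiff

/-- The norm of `E` is arbitrary, whereas the momentum argument needs an inner product. Coordinates
in an orthonormal basis of the tangent space at `x` provide a Euclidean target. -/
theorem exists_isChartIsometry {E : Type*} [NormedAddCommGroup E] [NormedSpace ℝ E]
    [FiniteDimensional ℝ E] {M : Type*} [TopologicalSpace M] [ChartedSpace E M]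
    [IsManifold 𝓘(ℝ, E) 1 M] [RiemannianBundle (fun x : M => TangentSpace 𝓘(ℝ, E) x)] (x : M) :
    ∃ T : E ≃L[ℝ] EuclideanSpace ℝ (Fin (Module.finrank ℝ E)),
      IsChartIsometry x (T : E →L[ℝ] EuclideanSpace ℝ (Fin (Module.finrank ℝ E))) := by
  have : FiniteDimensional ℝ (TangentSpace 𝓘(ℝ, E) x) := inferInstanceAs (FiniteDimensional ℝ E)
  let b := stdOrthonormalBasis ℝ (TangentSpace 𝓘(ℝ, E) x)
  let e := (trivializationAt E (TangentSpace 𝓘(ℝ, E)) x).continuousLinearEquivAt ℝ x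
    (FiberBundle.mem_baseSet_trivializationAt' x)
  refine ⟨e.symm.trans b.repr.toContinuousLinearEquiv, fun w => ?_⟩
  have h1 : ‖b.repr (e.symm w)‖ = ‖e.symm w‖ := b.repr.norm_map (e.symm w)
  have h2 : e.symm w = (trivializationAt E (TangentSpace 𝓘(ℝ, E)) x).symmL ℝ x w :=
    congrFun (Trivialization.symm_continuousLinearEquivAt_eq _
      (FiberBundle.mem_baseSet_trivializationAt' x)) w
  exact h1.trans (congrArg norm h2)

section LieGroup

variable {E : Type*} [NormedAddCommGroup E] [NormedSpace ℝ E] [FiniteDimensional ℝ E]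
  {G : Type*} [Group G] [MetricSpace G] [ChartedSpace E G] [LieGroup 𝓘(ℝ, E) ∞ G]
  {g : ContMDiffRiemannianMetric 𝓘(ℝ, E) ∞ E (fun x : G => TangentSpace 𝓘(ℝ, E) x)}

theorem exists_isLogChart (hed : ∀ x y : G, edist x y = riemDist g x y) :
    ∃ (ψ : G → EuclideanSpace ℝ (Fin (Module.finrank ℝ E)))
      (σ : EuclideanSpace ℝ (Fin (Module.finrank ℝ E)) → G), IsLogChart ψ σ := by
  let : RiemannianBundle (fun x : G => TangentSpace 𝓘(ℝ, E) x) := ⟨g.toRiemannianMetric⟩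
  have : IsContinuousRiemannianBundle E (fun x : G => TangentSpace 𝓘(ℝ, E) x) :=
    ⟨⟨g.inner, g.contMDiff.continuous, fun _ _ _ => rfl⟩⟩
  have := topologicalGroup_of_lieGroup 𝓘(ℝ, E) ∞ (G := G)
  obtain ⟨T, hT⟩ := exists_isChartIsometry (E := E) (1 : G)
  refine ⟨centredChart T, centredChartSymm G T, isLogChart_centredChart T ?_ ?_⟩
  · intro r hr
    lift r to ℝ≥0 using by linarith
    filter_upwards [hT.eventually_riemannianEDist_le (by exact_mod_cast hr)] with z hz
    have h1 : edist 1 z ≤ r * ‖centredChart T z‖ₑ := (hed 1 z).trans_le hz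
    rw [edist_comm, edist_nndist, enorm_eq_nnnorm] at h1
    exact_mod_cast h1
  · intro r hr
    lift r to ℝ≥0 using by linarith
    filter_upwards [hT.eventually_le_riemannianEDist (by exact_mod_cast hr)] with z hz
    have h1 : ‖centredChart T z‖ₑ ≤ r * edist 1 z := hz.trans_eq (by rw [hed]; rfl)
    rw [edist_comm, edist_nndist, enorm_eq_nnnorm] at h1
    exact_mod_cast h1

theorem properSpace_of_riemDist (hed : ∀ x y : G, edist x y = riemDist g x y)
    [IsIsometricSMul Gᵐᵒᵖ G] : ProperSpace G := by
  let : RiemannianBundle (fun x : G => TangentSpace 𝓘(ℝ, E) x) := ⟨g.toRiemannianMetric⟩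
  have := topologicalGroup_of_lieGroup 𝓘(ℝ, E) ∞ (G := G)
  have : LocallyCompactSpace G := Manifold.locallyCompact_of_finiteDimensional 𝓘(ℝ, E)
  exact properSpace_of_approx fun x y t ε ht htd hε =>
    exists_dist_le_of_edist_eq_riemannianEDist (E := E) hed x y t ε ht htd hε

omit [FiniteDimensional ℝ E] in
theorem exists_geodesic_of_riemDist [ProperSpace G] (hed : ∀ x y : G, edist x y = riemDist g x y)
    (x y : G) : ∃ γ : ℝ → G, γ 0 = x ∧ γ (dist x y) = y ∧
      ∀ s ∈ Icc 0 (dist x y), ∀ t ∈ Icc 0 (dist x y), dist (γ s) (γ t) = |s - t| := by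
  let : RiemannianBundle (fun x : G => TangentSpace 𝓘(ℝ, E) x) := ⟨g.toRiemannianMetric⟩
  exact exists_geodesic (fun x y r s hr hs h => exists_dist_le_of_approx
    (fun x y t ε ht htd hε =>
      exists_dist_le_of_edist_eq_riemannianEDist (E := E) hed x y t ε ht htd hε) hr hs h) x y

end LieGroup

theorem exists_metricSpace_edist_eq_riemDist {E : Type*} [NormedAddCommGroup E] [NormedSpace ℝ E]
    {G : Type*} [Group G] [tG : TopologicalSpace G] [ChartedSpace E G] [LieGroup 𝓘(ℝ, E) ∞ G]
    [T3Space G] [ConnectedSpace G]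
    (g : ContMDiffRiemannianMetric 𝓘(ℝ, E) ∞ E (fun x : G => TangentSpace 𝓘(ℝ, E) x)) :
    ∃ m : MetricSpace G, m.toPseudoMetricSpace.toUniformSpace.toTopologicalSpace = tG ∧
      ∀ x y : G, edist x y = riemDist g x y := by
  let : RiemannianBundle (fun x : G => TangentSpace 𝓘(ℝ, E) x) := ⟨g.toRiemannianMetric⟩
  have : IsContinuousRiemannianBundle E (fun x : G => TangentSpace 𝓘(ℝ, E) x) :=
    ⟨⟨g.inner, g.contMDiff.continuous, fun _ _ _ => rfl⟩⟩
  exact ⟨riemannianMetricSpace E G, rfl, fun _ _ => rfl⟩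

end

open MeasureTheory Manifold Bundle
open scoped ENNReal NNReal ContDiff

/-! ### Assembly of the geometric and measure-theoretic parts. -/

section LieGroup

open TameChains Set Filter Topology

variable {E : Type*} [NormedAddCommGroup E] [NormedSpace ℝ E] [FiniteDimensional ℝ E]
  {G : Type*} [Group G]

theorem ae_mem_uniqueNearestSet_riemDist [MetricSpace G] [ChartedSpace E G] [LieGroup 𝓘(ℝ, E) ∞ G]
    [ProperSpace G] [IsIsometricSMul Gᵐᵒᵖ G] [SecondCountableTopology G] [MeasurableSpace G]
    [BorelSpace G] (lam : Measure G) [SFinite lam] [lam.IsMulLeftInvariant]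
    {g : ContMDiffRiemannianMetric 𝓘(ℝ, E) ∞ E (fun x : G => TangentSpace 𝓘(ℝ, E) x)}
    (hed : ∀ x y : G, edist x y = riemDist g x y)
    {Ω : Type*} [MeasurableSpace Ω] [MulAction G Ω] {S : Set Ω}
    (hU : MeasurableSet (uniqueNearestSet (riemDist g) S))
    (hS : ∀ p : Ω, (orbitSet S p : Set G).Nonempty ∧ IsClosed (orbitSet S p : Set G)) (p : Ω) :
    ∀ᵐ x ∂lam, (x, p) ∈ uniqueNearestSet (riemDist g) S := by
  have := topologicalGroup_of_lieGroup 𝓘(ℝ, E) ∞ (G := G)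
  obtain ⟨ψ, σ, h⟩ := exists_isLogChart hed
  have hfun : (fun a b : G => edist a b) = riemDist g := by
    funext a b
    exact hed a b
  have hm : MeasurableSet {x : G | ∃ y, IsUniqueNearest (fun a b : G => edist a b)
      (orbitSet S p) x y} := by
    rw [hfun]
    exact (by fun_prop : Measurable fun x : G => (x, p)) hU
  have := h.ae_exists_isUniqueNearest (exists_geodesic_of_riemDist hed) lam (hS p).2 (hS p).1 hm
  rw [hfun] at this
  exact this

/-- The analytic facts on the Riemannian distance and the orbit sets used in the main theorem. -/
theorem riemDist_cell_properties [tG : TopologicalSpace G] [ChartedSpace E G]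
    [LieGroup 𝓘(ℝ, E) ∞ G] [T2Space G] [SecondCountableTopology G] [ConnectedSpace G]
    [MeasurableSpace G] [BorelSpace G] (lam : Measure G) [SFinite lam] [lam.IsMulLeftInvariant]
    (g : ContMDiffRiemannianMetric 𝓘(ℝ, E) ∞ E (fun x : G => TangentSpace 𝓘(ℝ, E) x))
    (hg : IsRightInvariantMetric g)
    {Ω : Type*} [MeasurableSpace Ω] [StandardBorelSpace Ω] [MulAction G Ω] [MeasurableSMul₂ G Ω]
    {S : Set Ω} (hS : MeasurableSet S)
    (hSorb : ∀ p : Ω, (orbitSet S p : Set G).Nonempty ∧ IsClosed (orbitSet S p : Set G)) :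
    PolishSpace G ∧ MeasurableSet {q : G × Ω | q.1 ∈ cell (riemDist g) S q.2} ∧
      ∀ p, ∀ᵐ x ∂lam, (x, p) ∈ uniqueNearestSet (riemDist g) S := by
  have hgrp := topologicalGroup_of_lieGroup 𝓘(ℝ, E) ∞ (G := G)
  have hlc : LocallyCompactSpace G := Manifold.locallyCompact_of_finiteDimensional 𝓘(ℝ, E)
  obtain ⟨m, hm, hed⟩ := exists_metricSpace_edist_eq_riemDist g
  subst hm
  have hd := riemDist_mul_right g hg
  have hiso : IsIsometricSMul Gᵐᵒᵖ G := ⟨fun a x y => by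
    rw [hed, hed]
    exact hd a.unop x y⟩
  -- Properness yields σ-compactness and completeness: the former is needed for projecting Borel
  -- sets with closed sections, the latter for `G` to be Polish.
  have hproper := properSpace_of_riemDist hed
  have hdc : ∀ x c, IsClosed {z | riemDist g x z ≤ c} := fun x c => by
    simp only [← hed]
    exact isClosed_le (by fun_prop) continuous_const
  have hdm : Measurable fun q : G × G => riemDist g q.1 q.2 := by
    simp only [← hed]
    fun_prop
  have hC := measurableSet_setOf_mem_cell hdm hdc hS fun p => (hSorb p).2
  exact ⟨inferInstance, hC, ae_mem_uniqueNearestSet_riemDist lam hed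
    (measurableSet_uniqueNearestSet hd hC) hSorb⟩

end LieGroup

open TameChains in
theorem mainTheorem3
    {E : Type*} [NormedAddCommGroup E] [NormedSpace ℝ E] [FiniteDimensional ℝ E]
    {G : Type*} [Group G] [TopologicalSpace G] [ChartedSpace E G] [LieGroup 𝓘(ℝ, E) ∞ G]
    [T2Space G] [SecondCountableTopology G] [ConnectedSpace G]
    [MeasurableSpace G] [BorelSpace G]
    (lam : Measure G) [lam.IsHaarMeasure] [lam.IsMulRightInvariant]
    (g : ContMDiffRiemannianMetric 𝓘(ℝ, E) ∞ E (fun x : G => TangentSpace 𝓘(ℝ, E) x))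
    (hg : IsRightInvariantMetric g)
    {Ω : Type*} [MeasurableSpace Ω] [StandardBorelSpace Ω] [MulAction G Ω] [MeasurableSMul₂ G Ω]
    (S : Set Ω) (hS : MeasurableSet S)
    (hSorb : ∀ p : Ω, (orbitSet S p : Set G).Nonempty ∧ (orbitSet S p : Set G).Countable ∧
      IsClosed (orbitSet S p : Set G)) :
    (∀ f : Ω → ℝ≥0∞, Measurable f →
      Measurable (cellIntegral (riemDist g) lam S f) ∧
      (∀ p ∉ S, cellIntegral (riemDist g) lam S f p = 0) ∧
      TamelyEquidecomposable (enhance lam f)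
        (enhance (Measure.count : Measure G) (cellIntegral (riemDist g) lam S f))) ∧
    (∀ μ : Measure Ω, IsProbabilityMeasure μ → SMulInvariantMeasure G Ω μ →
      ∃! ν : Measure Ω, IsInfinitesimalMeasure lam (Measure.count : Measure G) μ ν) ∧
    (∀ μ ν : Measure Ω, IsProbabilityMeasure μ → SMulInvariantMeasure G Ω μ →
      IsInfinitesimalMeasure lam (Measure.count : Measure G) μ ν →
      ∀ f : Ω → ℝ≥0∞, Measurable f →
        ∫⁻ p, f p ∂μ = ∫⁻ p in S, cellIntegral (riemDist g) lam S f p ∂ν) ∧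
    (∀ μ₁ μ₂ ν₁ ν₂ : Measure Ω,
      IsProbabilityMeasure μ₁ → SMulInvariantMeasure G Ω μ₁ →
      IsProbabilityMeasure μ₂ → SMulInvariantMeasure G Ω μ₂ →
      IsInfinitesimalMeasure lam (Measure.count : Measure G) μ₁ ν₁ →
      IsInfinitesimalMeasure lam (Measure.count : Measure G) μ₂ ν₂ →
      ν₁.restrict S = ν₂.restrict S → μ₁ = μ₂) := by
  have hgrp := topologicalGroup_of_lieGroup 𝓘(ℝ, E) ∞ (G := G)
  have hlc : LocallyCompactSpace G := Manifold.locallyCompact_of_finiteDimensional 𝓘(ℝ, E)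
  have hd := riemDist_mul_right g hg
  obtain ⟨hpolish, hC, hae⟩ := riemDist_cell_properties lam g hg hS fun p =>
    ⟨(hSorb p).1, (hSorb p).2.2⟩
  have hcount : ∀ p : Ω, (orbitSet S p : Set G).Countable := fun p => (hSorb p).2.1
  obtain ⟨h, hc, hs, h0, ht⟩ := exists_testFunction lam
  have hint : ∀ μ ν : Measure Ω, IsProbabilityMeasure μ → SMulInvariantMeasure G Ω μ →
      IsInfinitesimalMeasure lam (Measure.count : Measure G) μ ν →
      ∀ f : Ω → ℝ≥0∞, Measurable f →
        ∫⁻ p, f p ∂μ = ∫⁻ p in S, cellIntegral (riemDist g) lam S f p ∂ν :=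
    fun μ ν _ _ hν f hf =>
      lintegral_eq_setLIntegral_cellIntegral hd hC hae hcount hν hc hs h0 ht hf
  refine ⟨fun f hf => ⟨measurable_cellIntegral hC lam hf,
    fun p hp => cellIntegral_eq_zero lam f hp, nearestChain (riemDist g) lam S f,
    isTameChain_nearestChain hd hC hf, vertex_zero_nearestChain hd hC hae,
    vertex_one_nearestChain hd hC hcount hf⟩,
    fun μ _ _ => existsUnique_isInfinitesimalMeasure_count lam μ, hint, ?_⟩
  intro μ₁ μ₂ ν₁ ν₂ i₁ j₁ i₂ j₂ h₁ h₂ hν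
  -- The integral of `f` depends on the invariant measure only through the restriction of its
  -- infinitesimal measure to `S`.
  refine Measure.ext_of_lintegral _ fun f hf => ?_
  rw [hint μ₁ ν₁ i₁ j₁ h₁ f hf, hint μ₂ ν₂ i₂ j₂ h₂ f hf, hν]
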